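/- For $\xi\in\mathbb R$ put $\langle\xi\rangle=\sqrt{1+\xi^2}$ and $\hat\psi(\xi)=\frac1{\sqrt{2\pi}}\int_{\mathbb R}e^{-ix\xi}\psi(x)\,dx$. For $w\ge 0$, $\ell\ge 0$ let $$\mathcal H_w^\ell=\{\psi\in L^2(\mathbb R):\ \|\psi\|_{\mathcal H_w^\ell}<\infty\},\qquad \|\psi\|_{\mathcal H_w^\ell}^2=\int_{\mathbb R}\langle\xi\rangle^{2\ell}e^{2w\langle\xi\rangle}|\hat\psi(\xi)|^2\,d\xi .$$ For $w_0,M,T>0$ with $T<w_0/M$ and $w(t)=w_0-Mt$, let $C([0,T],\mathcal H_w^\ell)$ be the set of $\psi$ with $\psi(t)\in\mathcal H^\ell_{w(t)}$ for all $t\in[0,T]$ such that $t\mapsto\mathcal F^{-1}(e^{w(t)\langle\xi\rangle}\hat\psi(t))$ is continuous from $[0,T]$ to the Sobolev space $H^\ell(\mathbb R)$; let $Y^\ell_{w,T}$ be the set of $\psi\in C([0,T],\mathcal H_w^\ell)$ with $\int_0^T\|\psi(t)\|^2_{\mathcal H^{\ell+1/2}_{w(t)}}dt<\infty$, let $X^\ell_{w,T}=Y^{\ell+1}_{w,T}\times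 Y^\ell_{w,T}$, and $$|||\psi|||^2_{\ell,T}=\max\Big(\sup_{0\le s\le T}\|\psi(s)\|^2_{\mathcal H^\ell_{w(s)}},\ 2M\int_0^T\|\psi(s)\|^2_{\mathcal H^{\ell+1/2}_{w(s)}}ds\Big).$$ Let $f(s)=\mu s^\sigma$ and $g(s)=\alpha s^\gamma$ with $\alpha,\mu\in\mathbb R$ and integers $\gamma,\sigma\ge1$. For $\varepsilon\in[0,1]$ consider, for a real-valued phase $\phi^\varepsilon$ and a complex-valued amplitude $a^\varepsilon$, the system $$\begin{cases}\partial_t\phi^\varepsilon+\frac12(\partial_x\phi^\varepsilon)^2+\frac12g(|a^\varepsilon|^2)\partial_x\phi^\varepsilon+f(|a^\varepsilon|^2)=0,&\phi^\varepsilon_{|t=0}=\phi^\varepsilon_0,\\[2pt]\partial_ta^\varepsilon+\partial_x\phi^\varepsilon\partial_xa^\varepsilon+\frac12a^\varepsilon\partial_x^2\phi^\varepsilon+\frac12\partial_x\big(g(|a^\varepsilon|^2)a^\varepsilon\big)=\frac{i\varepsilon}2\partial_x^2a^\varepsilon,&a^\varepsilon_{|t=0}=a_0^\varepsilon,\end{cases}\qquad(t,x)\in[0,T]\times\mathbb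 R.$$ **Theorem.** Let $\ell>1$ and $R\ge0$. There is $M_0>0$, depending only on $\ell$, $R$ and $\alpha,\mu,\gamma,\sigma$, such that the following holds. Let $w_0>0$, and let $(\phi_0^\varepsilon,a_0^\varepsilon)_{\varepsilon\in[0,1]}$ be a family in $\mathcal H^{\ell+1}_{w_0}\times\mathcal H^\ell_{w_0}$, with $\phi_0^\varepsilon$ real-valued and $a_0^\varepsilon$ complex-valued, such that $\|\phi_0^\varepsilon\|_{\mathcal H^{\ell+1}_{w_0}}\le R$ and $\|a_0^\varepsilon\|_{\mathcal H^{\ell}_{w_0}}\le R$ for all $\varepsilon\in[0,1]$. Then for every $M\ge M_0$, every $0<T<w_0/M$ and every $\varepsilon\in[0,1]$, the system has a unique solution $(\phi^\varepsilon,a^\varepsilon)\in X^\ell_{w,T}$, where $w(t)=w_0-Mt$, and it satisfies $$|||\phi^\varepsilon|||^2_{\ell+1,T}\le4\|\phi_0^\varepsilon\|^2_{\mathcal H^{\ell+1}_{w_0}}+\|a_0^\varepsilon\|^{4\sigma}_{\mathcal H^\ell_{w_0}},\qquad|||a^\varepsilon|||^2_{\ell,T}\le2\|a_0^\varepsilon\|^2_{\mathcal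 H^\ell_{w_0}}.$$ (Since $w>0$ on $[0,T]$, elements of $X^\ell_{w,T}$ are smooth in $x$, and the equations are understood in the classical sense.) -/

import Mathlib

open MeasureTheory Set Filter Topology
open scoped ENNReal NNReal FourierTransform

namespace WKB

noncomputable section

/-- The Japanese bracket `⟨ξ⟩ = √(1 + ξ²)`. -/
def bracket (ξ : ℝ) : ℝ := Real.sqrt (1 + ξ ^ 2)

open Classical in
/-- The Fourier transform on `L²(ℝ)` with the normalisation
`ψ̂(ξ) = (2π)^{-1/2} ∫ e^{-ixξ} ψ(x) dx`, obtained from Mathlib's Plancherel extension of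
`∫ e^{-2πixξ} ψ(x) dx` by the change of variables `ξ ↦ ξ / (2π)`.
(It is `0` outside `L²`, where it is never used.) -/
def hat (ψ : ℝ → ℂ) : ℝ → ℂ :=
  if h : MemLp ψ 2 (volume : Measure ℝ) then
    fun ξ => (((Real.sqrt (2 * Real.pi))⁻¹ : ℝ) : ℂ) *
      (𝓕 (h.toLp ψ) : Lp ℂ 2 (volume : Measure ℝ)) (ξ / (2 * Real.pi))
  else 0

/-- The squared norm `‖ψ‖² = ∫ ⟨ξ⟩^{2ℓ} e^{2w⟨ξ⟩} |ψ̂(ξ)|² dξ`, with values in `[0, ∞]`. -/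
def normSq (w ℓ : ℝ) (ψ : ℝ → ℂ) : ℝ≥0∞ :=
  ∫⁻ ξ : ℝ, ENNReal.ofReal (bracket ξ ^ (2 * ℓ) * Real.exp (2 * w * bracket ξ)) * ‖hat ψ ξ‖ₑ ^ 2

/-- `ψ ∈ 𝓗_w^ℓ`. -/
def MemH (w ℓ : ℝ) (ψ : ℝ → ℂ) : Prop :=
  MemLp ψ 2 (volume : Measure ℝ) ∧ normSq w ℓ ψ < ∞

/-- `ψ ∈ C([0,T], 𝓗_w^ℓ)` for a time dependent weight `w`: each `ψ(t)` lies in `𝓗_{w(t)}^ℓ`, and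
`t ↦ 𝓕⁻¹(e^{w(t)⟨ξ⟩} ψ̂(t))` is continuous from `[0,T]` to the Sobolev space `H^ℓ`. -/
def MemC (w : ℝ → ℝ) (T ℓ : ℝ) (ψ : ℝ → ℝ → ℂ) : Prop :=
  (∀ t ∈ Icc 0 T, MemH (w t) ℓ (ψ t)) ∧
  ∀ t₀ ∈ Icc 0 T, Tendsto
    (fun t => ∫⁻ ξ : ℝ, ENNReal.ofReal (bracket ξ ^ (2 * ℓ)) *
      ‖((Real.exp (w t * bracket ξ) : ℝ) : ℂ) * hat (ψ t) ξ
        - ((Real.exp (w t₀ * bracket ξ) : ℝ) : ℂ) * hat (ψ t₀) ξ‖ₑ ^ 2)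
    (𝓝[Icc 0 T] t₀) (𝓝 0)

/-- `ψ ∈ Y_{w,T}^ℓ = C([0,T], 𝓗_w^ℓ) ∩ L²([0,T], 𝓗_w^{ℓ+1/2})`. -/
def MemY (w : ℝ → ℝ) (T ℓ : ℝ) (ψ : ℝ → ℝ → ℂ) : Prop :=
  MemC w T ℓ ψ ∧ ∫⁻ t in Icc 0 T, normSq (w t) (ℓ + 1 / 2) (ψ t) < ∞

/-- A real valued function, seen as a complex valued one. -/
def toC (φ : ℝ → ℝ) : ℝ → ℂ := fun x => (φ x : ℂ)

/-- `(φ, a) ∈ X_{w,T}^ℓ = Y_{w,T}^{ℓ+1} × Y_{w,T}^ℓ`, with a real valued phase `φ` and a complex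
valued amplitude `a`. -/
def MemX (w : ℝ → ℝ) (T ℓ : ℝ) (φ : ℝ → ℝ → ℝ) (a : ℝ → ℝ → ℂ) : Prop :=
  MemY w T (ℓ + 1) (fun t => toC (φ t)) ∧ MemY w T ℓ a

/-- The squared norm
`|||ψ|||²_{ℓ,t} = max (sup_{0≤s≤t} ‖ψ(s)‖²_{ℓ,w(s)}, 2M ∫₀ᵗ ‖ψ(s)‖²_{ℓ+1/2,w(s)} ds)`. -/
def tripleSq (w : ℝ → ℝ) (M ℓ t : ℝ) (ψ : ℝ → ℝ → ℂ) : ℝ≥0∞ :=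
  max (⨆ s ∈ Icc 0 t, normSq (w s) ℓ (ψ s))
    (ENNReal.ofReal (2 * M) * ∫⁻ s in Icc 0 t, normSq (w s) (ℓ + 1 / 2) (ψ s))

/-- `(φ, a)` solves on `[0,T] × ℝ` the system
`∂ₜφ + ½ (∂ₓφ)² + ½ g(|a|²) ∂ₓφ + f(|a|²) = 0`,
`∂ₜa + ∂ₓφ ∂ₓa + ½ a ∂ₓ²φ + ½ ∂ₓ(g(|a|²) a) = (iε/2) ∂ₓ²a`,
with initial data `(φ₀, a₀)`. The spaces `𝓗_w^ℓ` with `w > 0` consist of (classes of) smooth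
functions, so at each time `φ(t)` and `a(t)` denote the smooth representatives, and the equations
hold in the classical sense (with one-sided time derivatives at `t = 0` and `t = T`). -/
structure IsSolution (f g : ℝ → ℝ) (ε T : ℝ) (φ₀ : ℝ → ℝ) (a₀ : ℝ → ℂ)
    (φ : ℝ → ℝ → ℝ) (a : ℝ → ℝ → ℂ) : Prop where
  smooth_phase : ∀ t ∈ Icc 0 T, ContDiff ℝ (⊤ : ℕ∞) (φ t)
  smooth_amplitude : ∀ t ∈ Icc 0 T, ContDiff ℝ (⊤ : ℕ∞) (a t)
  init_phase : φ 0 =ᵐ[volume] φ₀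
  init_amplitude : a 0 =ᵐ[volume] a₀
  eq_phase : ∀ t ∈ Icc 0 T, ∀ x : ℝ,
    HasDerivWithinAt (fun s => φ s x)
      (-(1 / 2 * deriv (φ t) x ^ 2 + 1 / 2 * g (‖a t x‖ ^ 2) * deriv (φ t) x + f (‖a t x‖ ^ 2)))
      (Icc 0 T) t
  eq_amplitude : ∀ t ∈ Icc 0 T, ∀ x : ℝ,
    HasDerivWithinAt (fun s => a s x)
      (Complex.I * (ε : ℂ) / 2 * iteratedDeriv 2 (a t) x
        - (((deriv (φ t) x : ℝ) : ℂ) * deriv (a t) x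
          + 1 / 2 * a t x * ((iteratedDeriv 2 (φ t) x : ℝ) : ℂ)
          + 1 / 2 * deriv (fun y => ((g (‖a t y‖ ^ 2) : ℝ) : ℂ) * a t y) x))
      (Icc 0 T) t

end

end WKB

/-!
The proof works with the Fourier transforms `u` of the phase and `v` of the amplitude, so that the
norms are weighted `L²` norms of `|u|` and `|v|`. In Duhamel form the system reads
`u(t) = û₀ + ∫₀ᵗ P(u,v)`, `v(t) = e^{-itεξ²/2} (v̂₀ + ∫₀ᵗ e^{irεξ²/2} A(u,v) dr)`, where `P` and `A`
(`phaseRHS`, `ampRHS`) are built from convolutions and multiplications by `iξ`.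

The shrinking weight `e^{(w₀-Mt)⟨ξ⟩}` turns the time integral into a smoothing operator: since
`e^{(w₀-Mt)⟨ξ⟩} = e^{-M(t-r)⟨ξ⟩} e^{(w₀-Mr)⟨ξ⟩}`, Young's inequality in time at each frequency bounds
the norm `|||∫₀ᵗ F|||_{s,T}` by `1/M` times the norm of `F` in `√(2M) L²([0,T], 𝓗^{s-1/2}_w)`
(`supN_duhamel_le`). This is a gain of one derivative with a small constant, and one derivative is
what the quasilinear terms lose. As `𝓗^s_w` is an algebra for `s > 1/2` (`nrm_lconv_le`, from
`⟨ξ⟩ ≤ ⟨η⟩ + ⟨ξ-η⟩`), the nonlinearities are Lipschitz on balls between the corresponding spaces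
(`intN_phaseRHS_sub_le`, `intN_ampRHS_sub_le`); the derivatives are distributed so that `P` is
measured at regularity `ℓ + 1/2` and `A` at `ℓ - 1/2 > 1/2`. Hence for `M` large, depending only on
the radius, Duhamel's operator is a contraction (`contraction`), uniformly in `ε`, because the free
evolution has modulus one. Picard's iteration gives a mild solution in the ball of radius `R + 1`
(`exists_isMild`), and the bounds of the theorem follow by absorbing the small terms
(`IsMild.supN_sq_le`).

The weight is at least `w₀ - MT > 0`, so all transforms decay exponentially, and mild solutions are
dominated uniformly in time (`WtFam`, `DecayFam`). Dominated convergence yields continuity with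
values in `𝓗^ℓ_{w(t)}`, and Fubini's theorem and the fundamental theorem of calculus yield the
classical equations (`IsMild.isSolution`).

For uniqueness, an arbitrary classical solution in the solution space is brought to mild form: its
transform has a jointly measurable version (`MemC.exists_measurable_hat`), and integrating the
equations in time at fixed `x` gives Duhamel's formula at almost every frequency
(`ae_eq_duhamel_of_hasDerivWithinAt`). Nothing bounds its norm in terms of `R` beforehand. But as
long as it agrees with the mild solution its norm is at most `R + 1`, hence at most `R + 2` for a
little longer, where the contraction estimate forces agreement; so the closed set of times up to
which the solutions agree is all of `[0,T]` (`IsMild.unique`).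
-/

namespace WKB

noncomputable section

/-! ### The `L²` norm of a nonnegative function -/

section LTwo

variable {α : Type*} [MeasurableSpace α] {μ : Measure α} {F G : α → ℝ≥0∞}

/-- The `L²` norm of a function with values in `[0, ∞]`. No finiteness is presupposed. -/
def ltwo (μ : Measure α) (F : α → ℝ≥0∞) : ℝ≥0∞ := (∫⁻ a, F a ^ 2 ∂μ) ^ (1 / 2 : ℝ)

lemma ltwo_sq (μ : Measure α) (F : α → ℝ≥0∞) : ltwo μ F ^ 2 = ∫⁻ a, F a ^ 2 ∂μ := by
  rw [ltwo, ← ENNReal.rpow_two, ← ENNReal.rpow_mul]; norm_num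

lemma sqrt_mul_sqrt (x : ℝ≥0∞) : x ^ (1 / 2 : ℝ) * x ^ (1 / 2 : ℝ) = x := by
  rw [← sq, ← ENNReal.rpow_two, ← ENNReal.rpow_mul]; norm_num

lemma ltwo_le_iff {C : ℝ≥0∞} : ltwo μ F ≤ C ↔ ∫⁻ a, F a ^ 2 ∂μ ≤ C ^ 2 := by
  rw [← ltwo_sq]
  exact (ENNReal.pow_le_pow_left_iff two_ne_zero).symm

lemma ltwo_mono_ae (h : ∀ᵐ a ∂μ, F a ≤ G a) : ltwo μ F ≤ ltwo μ G := by
  rw [ltwo_le_iff, ltwo_sq]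
  exact lintegral_mono_ae (h.mono fun a ha => by gcongr)

lemma ltwo_mono (h : ∀ a, F a ≤ G a) : ltwo μ F ≤ ltwo μ G :=
  ltwo_mono_ae (Eventually.of_forall h)

lemma ltwo_congr_ae (h : ∀ᵐ a ∂μ, F a = G a) : ltwo μ F = ltwo μ G :=
  le_antisymm (ltwo_mono_ae (h.mono fun _ ha => ha.le)) (ltwo_mono_ae (h.mono fun _ ha => ha.ge))

lemma ltwo_add_le (hF : AEMeasurable F μ) (hG : AEMeasurable G μ) :
    ltwo μ (fun a => F a + G a) ≤ ltwo μ F + ltwo μ G := by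
  have := ENNReal.lintegral_Lp_add_le hF hG (p := 2) (by norm_num)
  simpa [ltwo, ENNReal.rpow_two] using this

lemma ltwo_const_mul {c : ℝ≥0∞} (hc : c ≠ ∞) (F : α → ℝ≥0∞) :
    ltwo μ (fun a => c * F a) = c * ltwo μ F := by
  have h : ltwo μ (fun a => c * F a) ^ 2 = (c * ltwo μ F) ^ 2 := by
    rw [ltwo_sq, mul_pow, ltwo_sq]
    simp_rw [mul_pow]
    rw [lintegral_const_mul' _ _ (by finiteness)]
  exact (ENNReal.pow_right_strictMono two_ne_zero).injective h

lemma lintegral_mul_le_ltwo (hF : AEMeasurable F μ) (hG : AEMeasurable G μ) :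
    ∫⁻ a, F a * G a ∂μ ≤ ltwo μ F * ltwo μ G := by
  have := ENNReal.lintegral_mul_le_Lp_mul_Lq μ (p := 2) (q := 2)
    Real.HolderConjugate.two_two hF hG
  simpa [ltwo, ENNReal.rpow_two] using this

lemma ltwo_zero : ltwo μ (fun _ : α => 0) = 0 := by simp [ltwo]

lemma ae_eq_zero_of_ltwo_eq_zero (hF : AEMeasurable F μ) (h : ltwo μ F = 0) :
    ∀ᵐ a ∂μ, F a = 0 := by
  have h2 : ∫⁻ a, F a ^ 2 ∂μ = 0 := by rw [← ltwo_sq, h]; simp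
  rw [lintegral_eq_zero_iff' (hF.pow_const 2)] at h2
  exact h2.mono fun a ha => by simpa using ha

lemma ae_lt_top_of_ltwo (hF : AEMeasurable F μ) (h : ltwo μ F ≠ ∞) : ∀ᵐ a ∂μ, F a < ∞ := by
  have h2 : ∫⁻ a, F a ^ 2 ∂μ ≠ ∞ := by rw [← ltwo_sq]; finiteness
  refine (ae_lt_top' (hF.pow_const 2) h2).mono fun a ha => ?_
  by_contra hc
  simp only [not_lt, top_le_iff] at hc
  simp [hc] at ha

/-- Fatou's lemma for the `L²` norm. -/
lemma ltwo_liminf_le {F : ℕ → α → ℝ≥0∞} (hF : ∀ n, AEMeasurable (F n) μ) {G : α → ℝ≥0∞}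
    (hG : ∀ᵐ a ∂μ, G a ≤ liminf (fun n => F n a) atTop) :
    ltwo μ G ≤ liminf (fun n => ltwo μ (F n)) atTop := by
  have hpow : ∀ x : ℕ → ℝ≥0∞, liminf x atTop ^ 2 = liminf (fun n => x n ^ 2) atTop := fun x =>
    (pow_left_mono 2).map_liminf_of_continuousAt x (ENNReal.continuous_pow 2).continuousAt
  rw [ltwo_le_iff, hpow]
  simp_rw [ltwo_sq]
  calc ∫⁻ a, G a ^ 2 ∂μ ≤ ∫⁻ a, liminf (fun n => F n a ^ 2) atTop ∂μ := by
        refine lintegral_mono_ae (hG.mono fun a ha => ?_)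
        rw [← hpow]
        gcongr
    _ ≤ _ := lintegral_liminf_le' fun n => (hF n).pow_const 2

lemma ltwo_restrict_mono {s t : Set α} (h : s ⊆ t) :
    ltwo (μ.restrict s) F ≤ ltwo (μ.restrict t) F := by
  rw [ltwo_le_iff, ltwo_sq]
  exact lintegral_mono_set h

end LTwo

/-! ### Convolution of nonnegative functions -/

/-- The convolution of two functions on `ℝ` with values in `[0, ∞]`. -/
def lconv (F G : ℝ → ℝ≥0∞) (ξ : ℝ) : ℝ≥0∞ := ∫⁻ η, F η * G (ξ - η)

lemma lconv_comm (F G : ℝ → ℝ≥0∞) : lconv F G = lconv G F := by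
  ext ξ
  rw [lconv, lconv, ← lintegral_sub_left_eq_self _ ξ]
  simp [mul_comm]

lemma measurable_lconv {F G : ℝ → ℝ≥0∞} (hF : Measurable F) (hG : Measurable G) :
    Measurable (lconv F G) := by
  refine Measurable.lintegral_prod_right' (f := fun p : ℝ × ℝ => F p.2 * G (p.1 - p.2)) ?_
  exact (hF.comp measurable_snd).mul (hG.comp (measurable_fst.sub measurable_snd))

/-- Young's inequality `L¹ * L² ⊆ L²`. -/
lemma ltwo_lconv_le {F G : ℝ → ℝ≥0∞} (hF : Measurable F) (hG : Measurable G) :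
    ltwo volume (lconv F G) ≤ (∫⁻ η, F η) * ltwo volume G := by
  rw [ltwo_le_iff, mul_pow, ltwo_sq]
  have hGs : ∀ ξ : ℝ, Measurable fun η => G (ξ - η) := fun ξ =>
    hG.comp (measurable_const.sub measurable_id)
  have h1 : ∀ ξ, lconv F G ξ ^ 2 ≤ (∫⁻ η, F η) * ∫⁻ η, F η * G (ξ - η) ^ 2 := by
    intro ξ
    have h := lintegral_mul_le_ltwo (μ := volume) (F := fun η => F η ^ (1 / 2 : ℝ))
      (G := fun η => F η ^ (1 / 2 : ℝ) * G (ξ - η)) (hF.pow_const _).aemeasurable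
      ((hF.pow_const _).mul (hGs ξ)).aemeasurable
    simp_rw [← mul_assoc, sqrt_mul_sqrt] at h
    calc lconv F G ξ ^ 2 ≤ _ := pow_le_pow_left' h 2
      _ = _ := by
        rw [mul_pow, ltwo_sq, ltwo_sq]
        simp_rw [mul_pow, sq (_ ^ (1 / 2 : ℝ)), sqrt_mul_sqrt]
  calc ∫⁻ ξ, lconv F G ξ ^ 2 ≤ ∫⁻ ξ, (∫⁻ η, F η) * ∫⁻ η, F η * G (ξ - η) ^ 2 := lintegral_mono h1
    _ = (∫⁻ η, F η) * ∫⁻ ξ, ∫⁻ η, F η * G (ξ - η) ^ 2 := by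
        refine lintegral_const_mul _ ?_
        refine Measurable.lintegral_prod_right' (f := fun p : ℝ × ℝ => F p.2 * G (p.1 - p.2) ^ 2) ?_
        exact (hF.comp measurable_snd).mul
          ((hG.comp (measurable_fst.sub measurable_snd)).pow_const 2)
    _ = (∫⁻ η, F η) * ∫⁻ η, ∫⁻ ξ, F η * G (ξ - η) ^ 2 := by
        rw [lintegral_lintegral_swap]
        exact ((hF.comp measurable_snd).mul
          ((hG.comp (measurable_fst.sub measurable_snd)).pow_const 2)).aemeasurable
    _ = (∫⁻ η, F η) ^ 2 * ∫⁻ ξ, G ξ ^ 2 := by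
        have : ∀ η, ∫⁻ ξ, F η * G (ξ - η) ^ 2 = F η * ∫⁻ ξ, G ξ ^ 2 := by
          intro η
          have hm : Measurable fun ξ => G (ξ - η) ^ 2 :=
            (hG.comp (measurable_id.sub_const η)).pow_const 2
          rw [lintegral_const_mul _ hm, lintegral_sub_right_eq_self (fun ξ => G ξ ^ 2) η]
        simp_rw [this]
        rw [lintegral_mul_const _ hF, sq, mul_assoc]

/-! ### Weights -/

lemma one_le_bracket (ξ : ℝ) : 1 ≤ bracket ξ := by
  rw [bracket, Real.one_le_sqrt]; nlinarith [sq_nonneg ξ]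

lemma bracket_pos (ξ : ℝ) : 0 < bracket ξ := zero_lt_one.trans_le (one_le_bracket ξ)

lemma abs_le_bracket (ξ : ℝ) : |ξ| ≤ bracket ξ := by
  rw [bracket]; exact Real.abs_le_sqrt (by linarith)

lemma bracket_neg (ξ : ℝ) : bracket (-ξ) = bracket ξ := by simp [bracket]

lemma continuous_bracket : Continuous bracket := by unfold bracket; fun_prop

lemma bracket_sub_add (ξ η : ℝ) : bracket ξ ≤ bracket η + bracket (ξ - η) := by
  have h1 := bracket_pos η
  have h2 := bracket_pos (ξ - η)
  have e1 : bracket η ^ 2 = 1 + η ^ 2 := Real.sq_sqrt (by positivity)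
  have e2 : bracket (ξ - η) ^ 2 = 1 + (ξ - η) ^ 2 := Real.sq_sqrt (by positivity)
  have h3 : η * (ξ - η) ≤ bracket η * bracket (ξ - η) :=
    (le_abs_self _).trans (by
      rw [abs_mul]
      exact mul_le_mul (abs_le_bracket _) (abs_le_bracket _) (abs_nonneg _) h1.le)
  rw [show bracket ξ = Real.sqrt (1 + ξ ^ 2) from rfl]
  apply Real.sqrt_le_iff.2
  constructor
  · positivity
  · nlinarith

/-- The weight `⟨ξ⟩^s e^{w⟨ξ⟩}`. -/
def wt (w s ξ : ℝ) : ℝ≥0∞ := ENNReal.ofReal (bracket ξ ^ s * Real.exp (w * bracket ξ))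

lemma wt_ne_top (w s ξ : ℝ) : wt w s ξ ≠ ∞ := ENNReal.ofReal_ne_top

lemma wt_ne_zero (w s ξ : ℝ) : wt w s ξ ≠ 0 := by
  rw [wt, Ne, ENNReal.ofReal_eq_zero, not_le]
  exact mul_pos (Real.rpow_pos_of_pos (bracket_pos ξ) s) (Real.exp_pos _)

lemma measurable_wt_uncurry {w : ℝ → ℝ} (hw : Measurable w) (s : ℝ) :
    Measurable fun p : ℝ × ℝ => wt (w p.1) s p.2 := by
  have := continuous_bracket.measurable
  exact ENNReal.measurable_ofReal.comp (((this.comp measurable_snd).pow_const s).mul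
    (((hw.comp measurable_fst).mul (this.comp measurable_snd)).exp))

lemma measurable_wt (w s : ℝ) : Measurable (wt w s) := by
  have := continuous_bracket.measurable
  exact ENNReal.measurable_ofReal.comp ((this.pow_const s).mul ((this.const_mul w).exp))

lemma wt_add (w w' s s' ξ : ℝ) : wt (w + w') (s + s') ξ = wt w s ξ * wt w' s' ξ := by
  rw [wt, wt, wt, ← ENNReal.ofReal_mul
    (mul_pos (Real.rpow_pos_of_pos (bracket_pos ξ) s) (Real.exp_pos _)).le,
    Real.rpow_add (bracket_pos ξ), add_mul, Real.exp_add]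
  congr 1; ring

lemma wt_zero_zero (ξ : ℝ) : wt 0 0 ξ = 1 := by simp [wt]

lemma wt_mono {w w' s s' : ℝ} (hw : w ≤ w') (hs : s ≤ s') (ξ : ℝ) : wt w s ξ ≤ wt w' s' ξ := by
  refine ENNReal.ofReal_le_ofReal ?_
  have := one_le_bracket ξ
  gcongr

lemma wt_neg (w s ξ : ℝ) : wt w s (-ξ) = wt w s ξ := by simp [wt, bracket_neg]

lemma wt_zero_one (ξ : ℝ) : wt 0 1 ξ = ENNReal.ofReal (bracket ξ) := by simp [wt]

lemma one_le_wt {w s : ℝ} (hw : 0 ≤ w) (hs : 0 ≤ s) (ξ : ℝ) : 1 ≤ wt w s ξ :=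
  wt_zero_zero ξ ▸ wt_mono hw hs ξ

/-- `⟨ξ⟩ ≤ 2 max (⟨η⟩, ⟨ξ - η⟩)` for the power, and the triangle inequality for the exponential. -/
lemma wt_le_add {w s : ℝ} (hw : 0 ≤ w) (hs : 0 ≤ s) (ξ η : ℝ) :
    wt w s ξ ≤ ENNReal.ofReal (2 ^ s) *
      (wt w s η * wt w 0 (ξ - η) + wt w 0 η * wt w s (ξ - η)) := by
  have h1 := bracket_pos η
  have h2 := bracket_pos (ξ - η)
  have h3 := bracket_pos ξ
  have pw : bracket ξ ^ s ≤ 2 ^ s * (bracket η ^ s + bracket (ξ - η) ^ s) := by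
    rcases le_total (bracket η) (bracket (ξ - η)) with h | h
    · calc bracket ξ ^ s ≤ (2 * bracket (ξ - η)) ^ s :=
            Real.rpow_le_rpow h3.le (by linarith [bracket_sub_add ξ η]) hs
        _ = 2 ^ s * bracket (ξ - η) ^ s := Real.mul_rpow (by norm_num) h2.le
        _ ≤ _ := by gcongr; linarith [Real.rpow_nonneg h1.le s]
    · calc bracket ξ ^ s ≤ (2 * bracket η) ^ s :=
            Real.rpow_le_rpow h3.le (by linarith [bracket_sub_add ξ η]) hs
        _ = 2 ^ s * bracket η ^ s := Real.mul_rpow (by norm_num) h1.le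
        _ ≤ _ := by gcongr; linarith [Real.rpow_nonneg h2.le s]
  have ex : Real.exp (w * bracket ξ) ≤ Real.exp (w * bracket η) * Real.exp (w * bracket (ξ - η)) := by
    rw [← Real.exp_add, ← mul_add]
    exact Real.exp_le_exp.2 (mul_le_mul_of_nonneg_left (bracket_sub_add ξ η) hw)
  simp only [wt]
  rw [← ENNReal.ofReal_mul (by positivity), ← ENNReal.ofReal_mul (by positivity),
    ← ENNReal.ofReal_add (by positivity) (by positivity), ← ENNReal.ofReal_mul (by positivity)]
  refine ENNReal.ofReal_le_ofReal ?_
  calc _ ≤ (2 ^ s * (bracket η ^ s + bracket (ξ - η) ^ s)) *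
        (Real.exp (w * bracket η) * Real.exp (w * bracket (ξ - η))) := by gcongr
    _ = _ := by simp only [Real.rpow_zero]; ring

/-! ### The weighted norms on the Fourier side -/

/-- The norm of `𝓗_w^s` in terms of the modulus `F` of the Fourier transform. -/
def nrm (w s : ℝ) (F : ℝ → ℝ≥0∞) : ℝ≥0∞ := ltwo volume fun ξ => wt w s ξ * F ξ

lemma nrm_mono {w w' s s' : ℝ} (hw : w ≤ w') (hs : s ≤ s') {F G : ℝ → ℝ≥0∞}
    (h : ∀ᵐ ξ, F ξ ≤ G ξ) : nrm w s F ≤ nrm w' s' G :=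
  ltwo_mono_ae (h.mono fun ξ hξ => mul_le_mul' (wt_mono hw hs ξ) hξ)

lemma nrm_congr {w s : ℝ} {F G : ℝ → ℝ≥0∞} (h : ∀ᵐ ξ, F ξ = G ξ) : nrm w s F = nrm w s G :=
  ltwo_congr_ae (h.mono fun ξ hξ => by rw [hξ])

lemma nrm_add_le {w s : ℝ} {F G : ℝ → ℝ≥0∞} (hF : AEMeasurable F) (hG : AEMeasurable G) :
    nrm w s (fun ξ => F ξ + G ξ) ≤ nrm w s F + nrm w s G := by
  simp only [nrm, mul_add]
  exact ltwo_add_le ((measurable_wt w s).aemeasurable.mul hF)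
    ((measurable_wt w s).aemeasurable.mul hG)

lemma nrm_const_mul {w s : ℝ} {c : ℝ≥0∞} (hc : c ≠ ∞) (F : ℝ → ℝ≥0∞) :
    nrm w s (fun ξ => c * F ξ) = c * nrm w s F := by
  rw [nrm, nrm, ← ltwo_const_mul hc]
  congr 1; ext ξ; ring

/-- The `L²` norm of `⟨ξ⟩^{-r}`, the constant of the embedding `H^r ⊆ 𝓕L¹`. -/
def embConst (r : ℝ) : ℝ≥0∞ := ltwo volume fun ξ => wt 0 (-r) ξ

lemma embConst_ne_top {r : ℝ} (hr : 1 / 2 < r) : embConst r ≠ ∞ := by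
  rw [embConst, ltwo]
  refine ENNReal.rpow_ne_top_of_nonneg (by norm_num) (ne_of_lt ?_)
  have h := integrable_rpow_neg_one_add_norm_sq (E := ℝ) (μ := volume) (r := 2 * r)
    (by simp; linarith)
  refine lt_of_eq_of_lt (lintegral_congr fun ξ => ?_) h.lintegral_lt_top
  rw [wt, ← ENNReal.ofReal_pow (by have := bracket_pos ξ; positivity)]
  congr 1
  rw [zero_mul, Real.exp_zero, mul_one, ← Real.rpow_natCast, ← Real.rpow_mul (bracket_pos ξ).le,
    bracket, Real.sqrt_eq_rpow, ← Real.rpow_mul (by positivity)]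
  simp only [Real.norm_eq_abs, sq_abs]
  congr 1
  push_cast; ring

lemma lintegral_wt_le {F : ℝ → ℝ≥0∞} (hF : AEMeasurable F) (w r : ℝ) :
    ∫⁻ ξ, wt w 0 ξ * F ξ ≤ embConst r * nrm w r F := by
  have := lintegral_mul_le_ltwo (μ := volume) (F := fun ξ => wt 0 (-r) ξ)
    (G := fun ξ => wt w r ξ * F ξ) (measurable_wt _ _).aemeasurable
    ((measurable_wt _ _).aemeasurable.mul hF)
  simp_rw [← mul_assoc, ← wt_add] at this
  simpa [embConst, nrm] using this

/-- The tame product estimate: `𝓗_w^s ∩ 𝓗_w^r` is an algebra for `s ≥ 0` and `r > 1/2`. -/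
lemma nrm_lconv_le {w s : ℝ} (hw : 0 ≤ w) (hs : 0 ≤ s) (r : ℝ) {F G : ℝ → ℝ≥0∞}
    (hF : Measurable F) (hG : Measurable G) :
    nrm w s (lconv F G) ≤ ENNReal.ofReal (2 ^ s) * embConst r *
      (nrm w s F * nrm w r G + nrm w r F * nrm w s G) := by
  have m1 := (measurable_wt w s).mul hF
  have m2 := (measurable_wt w 0).mul hF
  have m3 := (measurable_wt w s).mul hG
  have m4 := (measurable_wt w 0).mul hG
  have key : ∀ ξ, wt w s ξ * lconv F G ξ ≤ ENNReal.ofReal (2 ^ s) *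
      (lconv (fun ξ => wt w 0 ξ * G ξ) (fun ξ => wt w s ξ * F ξ) ξ +
        lconv (fun ξ => wt w 0 ξ * F ξ) (fun ξ => wt w s ξ * G ξ) ξ) := by
    intro ξ
    rw [lconv_comm (fun ξ => wt w 0 ξ * G ξ)]
    simp only [lconv]
    have hm : Measurable fun η => wt w s η * F η * (wt w 0 (ξ - η) * G (ξ - η)) :=
      m1.mul (m4.comp (measurable_const.sub measurable_id))
    rw [← lintegral_add_left hm,
      ← lintegral_const_mul' _ _ (wt_ne_top w s ξ), ← lintegral_const_mul' _ _ (by finiteness)]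
    refine lintegral_mono fun η => ?_
    calc wt w s ξ * (F η * G (ξ - η)) ≤ (ENNReal.ofReal (2 ^ s) *
      (wt w s η * wt w 0 (ξ - η) + wt w 0 η * wt w s (ξ - η))) * (F η * G (ξ - η)) := by
          gcongr; exact wt_le_add hw hs ξ η
      _ = _ := by ring
  calc nrm w s (lconv F G) ≤ _ := ltwo_mono key
    _ ≤ ENNReal.ofReal (2 ^ s) * ((∫⁻ ξ, wt w 0 ξ * G ξ) * nrm w s F +
        (∫⁻ ξ, wt w 0 ξ * F ξ) * nrm w s G) := by
      rw [ltwo_const_mul (by finiteness)]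
      gcongr
      refine (ltwo_add_le (measurable_lconv m4 m1).aemeasurable
        (measurable_lconv m2 m3).aemeasurable).trans ?_
      exact add_le_add (ltwo_lconv_le m4 m1) (ltwo_lconv_le m2 m3)
    _ ≤ ENNReal.ofReal (2 ^ s) * ((embConst r * nrm w r G) * nrm w s F +
        (embConst r * nrm w r F) * nrm w s G) := by
      gcongr
      · exact lintegral_wt_le hG.aemeasurable w r
      · exact lintegral_wt_le hF.aemeasurable w r
    _ = _ := by ring

/-! ### Space-time norms -/

section

lemma ltwo_mul_left {α : Type*} [MeasurableSpace α] {μ : Measure α} (c : ℝ≥0∞) {F : α → ℝ≥0∞}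
    (hF : AEMeasurable F μ) : ltwo μ (fun a => c * F a) = c * ltwo μ F := by
  have h : ltwo μ (fun a => c * F a) ^ 2 = (c * ltwo μ F) ^ 2 := by
    rw [ltwo_sq, mul_pow, ltwo_sq]
    simp_rw [mul_pow]
    rw [lintegral_const_mul'' _ (hF.pow_const 2)]
  exact (ENNReal.pow_right_strictMono two_ne_zero).injective h

variable {w : ℝ → ℝ} {M T s : ℝ} {F G : ℝ → ℝ → ℝ≥0∞}

lemma measurable_wt_time (hw : Measurable w) (s ξ : ℝ) : Measurable fun r => wt (w r) s ξ :=
  ENNReal.measurable_ofReal.comp (((hw.mul_const _).exp).const_mul _)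

lemma measurable_nrm (hw : Measurable w) (s : ℝ) (hF : Measurable (Function.uncurry F)) :
    Measurable fun t => nrm (w t) s (F t) := by
  have h : Measurable fun p : ℝ × ℝ => (wt (w p.1) s p.2 * F p.1 p.2) ^ 2 :=
    ((measurable_wt_uncurry hw s).mul hF).pow_const 2
  exact h.lintegral_prod_right'.pow_const _

/-- The norm `(2M ∫₀ᵀ ‖F(t)‖²_{𝓗^s_{w(t)}} dt)^{1/2}`. -/
def intN (w : ℝ → ℝ) (M T s : ℝ) (F : ℝ → ℝ → ℝ≥0∞) : ℝ≥0∞ :=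
  ltwo (volume.restrict (Icc 0 T)) fun t => ENNReal.ofReal (√(2 * M)) * nrm (w t) s (F t)

/-- The norm `|||·|||_{s,T}`, in terms of the modulus `F` of the Fourier transform. -/
def supN (w : ℝ → ℝ) (M T s : ℝ) (F : ℝ → ℝ → ℝ≥0∞) : ℝ≥0∞ :=
  max (⨆ t ∈ Icc 0 T, nrm (w t) s (F t)) (intN w M T (s + 1 / 2) F)

lemma supN_le_iff {C : ℝ≥0∞} : supN w M T s F ≤ C ↔
    (∀ t ∈ Icc 0 T, nrm (w t) s (F t) ≤ C) ∧ intN w M T (s + 1 / 2) F ≤ C := by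
  rw [supN, max_le_iff, iSup₂_le_iff]

lemma nrm_le_supN {t : ℝ} (ht : t ∈ Icc 0 T) : nrm (w t) s (F t) ≤ supN w M T s F :=
  (supN_le_iff.1 le_rfl).1 t ht

lemma intN_le_supN : intN w M T (s + 1 / 2) F ≤ supN w M T s F := le_max_right _ _

lemma intN_mono {s' : ℝ} (hs : s ≤ s') (h : ∀ t ∈ Icc 0 T, ∀ᵐ ξ, F t ξ ≤ G t ξ) :
    intN w M T s F ≤ intN w M T s' G := by
  refine ltwo_mono_ae ((ae_restrict_iff' measurableSet_Icc).2 (Eventually.of_forall fun t ht => ?_))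
  exact mul_le_mul' le_rfl (nrm_mono le_rfl hs (h t ht))

lemma supN_mono {s' : ℝ} (hs : s ≤ s') (h : ∀ t ∈ Icc 0 T, ∀ᵐ ξ, F t ξ ≤ G t ξ) :
    supN w M T s F ≤ supN w M T s' G :=
  supN_le_iff.2 ⟨fun t ht => (nrm_mono le_rfl hs (h t ht)).trans (nrm_le_supN ht),
    (intN_mono (by linarith) h).trans intN_le_supN⟩

/-- The norms are monotone in the length of the time interval. -/
lemma supN_mono_time {T' : ℝ} (hT : T ≤ T') : supN w M T s F ≤ supN w M T' s F :=
  supN_le_iff.2 ⟨fun _ ht => nrm_le_supN ⟨ht.1, ht.2.trans hT⟩,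
    (ltwo_restrict_mono (Icc_subset_Icc_right hT)).trans intN_le_supN⟩

lemma intN_add_le (hw : Measurable w) (hF : Measurable (Function.uncurry F))
    (hG : Measurable (Function.uncurry G)) :
    intN w M T s (fun t ξ => F t ξ + G t ξ) ≤ intN w M T s F + intN w M T s G := by
  refine (ltwo_mono (G := fun t => ENNReal.ofReal (√(2 * M)) * nrm (w t) s (F t) +
    ENNReal.ofReal (√(2 * M)) * nrm (w t) s (G t)) fun t => ?_).trans
    (ltwo_add_le ((measurable_nrm hw s hF).const_mul _).aemeasurable
      ((measurable_nrm hw s hG).const_mul _).aemeasurable)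
  rw [← mul_add]
  gcongr
  exact nrm_add_le (hF.comp measurable_prodMk_left).aemeasurable
    (hG.comp measurable_prodMk_left).aemeasurable

lemma supN_add_le (hw : Measurable w) (hF : Measurable (Function.uncurry F))
    (hG : Measurable (Function.uncurry G)) :
    supN w M T s (fun t ξ => F t ξ + G t ξ) ≤ supN w M T s F + supN w M T s G :=
  supN_le_iff.2 ⟨fun _ ht => (nrm_add_le (hF.comp measurable_prodMk_left).aemeasurable
    (hG.comp measurable_prodMk_left).aemeasurable).trans
      (add_le_add (nrm_le_supN ht) (nrm_le_supN ht)),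
    (intN_add_le hw hF hG).trans (add_le_add intN_le_supN intN_le_supN)⟩

lemma intN_const_mul {c : ℝ≥0∞} (hc : c ≠ ∞) (F : ℝ → ℝ → ℝ≥0∞) :
    intN w M T s (fun t ξ => c * F t ξ) = c * intN w M T s F := by
  rw [intN, intN, ← ltwo_const_mul hc]
  congr 1; ext t
  rw [nrm_const_mul hc]; ring

lemma measurable_lconv_uncurry (hF : Measurable (Function.uncurry F))
    (hG : Measurable (Function.uncurry G)) :
    Measurable (Function.uncurry fun t => lconv (F t) (G t)) := by
  refine Measurable.lintegral_prod_right'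
    (f := fun p : (ℝ × ℝ) × ℝ => F p.1.1 p.2 * G p.1.1 (p.1.2 - p.2)) ?_
  exact (hF.comp ((measurable_fst.comp measurable_fst).prodMk measurable_snd)).mul
    (hG.comp ((measurable_fst.comp measurable_fst).prodMk
      ((measurable_snd.comp measurable_fst).sub measurable_snd)))

/-- The constant of the product estimates at regularity `s`. -/
def algConst (s : ℝ) : ℝ≥0∞ := 2 * (ENNReal.ofReal (2 ^ (s + 1 / 2)) * embConst s)

lemma algConst_ne_top (hs : 1 / 2 < s) : algConst s ≠ ∞ := by
  have := embConst_ne_top hs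
  unfold algConst; finiteness

/-- The space-time norm is submultiplicative up to a constant. -/
lemma supN_lconv_le (hw : Measurable w) (hw0 : ∀ t ∈ Icc 0 T, 0 ≤ w t) (hs : 1 / 2 < s)
    (hF : Measurable (Function.uncurry F)) (hG : Measurable (Function.uncurry G)) :
    supN w M T s (fun t => lconv (F t) (G t)) ≤
      algConst s * (supN w M T s F * supN w M T s G) := by
  have mF : ∀ t, Measurable (F t) := fun t => hF.comp measurable_prodMk_left
  have mG : ∀ t, Measurable (G t) := fun t => hG.comp measurable_prodMk_left
  have e : (2 : ℝ) ^ s ≤ 2 ^ (s + 1 / 2) :=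
    Real.rpow_le_rpow_of_exponent_le (by norm_num) (by linarith)
  set C := ENNReal.ofReal (2 ^ (s + 1 / 2)) * embConst s with hC
  refine supN_le_iff.2 ⟨fun t ht => ?_, ?_⟩
  · calc nrm (w t) s (lconv (F t) (G t)) ≤ ENNReal.ofReal (2 ^ s) * embConst s *
          (nrm (w t) s (F t) * nrm (w t) s (G t) + nrm (w t) s (F t) * nrm (w t) s (G t)) :=
          nrm_lconv_le (hw0 t ht) (by linarith) s (mF t) (mG t)
      _ ≤ C * (supN w M T s F * supN w M T s G + supN w M T s F * supN w M T s G) := by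
        refine mul_le_mul' (mul_le_mul' (ENNReal.ofReal_le_ofReal e) le_rfl) ?_
        gcongr <;> exact nrm_le_supN ht
      _ = _ := by rw [algConst, ← hC]; ring
  · set c := ENNReal.ofReal (√(2 * M)) with hc
    have i1 := (measurable_nrm hw (s + 1 / 2) hF).const_mul c
    have i2 := (measurable_nrm hw (s + 1 / 2) hG).const_mul c
    calc intN w M T (s + 1 / 2) (fun t => lconv (F t) (G t)) ≤
        ltwo (volume.restrict (Icc 0 T)) (fun t =>
          C * supN w M T s G * (c * nrm (w t) (s + 1 / 2) (F t)) +
          C * supN w M T s F * (c * nrm (w t) (s + 1 / 2) (G t))) := by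
          refine ltwo_mono_ae ((ae_restrict_iff' measurableSet_Icc).2
            (Eventually.of_forall fun t ht => ?_))
          calc _ ≤ c * (C * (nrm (w t) (s + 1 / 2) (F t) * nrm (w t) s (G t) +
                nrm (w t) s (F t) * nrm (w t) (s + 1 / 2) (G t))) := by
                gcongr
                exact nrm_lconv_le (hw0 t ht) (by linarith) s (mF t) (mG t)
            _ ≤ c * (C * (nrm (w t) (s + 1 / 2) (F t) * supN w M T s G +
                supN w M T s F * nrm (w t) (s + 1 / 2) (G t))) := by
                gcongr <;> exact nrm_le_supN ht
            _ = _ := by ring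
      _ ≤ C * supN w M T s G * intN w M T (s + 1 / 2) F +
          C * supN w M T s F * intN w M T (s + 1 / 2) G := by
          refine (ltwo_add_le (i1.const_mul _).aemeasurable (i2.const_mul _).aemeasurable).trans ?_
          rw [ltwo_mul_left _ i1.aemeasurable, ltwo_mul_left _ i2.aemeasurable]
          exact le_rfl
      _ ≤ C * supN w M T s G * supN w M T s F + C * supN w M T s F * supN w M T s G := by
          gcongr <;> exact intN_le_supN
      _ = _ := by rw [algConst, ← hC]; ring

/-- The product estimate for a factor that is only square integrable in time. -/
lemma intN_lconv_le (hw : Measurable w) (hw0 : ∀ t ∈ Icc 0 T, 0 ≤ w t) (hs : 1 / 2 < s)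
    {s' : ℝ} (hs' : s ≤ s')
    (hF : Measurable (Function.uncurry F)) (hG : Measurable (Function.uncurry G)) :
    intN w M T s (fun t => lconv (F t) (G t)) ≤
      algConst s * (supN w M T s' F * intN w M T s G) := by
  have mF : ∀ t, Measurable (F t) := fun t => hF.comp measurable_prodMk_left
  have mG : ∀ t, Measurable (G t) := fun t => hG.comp measurable_prodMk_left
  have e : (2 : ℝ) ^ s ≤ 2 ^ (s + 1 / 2) :=
    Real.rpow_le_rpow_of_exponent_le (by norm_num) (by linarith)
  set c := ENNReal.ofReal (√(2 * M)) with hc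
  have i2 := (measurable_nrm hw s hG).const_mul c
  calc intN w M T s (fun t => lconv (F t) (G t)) ≤
      ltwo (volume.restrict (Icc 0 T)) (fun t =>
        (algConst s * supN w M T s' F) * (c * nrm (w t) s (G t))) := by
        refine ltwo_mono_ae ((ae_restrict_iff' measurableSet_Icc).2
          (Eventually.of_forall fun t ht => ?_))
        calc _ ≤ c * (ENNReal.ofReal (2 ^ (s + 1 / 2)) * embConst s *
              (nrm (w t) s (F t) * nrm (w t) s (G t) +
              nrm (w t) s (F t) * nrm (w t) s (G t))) := by
              gcongr
              refine (nrm_lconv_le (hw0 t ht) (by linarith) s (mF t) (mG t)).trans ?_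
              gcongr
          _ = c * (algConst s * (nrm (w t) s (F t) * nrm (w t) s (G t))) := by
              rw [algConst]; ring
          _ ≤ c * (algConst s * (supN w M T s' F * nrm (w t) s (G t))) := by
              gcongr
              exact (nrm_mono le_rfl hs' (Eventually.of_forall fun _ => le_rfl)).trans
                (nrm_le_supN ht)
          _ = _ := by ring
    _ = _ := by rw [ltwo_mul_left _ i2.aemeasurable, mul_assoc]; rfl

/-! ### The Duhamel estimate -/

/-- Square integration in time and frequency may be performed in either order. -/
lemma intN_eq (hw : Measurable w) (hF : Measurable (Function.uncurry F)) :
    intN w M T s F = ltwo volume fun ξ => ltwo (volume.restrict (Icc 0 T)) fun t =>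
      ENNReal.ofReal (√(2 * M)) * (wt (w t) s ξ * F t ξ) := by
  apply (ENNReal.pow_right_strictMono two_ne_zero).injective
  change intN w M T s F ^ 2 = ltwo _ _ ^ 2
  rw [intN, ltwo_sq, ltwo_sq]
  simp_rw [nrm, ← ltwo_const_mul ENNReal.ofReal_ne_top, ltwo_sq]
  rw [lintegral_lintegral_swap]
  exact ((((measurable_wt_uncurry hw s).mul hF).const_mul _).pow_const 2).aemeasurable

/-- The causal exponential kernel. -/
def expKernel (c τ : ℝ) : ℝ≥0∞ := (Ici 0).indicator (fun τ => ENNReal.ofReal (Real.exp (-(c * τ)))) τ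

lemma measurable_expKernel (c : ℝ) : Measurable (expKernel c) := by
  refine Measurable.indicator ?_ measurableSet_Ici
  fun_prop

lemma lintegral_expKernel {c : ℝ} (hc : 0 < c) : ∫⁻ τ, expKernel c τ = ENNReal.ofReal (1 / c) := by
  have h1 : IntegrableOn (fun τ => Real.exp (-c * τ)) (Ioi 0) :=
    integrableOn_exp_mul_Ioi (by linarith) 0
  have h2 := integral_exp_mul_Ioi (a := -c) (by linarith) 0
  unfold expKernel
  rw [lintegral_indicator measurableSet_Ici, ← restrict_Ioi_eq_restrict_Ici]
  simp_rw [← neg_mul]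
  rw [← ofReal_integral_eq_lintegral_ofReal h1 (Eventually.of_forall fun _ => (Real.exp_pos _).le),
    h2]
  congr 1
  simp [neg_div_neg_eq]

lemma lintegral_expKernel_sub {c : ℝ} (hc : 0 < c) (t : ℝ) :
    ∫⁻ r, expKernel c (t - r) = ENNReal.ofReal (1 / c) := by
  rw [lintegral_sub_left_eq_self (expKernel c) t, lintegral_expKernel hc]

lemma wt_eq_expKernel {τ : ℝ} (hτ : 0 ≤ τ) (c s ξ : ℝ) :
    wt (-(c * τ)) s ξ = ENNReal.ofReal (bracket ξ ^ s) * expKernel (c * bracket ξ) τ := by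
  rw [wt, expKernel, indicator_of_mem (by exact hτ), ENNReal.ofReal_mul
    (Real.rpow_nonneg (bracket_pos ξ).le _)]
  congr 3; ring

lemma ofReal_sqrt_sq {x : ℝ} (hx : 0 ≤ x) : ENNReal.ofReal (√x) ^ 2 = ENNReal.ofReal x := by
  rw [← ENNReal.ofReal_pow (Real.sqrt_nonneg _), Real.sq_sqrt hx]

/-- The parabolic gain of half a derivative of the weight `e^{-Mt⟨ξ⟩}`. -/
lemma ltwo_wt_half_le (hM : 0 < M) (ξ t : ℝ) :
    ltwo (volume.restrict (Icc 0 t)) (fun r => wt (-(M * (t - r))) (1 / 2) ξ) ≤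
      ENNReal.ofReal (√(1 / (2 * M))) := by
  have hb := bracket_pos ξ
  rw [ltwo_le_iff, ofReal_sqrt_sq (by positivity)]
  calc ∫⁻ r in Icc 0 t, wt (-(M * (t - r))) (1 / 2) ξ ^ 2 ≤
      ∫⁻ r in Icc 0 t, ENNReal.ofReal (bracket ξ) * expKernel (2 * M * bracket ξ) (t - r) := by
        refine lintegral_mono_ae ((ae_restrict_iff' measurableSet_Icc).2
          (Eventually.of_forall fun r hr => le_of_eq ?_))
        rw [sq, ← wt_add, show -(M * (t - r)) + -(M * (t - r)) = -(2 * M * (t - r)) by ring,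
          wt_eq_expKernel (by linarith [hr.2])]
        norm_num
    _ ≤ ∫⁻ r, ENNReal.ofReal (bracket ξ) * expKernel (2 * M * bracket ξ) (t - r) :=
        setLIntegral_le_lintegral _ _
    _ = ENNReal.ofReal (1 / (2 * M)) := by
        rw [lintegral_const_mul' _ _ ENNReal.ofReal_ne_top, lintegral_expKernel_sub (by positivity),
          ← ENNReal.ofReal_mul hb.le]
        congr 1; field_simp

/-- The bound of a Duhamel integral, uniformly in time and at each frequency. -/
lemma wt_mul_duhamel_le {w₀ : ℝ} (hM : 0 < M) (hF : Measurable (Function.uncurry F)) {t : ℝ}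
    (ht : t ∈ Icc 0 T) (ξ : ℝ) :
    wt (w₀ - M * t) s ξ * ∫⁻ r in Icc 0 t, F r ξ ≤ ENNReal.ofReal (1 / (2 * M)) *
      ltwo (volume.restrict (Icc 0 T)) fun r =>
        ENNReal.ofReal (√(2 * M)) * (wt (w₀ - M * r) (s - 1 / 2) ξ * F r ξ) := by
  have hw : Measurable fun r : ℝ => w₀ - M * r := by fun_prop
  have hm : Measurable fun r => wt (w₀ - M * r) (s - 1 / 2) ξ * F r ξ :=
    (measurable_wt_time hw _ _).mul (hF.comp measurable_prodMk_right)
  have hm2 : Measurable fun r => wt (-(M * (t - r))) (1 / 2) ξ :=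
    measurable_wt_time (by fun_prop) _ _
  calc wt (w₀ - M * t) s ξ * ∫⁻ r in Icc 0 t, F r ξ
      = ∫⁻ r in Icc 0 t, wt (-(M * (t - r))) (1 / 2) ξ *
          (wt (w₀ - M * r) (s - 1 / 2) ξ * F r ξ) := by
        rw [← lintegral_const_mul' _ _ (wt_ne_top _ _ _)]
        refine lintegral_congr fun r => ?_
        rw [← mul_assoc, ← wt_add]
        congr 2 <;> ring
    _ ≤ _ := lintegral_mul_le_ltwo hm2.aemeasurable hm.aemeasurable
    _ ≤ ENNReal.ofReal (√(1 / (2 * M))) * ltwo (volume.restrict (Icc 0 T)) fun r =>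
          wt (w₀ - M * r) (s - 1 / 2) ξ * F r ξ :=
        mul_le_mul' (ltwo_wt_half_le hM ξ t) (ltwo_restrict_mono (Icc_subset_Icc_right ht.2))
    _ = _ := by
        rw [ltwo_const_mul ENNReal.ofReal_ne_top, ← mul_assoc, ← ENNReal.ofReal_mul (by positivity)]
        congr 2
        rw [Real.sqrt_div' _ (by positivity), Real.sqrt_one]
        have h2 : √(2 * M) ^ 2 = 2 * M := Real.sq_sqrt (by positivity)
        have h3 : 0 < √(2 * M) := Real.sqrt_pos.2 (by positivity)
        field_simp
        linarith

lemma measurable_duhamel (hF : Measurable (Function.uncurry F)) :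
    Measurable (Function.uncurry fun t ξ => ∫⁻ r in Icc 0 t, F r ξ) := by
  have : (Function.uncurry fun t ξ => ∫⁻ r in Icc 0 t, F r ξ) =
      fun p : ℝ × ℝ => ∫⁻ r, {q : (ℝ × ℝ) × ℝ | 0 ≤ q.2 ∧ q.2 ≤ q.1.1}.indicator
        (fun q => F q.2 q.1.2) (p, r) := by
    ext ⟨t, ξ⟩
    rw [Function.uncurry, ← lintegral_indicator measurableSet_Icc]
    rfl
  rw [this]
  refine Measurable.lintegral_prod_right' (Measurable.indicator ?_ ?_)
  · exact hF.comp (measurable_snd.prodMk (measurable_snd.comp measurable_fst))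
  · exact (measurableSet_le measurable_const measurable_snd).inter
      (measurableSet_le measurable_snd (measurable_fst.comp measurable_fst))

/-- A Duhamel integral gains one derivative, split evenly between source and solution, with a
factor `1 / M`. -/
lemma supN_duhamel_le {w₀ : ℝ} (hM : 0 < M) (hF : Measurable (Function.uncurry F)) :
    supN (fun t => w₀ - M * t) M T s (fun t ξ => ∫⁻ r in Icc 0 t, F r ξ) ≤
      ENNReal.ofReal (1 / M) * intN (fun t => w₀ - M * t) M T (s - 1 / 2) F := by
  have hw : Measurable fun r : ℝ => w₀ - M * r := by fun_prop
  refine supN_le_iff.2 ⟨fun t ht => ?_, ?_⟩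
  · calc _ ≤ _ := ltwo_mono fun ξ => wt_mul_duhamel_le hM hF ht ξ
      _ = ENNReal.ofReal (1 / (2 * M)) * intN (fun t => w₀ - M * t) M T (s - 1 / 2) F := by
        rw [ltwo_const_mul ENNReal.ofReal_ne_top, intN_eq hw hF]
      _ ≤ _ := by
        gcongr
        linarith
  · rw [intN_eq hw (measurable_duhamel hF), intN_eq hw hF, ← ltwo_const_mul ENNReal.ofReal_ne_top]
    refine ltwo_mono fun ξ => ?_
    have hb := bracket_pos ξ
    set H : ℝ → ℝ≥0∞ := (Icc 0 T).indicator fun r =>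
      ENNReal.ofReal (√(2 * M)) * (wt (w₀ - M * r) (s - 1 / 2) ξ * F r ξ) with hH
    have mH : Measurable H := by
      refine Measurable.indicator (Measurable.const_mul ?_ _) measurableSet_Icc
      exact (measurable_wt_time hw _ _).mul (hF.comp measurable_prodMk_right)
    set k : ℝ → ℝ≥0∞ := fun τ => ENNReal.ofReal (bracket ξ) * expKernel (M * bracket ξ) τ with hk
    have mk : Measurable k := (measurable_expKernel _).const_mul _
    have ik : ∫⁻ τ, k τ = ENNReal.ofReal (1 / M) := by
      rw [hk, lintegral_const_mul' _ _ ENNReal.ofReal_ne_top, lintegral_expKernel (by positivity),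
          ← ENNReal.ofReal_mul hb.le]
      congr 1; field_simp
    have nH : ltwo volume H = ltwo (volume.restrict (Icc 0 T)) fun r =>
        ENNReal.ofReal (√(2 * M)) * (wt (w₀ - M * r) (s - 1 / 2) ξ * F r ξ) := by
      unfold ltwo
      rw [← lintegral_indicator measurableSet_Icc]
      congr 2; ext r
      by_cases hr : r ∈ Icc 0 T <;> simp [hH, hr]
    calc _ ≤ ltwo (volume.restrict (Icc 0 T)) (lconv k H) := by
          refine ltwo_mono_ae ((ae_restrict_iff' measurableSet_Icc).2
            (Eventually.of_forall fun t ht => ?_))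
          rw [lconv_comm, lconv, ← lintegral_const_mul' _ _ (wt_ne_top _ _ _),
            ← lintegral_const_mul' _ _ ENNReal.ofReal_ne_top,
            ← lintegral_indicator measurableSet_Icc]
          refine lintegral_mono fun r => ?_
          by_cases hr : r ∈ Icc 0 t
          · rw [indicator_of_mem hr, hH, indicator_of_mem (Icc_subset_Icc_right ht.2 hr), hk,
              show w₀ - M * t = w₀ - M * r + -(M * (t - r)) by ring,
              show s + 1 / 2 = s - 1 / 2 + 1 by ring, wt_add, wt_eq_expKernel (by linarith [hr.2])]
            rw [Real.rpow_one]
            exact le_of_eq (by ring)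
          · rw [indicator_of_notMem hr]; exact zero_le
      _ ≤ ltwo volume (lconv k H) := by
          rw [← Measure.restrict_univ (μ := (volume : Measure ℝ)),
            Measure.restrict_restrict_of_subset (subset_univ _)]
          exact ltwo_restrict_mono (subset_univ _)
      _ ≤ (∫⁻ τ, k τ) * ltwo volume H := ltwo_lconv_le mk mH
      _ = _ := by rw [ik, nH]

/-- The free evolution is bounded by the initial data. -/
lemma supN_const_le {w₀ : ℝ} (hM : 0 < M) {F : ℝ → ℝ≥0∞} (hF : Measurable F) :
    supN (fun t => w₀ - M * t) M T s (fun _ => F) ≤ nrm w₀ s F := by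
  have hw : Measurable fun r : ℝ => w₀ - M * r := by fun_prop
  refine supN_le_iff.2 ⟨fun t ht => nrm_mono (by nlinarith [ht.1]) le_rfl
    (Eventually.of_forall fun _ => le_rfl), ?_⟩
  rw [intN_eq (F := fun _ => F) hw (hF.comp measurable_snd)]
  refine ltwo_mono fun ξ => ?_
  have hb := bracket_pos ξ
  rw [ltwo_le_iff]
  calc ∫⁻ t in Icc 0 T, (ENNReal.ofReal (√(2 * M)) * (wt (w₀ - M * t) (s + 1 / 2) ξ * F ξ)) ^ 2
      ≤ ∫⁻ t in Icc 0 T, (ENNReal.ofReal (2 * M) * ENNReal.ofReal (bracket ξ) *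
          (wt w₀ s ξ * F ξ) ^ 2) * expKernel (2 * M * bracket ξ) t := by
        refine lintegral_mono_ae ((ae_restrict_iff' measurableSet_Icc).2
          (Eventually.of_forall fun t ht => le_of_eq ?_))
        rw [show w₀ - M * t = w₀ + -(M * t) by ring, wt_add, mul_pow, ofReal_sqrt_sq (by positivity),
          mul_pow, mul_pow, sq (wt (-(M * t)) _ _), ← wt_add,
          show -(M * t) + -(M * t) = -(2 * M * t) by ring, wt_eq_expKernel ht.1]
        norm_num
        ring
    _ ≤ ∫⁻ t, (ENNReal.ofReal (2 * M) * ENNReal.ofReal (bracket ξ) *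
          (wt w₀ s ξ * F ξ) ^ 2) * expKernel (2 * M * bracket ξ) t :=
        setLIntegral_le_lintegral _ _
    _ = _ := by
        rw [lintegral_const_mul _ (measurable_expKernel _), lintegral_expKernel (by positivity),
          mul_comm, ← mul_assoc, ← ENNReal.ofReal_mul (by positivity),
          ← ENNReal.ofReal_mul (by positivity)]
        have : 1 / (2 * M * bracket ξ) * (2 * M * bracket ξ) = 1 := by field_simp
        rw [this]; simp

end

/-! ### The nonlinearity on the Fourier side -/

section

/-- The constant `(2π)^{-1/2}`. -/
def fourierConst : ℂ := (((Real.sqrt (2 * Real.pi))⁻¹ : ℝ) : ℂ)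

/-- The convolution normalised so that it corresponds to the product of functions under the
Fourier transform with the unitary normalisation. -/
def conv (f g : ℝ → ℂ) (ξ : ℝ) : ℂ := fourierConst * ∫ η, f η * g (ξ - η)

/-- Multiplication by `iξ`, the derivative on the Fourier side. -/
def dHat (f : ℝ → ℂ) (ξ : ℝ) : ℂ := Complex.I * (ξ : ℂ) * f ξ

/-- Complex conjugation on the Fourier side, `f ↦ conj f(-ξ)`. -/
def conjHat (f : ℝ → ℂ) (ξ : ℝ) : ℂ := (starRingEnd ℂ) (f (-ξ))

/-- `convPow f n` is the convolution of `n + 1` copies of `f`: there is no unit for the convolution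
of functions. -/
def convPow (f : ℝ → ℂ) : ℕ → ℝ → ℂ
  | 0 => f
  | n + 1 => conv f (convPow f n)

/-- The Fourier transform of `|a|²`, in terms of that of `a`. -/
def modSq (v : ℝ → ℂ) : ℝ → ℂ := conv v (conjHat v)

/-- The Fourier transform of `∂ₜφ` for the system with `f(s) = μ s^{m+1}`, `g(s) = α s^{n+1}`, in
terms of the Fourier transforms `u` of `φ` and `v` of `a`. -/
def phaseRHS (α μ : ℝ) (n m : ℕ) (u v : ℝ → ℂ) (ξ : ℝ) : ℂ :=
  -(1 / 2 * conv (dHat u) (dHat u) ξ + (α : ℂ) / 2 * conv (convPow (modSq v) n) (dHat u) ξ +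
    (μ : ℂ) * convPow (modSq v) m ξ)

/-- The Fourier transform of the nonlinear part of `∂ₜa` for the system with `g(s) = α s^{n+1}`. -/
def ampRHS (α : ℝ) (n : ℕ) (u v : ℝ → ℂ) (ξ : ℝ) : ℂ :=
  -(conv (dHat u) (dHat v) ξ + 1 / 2 * conv v (dHat (dHat u)) ξ +
    (α : ℂ) / 2 * dHat (conv (convPow (modSq v) n) v) ξ)

lemma enorm_fourierConst_le : ‖fourierConst‖ₑ ≤ 1 := by
  have h : ‖fourierConst‖ ≤ 1 := by
    rw [fourierConst, Complex.norm_real, Real.norm_of_nonneg (by positivity)]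
    refine inv_le_one_of_one_le₀ ?_
    rw [Real.one_le_sqrt]
    linarith [Real.pi_gt_three]
  rw [← ofReal_norm]
  exact ENNReal.ofReal_le_one.2 h

lemma enorm_conv_le (f g : ℝ → ℂ) (ξ : ℝ) :
    ‖conv f g ξ‖ₑ ≤ lconv (fun ξ => ‖f ξ‖ₑ) (fun ξ => ‖g ξ‖ₑ) ξ := by
  rw [conv, enorm_mul]
  calc _ ≤ 1 * ‖∫ η, f η * g (ξ - η)‖ₑ := by gcongr; exact enorm_fourierConst_le
    _ ≤ _ := by
      rw [one_mul]
      refine (enorm_integral_le_lintegral_enorm _).trans (le_of_eq ?_)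
      simp_rw [enorm_mul]; rfl

lemma ltwo_comp_sub {G : ℝ → ℝ≥0∞} (ξ : ℝ) :
    ltwo volume (fun η => G (ξ - η)) = ltwo volume G := by
  rw [ltwo, ltwo, lintegral_sub_left_eq_self (fun η => G η ^ 2) ξ]

/-- The convolution integral of two square integrable functions converges at every point. -/
lemma integrable_conv {f g : ℝ → ℂ} (hf : Measurable f) (hg : Measurable g)
    (hf' : ltwo volume (fun ξ => ‖f ξ‖ₑ) ≠ ∞) (hg' : ltwo volume (fun ξ => ‖g ξ‖ₑ) ≠ ∞) (ξ : ℝ) :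
    Integrable fun η => f η * g (ξ - η) := by
  have hgm : Measurable fun η => g (ξ - η) := hg.comp (measurable_const.sub measurable_id)
  refine ⟨(hf.mul hgm).aestronglyMeasurable, ?_⟩
  have := lintegral_mul_le_ltwo (μ := volume) hf.enorm.aemeasurable hgm.enorm.aemeasurable
  rw [ltwo_comp_sub (G := fun η => ‖g η‖ₑ)] at this
  rw [HasFiniteIntegral]
  simp_rw [enorm_mul]
  exact this.trans_lt (by finiteness)

lemma enorm_conv_sub_le {f g f' g' : ℝ → ℂ} (hf : Measurable f) (hg : Measurable g)
    (hf' : Measurable f') (hg' : Measurable g')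
    (nf : ltwo volume (fun ξ => ‖f ξ‖ₑ) ≠ ∞) (ng : ltwo volume (fun ξ => ‖g ξ‖ₑ) ≠ ∞)
    (nf' : ltwo volume (fun ξ => ‖f' ξ‖ₑ) ≠ ∞) (ng' : ltwo volume (fun ξ => ‖g' ξ‖ₑ) ≠ ∞) (ξ : ℝ) :
    ‖conv f g ξ - conv f' g' ξ‖ₑ ≤
      lconv (fun ξ => ‖f ξ - f' ξ‖ₑ) (fun ξ => ‖g ξ‖ₑ) ξ +
      lconv (fun ξ => ‖f' ξ‖ₑ) (fun ξ => ‖g ξ - g' ξ‖ₑ) ξ := by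
  have e : conv f g ξ - conv f' g' ξ = conv (fun ξ => f ξ - f' ξ) g ξ +
      conv f' (fun ξ => g ξ - g' ξ) ξ := by
    have i1 := integrable_conv hf hg nf ng ξ
    have i2 := integrable_conv hf' hg nf' ng ξ
    have i3 := integrable_conv hf' hg' nf' ng' ξ
    simp only [conv]
    simp_rw [sub_mul, mul_sub]
    rw [integral_sub i1 i2, integral_sub i2 i3]
    ring
  rw [e]
  exact (enorm_add_le _ _).trans (add_le_add (enorm_conv_le _ _ _) (enorm_conv_le _ _ _))

lemma measurable_conv_uncurry {f g : ℝ → ℝ → ℂ} (hf : Measurable (Function.uncurry f))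
    (hg : Measurable (Function.uncurry g)) :
    Measurable (Function.uncurry fun t => conv (f t) (g t)) := by
  refine Measurable.const_mul ?_ _
  have : Measurable fun p : (ℝ × ℝ) × ℝ => f p.1.1 p.2 * g p.1.1 (p.1.2 - p.2) :=
    (hf.comp ((measurable_fst.comp measurable_fst).prodMk measurable_snd)).mul
      (hg.comp ((measurable_fst.comp measurable_fst).prodMk
        ((measurable_snd.comp measurable_fst).sub measurable_snd)))
  exact this.stronglyMeasurable.integral_prod_right'.measurable

lemma measurable_dHat_uncurry {f : ℝ → ℝ → ℂ} (hf : Measurable (Function.uncurry f)) :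
    Measurable (Function.uncurry fun t => dHat (f t)) :=
  ((Complex.measurable_ofReal.comp measurable_snd).const_mul _).mul hf

lemma measurable_conjHat_uncurry {f : ℝ → ℝ → ℂ} (hf : Measurable (Function.uncurry f)) :
    Measurable (Function.uncurry fun t => conjHat (f t)) :=
  Complex.continuous_conj.measurable.comp
    (hf.comp (measurable_fst.prodMk measurable_snd.neg))

lemma measurable_convPow_uncurry {f : ℝ → ℝ → ℂ} (hf : Measurable (Function.uncurry f)) (n : ℕ) :
    Measurable (Function.uncurry fun t => convPow (f t) n) := by
  induction n with
  | zero => exact hf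
  | succ n ih => exact measurable_conv_uncurry hf ih

lemma measurable_modSq_uncurry {f : ℝ → ℝ → ℂ} (hf : Measurable (Function.uncurry f)) :
    Measurable (Function.uncurry fun t => modSq (f t)) :=
  measurable_conv_uncurry hf (measurable_conjHat_uncurry hf)

lemma measurable_phaseRHS_uncurry (α μ : ℝ) (n m : ℕ) {u v : ℝ → ℝ → ℂ}
    (hu : Measurable (Function.uncurry u)) (hv : Measurable (Function.uncurry v)) :
    Measurable (Function.uncurry fun t => phaseRHS α μ n m (u t) (v t)) := by
  have hD := measurable_dHat_uncurry hu
  have hm := measurable_modSq_uncurry hv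
  exact ((((measurable_conv_uncurry hD hD).const_mul _).add
    ((measurable_conv_uncurry (measurable_convPow_uncurry hm n) hD).const_mul _)).add
    ((measurable_convPow_uncurry hm m).const_mul _)).neg

lemma measurable_ampRHS_uncurry (α : ℝ) (n : ℕ) {u v : ℝ → ℝ → ℂ}
    (hu : Measurable (Function.uncurry u)) (hv : Measurable (Function.uncurry v)) :
    Measurable (Function.uncurry fun t => ampRHS α n (u t) (v t)) := by
  have hD := measurable_dHat_uncurry hu
  have hm := measurable_modSq_uncurry hv
  exact (((measurable_conv_uncurry hD (measurable_dHat_uncurry hv)).add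
    ((measurable_conv_uncurry hv (measurable_dHat_uncurry hD)).const_mul _)).add
    ((measurable_dHat_uncurry (measurable_conv_uncurry
      (measurable_convPow_uncurry hm n) hv)).const_mul _)).neg

/-! ### Lipschitz estimates -/

lemma nrm_dHat_le (w s : ℝ) (f : ℝ → ℂ) :
    nrm w s (fun ξ => ‖dHat f ξ‖ₑ) ≤ nrm w (s + 1) (fun ξ => ‖f ξ‖ₑ) := by
  refine ltwo_mono fun ξ => ?_
  have h : ‖dHat f ξ‖ₑ ≤ wt 0 1 ξ * ‖f ξ‖ₑ := by
    rw [dHat, enorm_mul, enorm_mul, wt_zero_one]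
    gcongr
    rw [← ofReal_norm, ← ofReal_norm, Complex.norm_I, ENNReal.ofReal_one, one_mul,
      Complex.norm_real]
    exact ENNReal.ofReal_le_ofReal (abs_le_bracket ξ)
  calc _ ≤ wt w s ξ * (wt 0 1 ξ * ‖f ξ‖ₑ) := by gcongr
    _ = _ := by rw [← mul_assoc, ← wt_add, add_zero]

lemma nrm_comp_neg (w s : ℝ) (F : ℝ → ℝ≥0∞) : nrm w s (fun ξ => F (-ξ)) = nrm w s F := by
  have h := lintegral_neg_eq_self (μ := (volume : Measure ℝ)) (fun ξ => (wt w s ξ * F ξ) ^ 2)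
  simp only [wt_neg] at h
  rw [nrm, nrm, ltwo, ltwo, h]

lemma nrm_conjHat (w s : ℝ) (f : ℝ → ℂ) :
    nrm w s (fun ξ => ‖conjHat f ξ‖ₑ) = nrm w s (fun ξ => ‖f ξ‖ₑ) := by
  rw [← nrm_comp_neg w s fun ξ => ‖f ξ‖ₑ]
  congr 1; ext ξ
  rw [conjHat, RCLike.enorm_conj]

lemma ltwo_le_nrm {w s : ℝ} (hw : 0 ≤ w) (hs : 0 ≤ s) (F : ℝ → ℝ≥0∞) :
    ltwo volume F ≤ nrm w s F :=
  ltwo_mono fun ξ => le_mul_of_one_le_left zero_le (one_le_wt hw hs ξ)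

/-- Two space-time functions `f`, `f'` on the Fourier side have norms `|||·|||_{s,T}` at most `B`,
and the norm of their difference is at most `B δ`. This is the form in which Lipschitz bounds are
propagated through the nonlinearity. -/
structure Ctl (w : ℝ → ℝ) (M T s : ℝ) (δ B : ℝ≥0∞) (f f' : ℝ → ℝ → ℂ) : Prop where
  meas : Measurable (Function.uncurry f)
  meas' : Measurable (Function.uncurry f')
  le : supN w M T s (fun t ξ => ‖f t ξ‖ₑ) ≤ B
  le' : supN w M T s (fun t ξ => ‖f' t ξ‖ₑ) ≤ B
  diff : supN w M T s (fun t ξ => ‖f t ξ - f' t ξ‖ₑ) ≤ B * δ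

/-- The analogue of `Ctl` for the norm of `L²([0,T], 𝓗^s_w)`, for functions that are square
integrable at each time. -/
structure IntCtl (w : ℝ → ℝ) (M T s : ℝ) (δ B : ℝ≥0∞) (f f' : ℝ → ℝ → ℂ) : Prop where
  meas : Measurable (Function.uncurry f)
  meas' : Measurable (Function.uncurry f')
  fin : ∀ t ∈ Icc 0 T, ltwo volume (fun ξ => ‖f t ξ‖ₑ) ≠ ∞
  fin' : ∀ t ∈ Icc 0 T, ltwo volume (fun ξ => ‖f' t ξ‖ₑ) ≠ ∞
  le : intN w M T s (fun t ξ => ‖f t ξ‖ₑ) ≤ B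
  le' : intN w M T s (fun t ξ => ‖f' t ξ‖ₑ) ≤ B
  diff : intN w M T s (fun t ξ => ‖f t ξ - f' t ξ‖ₑ) ≤ B * δ

variable {w : ℝ → ℝ} {M T s : ℝ} {δ B B' : ℝ≥0∞} {f f' g g' : ℝ → ℝ → ℂ}

lemma measurable_enorm_uncurry (hf : Measurable (Function.uncurry f)) :
    Measurable (Function.uncurry fun t ξ => ‖f t ξ‖ₑ) := hf.enorm

lemma measurable_enorm_sub_uncurry (hf : Measurable (Function.uncurry f))
    (hg : Measurable (Function.uncurry g)) :
    Measurable (Function.uncurry fun t ξ => ‖f t ξ - g t ξ‖ₑ) := (hf.sub hg).enorm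

lemma measurable_slice {X : Type*} [MeasurableSpace X] {f : ℝ → ℝ → X}
    (hf : Measurable (Function.uncurry f)) (t : ℝ) : Measurable (f t) :=
  hf.comp measurable_prodMk_left

lemma ltwo_ne_top_of_supN (hw0 : ∀ t ∈ Icc 0 T, 0 ≤ w t) (hs : 0 ≤ s) {F : ℝ → ℝ → ℝ≥0∞}
    (hB : B ≠ ∞) (h : supN w M T s F ≤ B) {t : ℝ} (ht : t ∈ Icc 0 T) : ltwo volume (F t) ≠ ∞ :=
  ne_top_of_le_ne_top hB (((ltwo_le_nrm (hw0 t ht) hs _).trans (nrm_le_supN ht)).trans h)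

lemma supN_conv_le (hw : Measurable w) (hw0 : ∀ t ∈ Icc 0 T, 0 ≤ w t) (hs : 1 / 2 < s)
    (hf : Measurable (Function.uncurry f)) (hg : Measurable (Function.uncurry g)) :
    supN w M T s (fun t ξ => ‖conv (f t) (g t) ξ‖ₑ) ≤ algConst s *
      (supN w M T s (fun t ξ => ‖f t ξ‖ₑ) * supN w M T s (fun t ξ => ‖g t ξ‖ₑ)) :=
  (supN_mono le_rfl fun _ _ => Eventually.of_forall fun _ => enorm_conv_le _ _ _).trans
    (supN_lconv_le hw hw0 hs hf.enorm hg.enorm)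

lemma supN_conjHat (f : ℝ → ℝ → ℂ) :
    supN w M T s (fun t ξ => ‖conjHat (f t) ξ‖ₑ) = supN w M T s (fun t ξ => ‖f t ξ‖ₑ) := by
  simp only [supN, intN, nrm_conjHat]

lemma supN_convPow_le (hw : Measurable w) (hw0 : ∀ t ∈ Icc 0 T, 0 ≤ w t) (hs : 1 / 2 < s)
    (hf : Measurable (Function.uncurry f)) (n : ℕ) :
    supN w M T s (fun t ξ => ‖convPow (f t) n ξ‖ₑ) ≤
      algConst s ^ n * supN w M T s (fun t ξ => ‖f t ξ‖ₑ) ^ (n + 1) := by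
  induction n with
  | zero => simp [convPow]
  | succ n ih =>
    refine (supN_conv_le hw hw0 hs hf (measurable_convPow_uncurry hf n)).trans ?_
    calc _ ≤ algConst s * (supN w M T s (fun t ξ => ‖f t ξ‖ₑ) *
          (algConst s ^ n * supN w M T s (fun t ξ => ‖f t ξ‖ₑ) ^ (n + 1))) := by gcongr
      _ = _ := by ring

lemma Ctl.conv (hw : Measurable w) (hw0 : ∀ t ∈ Icc 0 T, 0 ≤ w t) (hs : 1 / 2 < s)
    (hB : B ≠ ∞) (hB' : B' ≠ ∞) (hf : Ctl w M T s δ B f f') (hg : Ctl w M T s δ B' g g') :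
    Ctl w M T s δ (2 * algConst s * B * B') (fun t => conv (f t) (g t))
      (fun t => conv (f' t) (g' t)) where
  meas := measurable_conv_uncurry hf.meas hg.meas
  meas' := measurable_conv_uncurry hf.meas' hg.meas'
  le := by
    refine (supN_conv_le hw hw0 hs hf.meas hg.meas).trans ?_
    calc _ ≤ algConst s * (B * B') := by gcongr; exacts [hf.le, hg.le]
      _ ≤ 2 * (algConst s * (B * B')) := le_mul_of_one_le_left zero_le (by norm_num)
      _ = _ := by ring
  le' := by
    refine (supN_conv_le hw hw0 hs hf.meas' hg.meas').trans ?_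
    calc _ ≤ algConst s * (B * B') := by gcongr; exacts [hf.le', hg.le']
      _ ≤ 2 * (algConst s * (B * B')) := le_mul_of_one_le_left zero_le (by norm_num)
      _ = _ := by ring
  diff := by
    have h0 : (0 : ℝ) ≤ s := by linarith
    have mf := measurable_enorm_sub_uncurry hf.meas hf.meas'
    have mg := measurable_enorm_sub_uncurry hg.meas hg.meas'
    calc _ ≤ supN w M T s (fun t ξ => lconv (fun ξ => ‖f t ξ - f' t ξ‖ₑ) (fun ξ => ‖g t ξ‖ₑ) ξ +
          lconv (fun ξ => ‖f' t ξ‖ₑ) (fun ξ => ‖g t ξ - g' t ξ‖ₑ) ξ) :=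
          supN_mono le_rfl fun t ht => Eventually.of_forall fun ξ =>
            enorm_conv_sub_le (measurable_slice hf.meas t) (measurable_slice hg.meas t)
              (measurable_slice hf.meas' t) (measurable_slice hg.meas' t)
              (ltwo_ne_top_of_supN hw0 h0 hB hf.le ht) (ltwo_ne_top_of_supN hw0 h0 hB' hg.le ht)
              (ltwo_ne_top_of_supN hw0 h0 hB hf.le' ht) (ltwo_ne_top_of_supN hw0 h0 hB' hg.le' ht) ξ
      _ ≤ _ := supN_add_le hw (measurable_lconv_uncurry mf (measurable_enorm_uncurry hg.meas))
          (measurable_lconv_uncurry (measurable_enorm_uncurry hf.meas') mg)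
      _ ≤ algConst s * (B * δ * B') + algConst s * (B * (B' * δ)) := by
          refine add_le_add ((supN_lconv_le hw hw0 hs mf (measurable_enorm_uncurry hg.meas)).trans ?_)
            ((supN_lconv_le hw hw0 hs (measurable_enorm_uncurry hf.meas') mg).trans ?_)
          · gcongr; exacts [hf.diff, hg.le]
          · gcongr; exacts [hf.le', hg.diff]
      _ = _ := by ring

lemma Ctl.conjHat (hf : Ctl w M T s δ B f f') :
    Ctl w M T s δ B (fun t => conjHat (f t)) (fun t => conjHat (f' t)) where
  meas := measurable_conjHat_uncurry hf.meas
  meas' := measurable_conjHat_uncurry hf.meas'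
  le := by rw [supN_conjHat]; exact hf.le
  le' := by rw [supN_conjHat]; exact hf.le'
  diff := by
    have := supN_conjHat (w := w) (M := M) (T := T) (s := s) fun t ξ => f t ξ - f' t ξ
    simp only [WKB.conjHat, map_sub] at this ⊢
    rw [this]; exact hf.diff

lemma Ctl.convPow (hw : Measurable w) (hw0 : ∀ t ∈ Icc 0 T, 0 ≤ w t) (hs : 1 / 2 < s)
    (hB : B ≠ ∞) (hf : Ctl w M T s δ B f f') (n : ℕ) :
    Ctl w M T s δ ((2 * algConst s * B) ^ n * B) (fun t => convPow (f t) n)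
      (fun t => convPow (f' t) n) := by
  have hA := algConst_ne_top hs
  induction n with
  | zero => simpa [WKB.convPow] using hf
  | succ n ih =>
    have := hf.conv hw hw0 hs hB (by finiteness) ih
    rwa [show 2 * algConst s * B * ((2 * algConst s * B) ^ n * B) =
      (2 * algConst s * B) ^ (n + 1) * B by ring] at this

lemma intN_dHat_le (f : ℝ → ℝ → ℂ) :
    intN w M T s (fun t ξ => ‖dHat (f t) ξ‖ₑ) ≤ intN w M T (s + 1) (fun t ξ => ‖f t ξ‖ₑ) :=
  ltwo_mono fun _ => mul_le_mul' le_rfl (nrm_dHat_le _ _ _)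

lemma supN_dHat_le (f : ℝ → ℝ → ℂ) :
    supN w M T s (fun t ξ => ‖dHat (f t) ξ‖ₑ) ≤ supN w M T (s + 1) (fun t ξ => ‖f t ξ‖ₑ) := by
  refine supN_le_iff.2 ⟨fun t ht => (nrm_dHat_le _ _ _).trans
    (nrm_le_supN (F := fun t ξ => ‖f t ξ‖ₑ) ht), (intN_dHat_le f).trans ?_⟩
  rw [show s + 1 / 2 + 1 = s + 1 + 1 / 2 by ring]
  exact intN_le_supN

lemma dHat_sub (f f' : ℝ → ℂ) (ξ : ℝ) :
    dHat f ξ - dHat f' ξ = dHat (fun ξ => f ξ - f' ξ) ξ := by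
  simp only [dHat]; ring

lemma Ctl.dHat (hf : Ctl w M T (s + 1) δ B f f') :
    Ctl w M T s δ B (fun t => dHat (f t)) (fun t => dHat (f' t)) where
  meas := measurable_dHat_uncurry hf.meas
  meas' := measurable_dHat_uncurry hf.meas'
  le := (supN_dHat_le f).trans hf.le
  le' := (supN_dHat_le f').trans hf.le'
  diff := by
    simp_rw [dHat_sub]
    exact (supN_dHat_le fun t ξ => f t ξ - f' t ξ).trans hf.diff

/-- The derivative of a function with finite norm `|||·|||_{s,T}` lies in `L²([0,T], 𝓗^{s-1/2}_w)`. -/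
lemma Ctl.intCtl_dHat (hw0 : ∀ t ∈ Icc 0 T, 0 ≤ w t) (hs : 1 ≤ s) (hB : B ≠ ∞)
    (hf : Ctl w M T s δ B f f') :
    IntCtl w M T (s - 1 / 2) δ B (fun t => WKB.dHat (f t)) (fun t => WKB.dHat (f' t)) := by
  have key : ∀ f : ℝ → ℝ → ℂ, intN w M T (s - 1 / 2) (fun t ξ => ‖WKB.dHat (f t) ξ‖ₑ) ≤
      supN w M T s (fun t ξ => ‖f t ξ‖ₑ) := fun f => by
    refine (intN_dHat_le f).trans ?_
    rw [show s - 1 / 2 + 1 = s + 1 / 2 by ring]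
    exact intN_le_supN
  have hd := Ctl.dHat (s := s - 1) (by simpa using hf)
  exact
  { meas := hd.meas
    meas' := hd.meas'
    fin := fun t ht => ltwo_ne_top_of_supN hw0 (by linarith) hB hd.le ht
    fin' := fun t ht => ltwo_ne_top_of_supN hw0 (by linarith) hB hd.le' ht
    le := (key f).trans hf.le
    le' := (key f').trans hf.le'
    diff := by
      simp_rw [dHat_sub]
      exact (key fun t ξ => f t ξ - f' t ξ).trans hf.diff }

lemma IntCtl.conv (hw : Measurable w) (hw0 : ∀ t ∈ Icc 0 T, 0 ≤ w t) (hs : 1 / 2 < s) {s' : ℝ}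
    (hs' : s ≤ s') (hB : B ≠ ∞) (hf : Ctl w M T s' δ B f f')
    (hg : IntCtl w M T s δ B' g g') :
    intN w M T s (fun t ξ => ‖WKB.conv (f t) (g t) ξ - WKB.conv (f' t) (g' t) ξ‖ₑ) ≤
      2 * algConst s * B * B' * δ := by
  have h0 : (0 : ℝ) ≤ s' := by linarith
  have mf := measurable_enorm_sub_uncurry hf.meas hf.meas'
  have mg := measurable_enorm_sub_uncurry hg.meas hg.meas'
  calc _ ≤ intN w M T s (fun t ξ => lconv (fun ξ => ‖f t ξ - f' t ξ‖ₑ) (fun ξ => ‖g t ξ‖ₑ) ξ +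
        lconv (fun ξ => ‖f' t ξ‖ₑ) (fun ξ => ‖g t ξ - g' t ξ‖ₑ) ξ) :=
        intN_mono le_rfl fun t ht => Eventually.of_forall fun ξ =>
          enorm_conv_sub_le (measurable_slice hf.meas t) (measurable_slice hg.meas t)
            (measurable_slice hf.meas' t) (measurable_slice hg.meas' t)
            (ltwo_ne_top_of_supN hw0 h0 hB hf.le ht) (hg.fin t ht)
            (ltwo_ne_top_of_supN hw0 h0 hB hf.le' ht) (hg.fin' t ht) ξ
    _ ≤ _ := intN_add_le hw (measurable_lconv_uncurry mf (measurable_enorm_uncurry hg.meas))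
        (measurable_lconv_uncurry (measurable_enorm_uncurry hf.meas') mg)
    _ ≤ algConst s * (B * δ * B') + algConst s * (B * (B' * δ)) := by
        refine add_le_add ((intN_lconv_le hw hw0 hs hs' mf (measurable_enorm_uncurry hg.meas)).trans ?_)
          ((intN_lconv_le hw hw0 hs hs' (measurable_enorm_uncurry hf.meas') mg).trans ?_)
        · gcongr; exacts [hf.diff, hg.le]
        · gcongr; exacts [hf.le', hg.diff]
    _ = _ := by ring

lemma enorm_lin_sub_le (a b c x y z x' y' z' : ℂ) :
    ‖-(a * x + b * y + c * z) - -(a * x' + b * y' + c * z')‖ₑ ≤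
      (‖a‖ₑ * ‖x - x'‖ₑ + ‖b‖ₑ * ‖y - y'‖ₑ) + ‖c‖ₑ * ‖z - z'‖ₑ := by
  rw [show -(a * x + b * y + c * z) - -(a * x' + b * y' + c * z') =
    -(a * (x - x') + b * (y - y') + c * (z - z')) by ring, enorm_neg, ← enorm_mul, ← enorm_mul,
    ← enorm_mul]
  exact (enorm_add_le _ _).trans (add_le_add (enorm_add_le _ _) le_rfl)

lemma intN_lin_le (hw : Measurable w) {a b c : ℝ≥0∞} (ha : a ≠ ∞) (hb : b ≠ ∞) (hc : c ≠ ∞)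
    {F G H : ℝ → ℝ → ℝ≥0∞} (hF : Measurable (Function.uncurry F))
    (hG : Measurable (Function.uncurry G)) (hH : Measurable (Function.uncurry H)) :
    intN w M T s (fun t ξ => (a * F t ξ + b * G t ξ) + c * H t ξ) ≤
      (a * intN w M T s F + b * intN w M T s G) + c * intN w M T s H := by
  rw [← intN_const_mul ha, ← intN_const_mul hb, ← intN_const_mul hc]
  have hs : Measurable (Function.uncurry fun t ξ => a * F t ξ + b * G t ξ) :=
    (hF.const_mul a).add (hG.const_mul b)
  have hs' : Measurable (Function.uncurry fun t ξ => c * H t ξ) := hH.const_mul c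
  exact (intN_add_le hw hs hs').trans
    (add_le_add (intN_add_le hw (hF.const_mul a) (hG.const_mul b)) le_rfl)

/-- A Lipschitz constant of the nonlinearity of the phase equation on the ball of radius `K`; `P k`
is the contribution of the `k + 1`-fold convolution power of `modSq v`. -/
def phaseLip (α μ : ℝ) (n m : ℕ) (ℓ : ℝ) (K : ℝ≥0∞) : ℝ≥0∞ :=
  let A := 2 * algConst ℓ
  let P : ℕ → ℝ≥0∞ := fun k => (A * (A * K * K)) ^ k * (A * K * K)
  (‖(1 / 2 : ℂ)‖ₑ * (A * K * K) + ‖(α : ℂ) / 2‖ₑ * (A * P n * K)) + ‖(μ : ℂ)‖ₑ * P m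

/-- A Lipschitz constant of the nonlinearity of the amplitude equation on the ball of radius `K`. -/
def ampLip (α : ℝ) (n : ℕ) (ℓ : ℝ) (K : ℝ≥0∞) : ℝ≥0∞ :=
  let A := 2 * algConst ℓ
  let A' := 2 * algConst (ℓ - 1 / 2)
  let P : ℝ≥0∞ := (A * (A * K * K)) ^ n * (A * K * K)
  (‖(1 : ℂ)‖ₑ * (A' * K * K) + ‖(1 / 2 : ℂ)‖ₑ * (A' * K * K)) + ‖(α : ℂ) / 2‖ₑ * (A * P * K)

lemma phaseLip_ne_top (α μ : ℝ) (n m : ℕ) {ℓ : ℝ} (hℓ : 1 < ℓ) {K : ℝ≥0∞} (hK : K ≠ ∞) :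
    phaseLip α μ n m ℓ K ≠ ∞ := by
  have := algConst_ne_top (s := ℓ) (by linarith)
  unfold phaseLip
  dsimp only
  finiteness

lemma ampLip_ne_top (α : ℝ) (n : ℕ) {ℓ : ℝ} (hℓ : 1 < ℓ) {K : ℝ≥0∞} (hK : K ≠ ∞) :
    ampLip α n ℓ K ≠ ∞ := by
  have := algConst_ne_top (s := ℓ) (by linarith)
  have := algConst_ne_top (s := ℓ - 1 / 2) (by linarith)
  unfold ampLip
  dsimp only
  finiteness

variable {ℓ : ℝ} {K : ℝ≥0∞} {u v u' v' : ℝ → ℝ → ℂ}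

lemma Ctl.modSq (hw : Measurable w) (hw0 : ∀ t ∈ Icc 0 T, 0 ≤ w t) (hs : 1 / 2 < s)
    (hB : B ≠ ∞) (hf : Ctl w M T s δ B f f') :
    Ctl w M T s δ (2 * algConst s * B * B) (fun t => modSq (f t)) (fun t => modSq (f' t)) :=
  hf.conv hw hw0 hs hB hB hf.conjHat

lemma intN_phaseRHS_sub_le (α μ : ℝ) (n m : ℕ) (hw : Measurable w)
    (hw0 : ∀ t ∈ Icc 0 T, 0 ≤ w t) (hℓ : 1 < ℓ) (hK : K ≠ ∞)
    (hu : Ctl w M T (ℓ + 1) δ K u u') (hv : Ctl w M T ℓ δ K v v') :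
    intN w M T (ℓ + 1 - 1 / 2)
      (fun t ξ => ‖phaseRHS α μ n m (u t) (v t) ξ - phaseRHS α μ n m (u' t) (v' t) ξ‖ₑ) ≤
      phaseLip α μ n m ℓ K * δ := by
  have hs : 1 / 2 < ℓ := by linarith
  have hA := algConst_ne_top hs
  have hm := hv.modSq hw hw0 hs hK
  have h1 := hu.dHat.conv hw hw0 hs hK hK hu.dHat
  have h2 := (hm.convPow hw hw0 hs (by finiteness) n).conv hw hw0 hs (by finiteness) hK hu.dHat
  have h3 := hm.convPow hw hw0 hs (by finiteness) m
  have e : ℓ + 1 - 1 / 2 = ℓ + 1 / 2 := by ring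
  calc _ ≤ _ := intN_mono le_rfl fun t _ => Eventually.of_forall fun ξ =>
        enorm_lin_sub_le _ _ _ _ _ _ _ _ _
    _ ≤ _ := intN_lin_le hw enorm_ne_top enorm_ne_top enorm_ne_top
        (measurable_enorm_sub_uncurry h1.meas h1.meas')
        (measurable_enorm_sub_uncurry h2.meas h2.meas')
        (measurable_enorm_sub_uncurry h3.meas h3.meas')
    _ ≤ _ := by
        rw [e]
        refine (add_le_add (add_le_add (mul_le_mul' le_rfl (intN_le_supN.trans h1.diff))
          (mul_le_mul' le_rfl (intN_le_supN.trans h2.diff)))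
          (mul_le_mul' le_rfl (intN_le_supN.trans h3.diff))).trans (le_of_eq ?_)
        rw [phaseLip]; ring

lemma enorm_ampRHS_sub_le (α : ℝ) (n : ℕ) (u v u' v' : ℝ → ℂ) (ξ : ℝ) :
    ‖ampRHS α n u v ξ - ampRHS α n u' v' ξ‖ₑ ≤
      (‖(1 : ℂ)‖ₑ * ‖conv (dHat u) (dHat v) ξ - conv (dHat u') (dHat v') ξ‖ₑ +
      ‖(1 / 2 : ℂ)‖ₑ * ‖conv v (dHat (dHat u)) ξ - conv v' (dHat (dHat u')) ξ‖ₑ) +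
      ‖(α : ℂ) / 2‖ₑ * ‖dHat (conv (convPow (modSq v) n) v) ξ -
        dHat (conv (convPow (modSq v') n) v') ξ‖ₑ := by
  have h := enorm_lin_sub_le 1 (1 / 2) ((α : ℂ) / 2) (conv (dHat u) (dHat v) ξ)
    (conv v (dHat (dHat u)) ξ) (dHat (conv (convPow (modSq v) n) v) ξ) (conv (dHat u') (dHat v') ξ)
    (conv v' (dHat (dHat u')) ξ) (dHat (conv (convPow (modSq v') n) v') ξ)
  rw [one_mul, one_mul] at h
  exact h

lemma intN_ampRHS_sub_le (α : ℝ) (n : ℕ) (hw : Measurable w)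
    (hw0 : ∀ t ∈ Icc 0 T, 0 ≤ w t) (hℓ : 1 < ℓ) (hK : K ≠ ∞)
    (hu : Ctl w M T (ℓ + 1) δ K u u') (hv : Ctl w M T ℓ δ K v v') :
    intN w M T (ℓ - 1 / 2)
      (fun t ξ => ‖ampRHS α n (u t) (v t) ξ - ampRHS α n (u' t) (v' t) ξ‖ₑ) ≤
      ampLip α n ℓ K * δ := by
  have hs : 1 / 2 < ℓ := by linarith
  have hs' : 1 / 2 < ℓ - 1 / 2 := by linarith
  have hA := algConst_ne_top hs
  have hm := hv.modSq hw hw0 hs hK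
  have i1 := hv.intCtl_dHat hw0 hℓ.le hK
  have i2 := hu.dHat.intCtl_dHat hw0 hℓ.le hK
  have h1 := IntCtl.conv hw hw0 hs' (by linarith) hK hu.dHat i1
  have h2 := IntCtl.conv hw hw0 hs' (by linarith) hK hv i2
  have i3 := (hm.convPow hw hw0 hs (by finiteness) n).conv hw hw0 hs (by finiteness) hK hv
  have h3 := i3.intCtl_dHat hw0 hℓ.le (by finiteness)
  calc _ ≤ _ := intN_mono le_rfl fun t _ => Eventually.of_forall fun ξ =>
        enorm_ampRHS_sub_le α n (u t) (v t) (u' t) (v' t) ξ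
    _ ≤ _ := intN_lin_le hw enorm_ne_top enorm_ne_top enorm_ne_top
        (measurable_enorm_sub_uncurry (measurable_conv_uncurry hu.dHat.meas i1.meas)
          (measurable_conv_uncurry hu.dHat.meas' i1.meas'))
        (measurable_enorm_sub_uncurry (measurable_conv_uncurry hv.meas i2.meas)
          (measurable_conv_uncurry hv.meas' i2.meas'))
        (measurable_enorm_sub_uncurry h3.meas h3.meas')
    _ ≤ _ := by
        refine (add_le_add (add_le_add (mul_le_mul' le_rfl h1) (mul_le_mul' le_rfl h2))
          (mul_le_mul' le_rfl h3.diff)).trans (le_of_eq ?_)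
        rw [ampLip]; ring

end

/-! ### Completeness of the space-time norm -/

section Complete

variable {w : ℝ → ℝ} {M T s : ℝ}

lemma supN_sub_comm (f g : ℝ → ℝ → ℂ) :
    supN w M T s (fun t ξ => ‖f t ξ - g t ξ‖ₑ) = supN w M T s (fun t ξ => ‖g t ξ - f t ξ‖ₑ) := by
  simp_rw [← edist_eq_enorm_sub, edist_comm]

lemma supN_sub_le {f g h : ℝ → ℝ → ℂ} (hw : Measurable w) (hf : Measurable (Function.uncurry f))
    (hg : Measurable (Function.uncurry g)) (hh : Measurable (Function.uncurry h)) :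
    supN w M T s (fun t ξ => ‖f t ξ - h t ξ‖ₑ) ≤
      supN w M T s (fun t ξ => ‖f t ξ - g t ξ‖ₑ) + supN w M T s (fun t ξ => ‖g t ξ - h t ξ‖ₑ) := by
  refine (supN_mono le_rfl fun t _ => Eventually.of_forall fun ξ => ?_).trans
    (supN_add_le hw (measurable_enorm_sub_uncurry hf hg) (measurable_enorm_sub_uncurry hg hh))
  simp_rw [← edist_eq_enorm_sub]
  exact edist_triangle _ _ _

lemma ltwo_tsum_le {α : Type*} [MeasurableSpace α] {μ : Measure α} {F : ℕ → α → ℝ≥0∞}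
    (hF : ∀ n, AEMeasurable (F n) μ) :
    ltwo μ (fun a => ∑' n, F n a) ≤ ∑' n, ltwo μ (F n) := by
  have hS : ∀ N, AEMeasurable (fun a => ∑ n ∈ Finset.range N, F n a) μ := fun N =>
    Finset.aemeasurable_fun_sum _ fun n _ => hF n
  have h1 : ∀ N, ltwo μ (fun a => ∑ n ∈ Finset.range N, F n a) ≤
      ∑ n ∈ Finset.range N, ltwo μ (F n) := by
    intro N
    induction N with
    | zero => simp [ltwo_zero]
    | succ N ih =>
      simp_rw [Finset.sum_range_succ]
      exact (ltwo_add_le (hS N) (hF N)).trans (add_le_add ih le_rfl)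
  refine (ltwo_liminf_le hS (Eventually.of_forall fun a =>
    (ENNReal.tendsto_nat_tsum fun n => F n a).liminf_eq.ge)).trans ?_
  refine liminf_le_of_frequently_le' (Eventually.frequently (Eventually.of_forall fun N => ?_))
  exact (h1 N).trans (ENNReal.sum_le_tsum _)

/-- Completeness: a sequence whose consecutive differences are summable in the space-time norm
converges in that norm, to a jointly measurable limit. -/
lemma exists_supN_limit (hw : Measurable w) {f : ℕ → ℝ → ℝ → ℂ}
    (hf : ∀ n, Measurable (Function.uncurry (f n))) {b : ℕ → ℝ≥0∞} (hb : ∑' n, b n ≠ ∞)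
    (hfb : ∀ n, supN w M T s (fun t ξ => ‖f n t ξ - f (n + 1) t ξ‖ₑ) ≤ b n) :
    ∃ g : ℝ → ℝ → ℂ, Measurable (Function.uncurry g) ∧
      ∀ n, supN w M T s (fun t ξ => ‖f n t ξ - g t ξ‖ₑ) ≤ ∑' k, b (k + n) := by
  set g : ℝ → ℝ → ℂ := fun t ξ => limUnder atTop fun n => f n t ξ with hg
  have mg : Measurable (Function.uncurry g) :=
    (StronglyMeasurable.limUnder (l := atTop) fun n => (hf n).stronglyMeasurable).measurable
  refine ⟨g, mg, fun n => ?_⟩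
  have lim : ∀ t ∈ Icc 0 T, ∀ᵐ ξ, Tendsto (fun n => f n t ξ) atTop (𝓝 (g t ξ)) := by
    intro t ht
    have hm : ∀ n, AEMeasurable (fun ξ => wt (w t) s ξ * ‖f n t ξ - f (n + 1) t ξ‖ₑ) := fun n =>
      ((measurable_wt _ _).mul ((measurable_slice (hf n) t).sub
        (measurable_slice (hf (n + 1)) t)).enorm).aemeasurable
    have hfin := ne_top_of_le_ne_top hb ((ltwo_tsum_le hm).trans (ENNReal.tsum_le_tsum fun n =>
      (nrm_le_supN (F := fun t ξ => ‖f n t ξ - f (n + 1) t ξ‖ₑ) ht).trans (hfb n)))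
    have hm' : AEMeasurable (fun ξ => ∑' n, wt (w t) s ξ * ‖f n t ξ - f (n + 1) t ξ‖ₑ) :=
      AEMeasurable.tsum hm
    filter_upwards [ae_lt_top_of_ltwo hm' hfin] with ξ hξ
    rw [ENNReal.tsum_mul_left] at hξ
    have hξ' : ∑' n, ‖f n t ξ - f (n + 1) t ξ‖ₑ ≠ ∞ := fun h => by
      rw [h, ENNReal.mul_top (wt_ne_zero _ _ _)] at hξ
      exact lt_irrefl _ hξ
    have hc := cauchySeq_of_edist_le_of_tsum_ne_top (f := fun n => f n t ξ) _
      (fun n => (edist_eq_enorm_sub _ _).le) hξ'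
    exact hc.tendsto_limUnder
  have tail : ∀ j, supN w M T s (fun t ξ => ‖f n t ξ - f (j + n) t ξ‖ₑ) ≤ ∑' k, b (k + n) := by
    have h : ∀ j, supN w M T s (fun t ξ => ‖f n t ξ - f (j + n) t ξ‖ₑ) ≤
        ∑ k ∈ Finset.range j, b (k + n) := by
      intro j
      induction j with
      | zero =>
        refine supN_le_iff.2 ⟨fun t _ => ?_, ?_⟩ <;> simp [nrm, intN, ltwo_zero]
      | succ j ih =>
        rw [Finset.sum_range_succ]
        refine (supN_sub_le hw (hf n) (hf (j + n)) (hf _)).trans (add_le_add ih ?_)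
        rw [show j + 1 + n = j + n + 1 by ring]
        exact hfb (j + n)
    exact fun j => (h j).trans (ENNReal.sum_le_tsum _)
  have fatou : ∀ s', ∀ t ∈ Icc 0 T, nrm (w t) s' (fun ξ => ‖f n t ξ - g t ξ‖ₑ) ≤
      liminf (fun j => nrm (w t) s' (fun ξ => ‖f n t ξ - f (j + n) t ξ‖ₑ)) atTop := by
    intro s' t ht
    refine ltwo_liminf_le (fun j => ((measurable_wt _ _).mul ((measurable_slice (hf n) t).sub
      (measurable_slice (hf _) t)).enorm).aemeasurable) ?_
    filter_upwards [lim t ht] with ξ hξ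
    have h2 : Tendsto (fun j => ‖f n t ξ - f (j + n) t ξ‖ₑ) atTop (𝓝 ‖f n t ξ - g t ξ‖ₑ) :=
      (tendsto_const_nhds.sub (hξ.comp (tendsto_add_atTop_nat n))).enorm
    exact (ENNReal.Tendsto.const_mul h2 (Or.inr (wt_ne_top _ _ _))).liminf_eq.ge
  have bdd : ∀ x : ℕ → ℝ≥0∞, (∀ j, x j ≤ ∑' k, b (k + n)) →
      liminf x atTop ≤ ∑' k, b (k + n) := fun x hx =>
    liminf_le_of_frequently_le' (Eventually.frequently (Eventually.of_forall hx))
  refine supN_le_iff.2 ⟨fun t ht => (fatou s t ht).trans (bdd _ fun j =>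
    (nrm_le_supN (F := fun t ξ => ‖f n t ξ - f (j + n) t ξ‖ₑ) ht).trans (tail j)), ?_⟩
  refine (ltwo_liminf_le (F := fun j t => ENNReal.ofReal (√(2 * M)) *
    nrm (w t) (s + 1 / 2) (fun ξ => ‖f n t ξ - f (j + n) t ξ‖ₑ)) (fun j =>
      ((measurable_nrm hw _ (measurable_enorm_sub_uncurry (hf n) (hf _))).const_mul _).aemeasurable)
      ((ae_restrict_iff' measurableSet_Icc).2 (Eventually.of_forall fun t ht => ?_))).trans
        (bdd _ fun j => intN_le_supN.trans (tail j))
  rw [ENNReal.liminf_const_mul_of_ne_top ENNReal.ofReal_ne_top]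
  gcongr
  exact fatou _ t ht

end Complete

/-! ### Almost everywhere congruence of the nonlinearity -/

section Congr

lemma ae_comp_sub_left {p : ℝ → Prop} (h : ∀ᵐ η, p η) (ξ : ℝ) : ∀ᵐ η, p (ξ - η) :=
  (Measure.measurePreserving_sub_left volume ξ).quasiMeasurePreserving.ae h

lemma conv_congr {f f' g g' : ℝ → ℂ} (hf : f =ᵐ[volume] f') (hg : g =ᵐ[volume] g') :
    conv f g = conv f' g' := by
  ext ξ
  rw [conv, conv]
  congr 1
  refine integral_congr_ae ?_
  filter_upwards [hf, ae_comp_sub_left hg ξ] with η h1 h2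
  rw [h1, h2]

lemma dHat_congr {f f' : ℝ → ℂ} (hf : f =ᵐ[volume] f') : dHat f =ᵐ[volume] dHat f' :=
  hf.mono fun ξ h => by simp only [dHat, h]

lemma conjHat_congr {f f' : ℝ → ℂ} (hf : f =ᵐ[volume] f') : conjHat f =ᵐ[volume] conjHat f' :=
  ((Measure.measurePreserving_neg (volume : Measure ℝ)).quasiMeasurePreserving.ae hf).mono
    fun ξ h => by simp only [conjHat, h]

lemma modSq_congr {v v' : ℝ → ℂ} (hv : v =ᵐ[volume] v') : modSq v = modSq v' :=
  conv_congr hv (conjHat_congr hv)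

lemma phaseRHS_congr {α μ : ℝ} {n m : ℕ} {u u' v v' : ℝ → ℂ} (hu : u =ᵐ[volume] u')
    (hv : v =ᵐ[volume] v') : phaseRHS α μ n m u v = phaseRHS α μ n m u' v' := by
  ext ξ
  rw [phaseRHS, phaseRHS, conv_congr (dHat_congr hu) (dHat_congr hu), modSq_congr hv,
    conv_congr (EventuallyEq.refl _ (convPow (modSq v') n)) (dHat_congr hu)]

lemma ampRHS_congr {α : ℝ} {n : ℕ} {u u' v v' : ℝ → ℂ} (hu : u =ᵐ[volume] u')
    (hv : v =ᵐ[volume] v') : ampRHS α n u v = ampRHS α n u' v' := by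
  ext ξ
  rw [ampRHS, ampRHS, conv_congr (dHat_congr hu) (dHat_congr hv), modSq_congr hv,
    conv_congr hv (dHat_congr (dHat_congr hu)),
    conv_congr (EventuallyEq.refl _ (convPow (modSq v') n)) hv]

/-! ### Conjugation symmetry of the nonlinearity -/

lemma conv_comm (f g : ℝ → ℂ) : conv f g = conv g f := by
  ext ξ
  rw [conv, conv, ← integral_sub_left_eq_self _ _ ξ]
  simp [mul_comm]

lemma conjHat_conjHat (f : ℝ → ℂ) : conjHat (conjHat f) = f := by ext ξ; simp [conjHat]

lemma conjHat_conv (f g : ℝ → ℂ) : conjHat (conv f g) = conv (conjHat f) (conjHat g) := by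
  ext ξ
  rw [conjHat, conv, conv, map_mul, fourierConst, Complex.conj_ofReal, ← integral_conj,
    ← integral_neg_eq_self (fun η => (starRingEnd ℂ) (f η * g (-ξ - η)))]
  congr 2
  ext η
  rw [map_mul, conjHat, conjHat, show -ξ - -η = -(ξ - η) by ring]

lemma conjHat_dHat (f : ℝ → ℂ) : conjHat (dHat f) = dHat (conjHat f) := by
  ext ξ; simp [conjHat, dHat]

lemma conjHat_modSq (v : ℝ → ℂ) : conjHat (modSq v) = modSq v := by
  rw [modSq, conjHat_conv, conjHat_conjHat, conv_comm]

lemma conjHat_convPow (f : ℝ → ℂ) (n : ℕ) : conjHat (convPow f n) = convPow (conjHat f) n := by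
  induction n with
  | zero => rfl
  | succ n ih => rw [convPow, convPow, conjHat_conv, ih]

lemma conjHat_phaseRHS (α μ : ℝ) (n m : ℕ) (u v : ℝ → ℂ) :
    conjHat (phaseRHS α μ n m u v) = phaseRHS α μ n m (conjHat u) v := by
  have h1 := conjHat_conv (dHat u) (dHat u)
  have h2 := conjHat_conv (convPow (modSq v) n) (dHat u)
  have h3 := conjHat_convPow (modSq v) m
  rw [conjHat_convPow, conjHat_modSq] at h2
  rw [conjHat_modSq] at h3
  rw [conjHat_dHat] at h1 h2
  ext ξ
  rw [phaseRHS, ← h1, ← h2]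
  conv_rhs => rw [← h3]
  have c2 : (starRingEnd ℂ) 2 = 2 := map_ofNat _ 2
  simp [conjHat, phaseRHS, c2]

end Congr

/-! ### The Duhamel operator -/

section Duhamel

/-- The solution of `∂ₜψ = (iε/2) ∂ₓ²ψ + F` with initial datum `f₀`, on the Fourier side. -/
def duhamel (ε : ℝ) (f₀ : ℝ → ℂ) (F : ℝ → ℝ → ℂ) (t ξ : ℝ) : ℂ :=
  Complex.exp (-(Complex.I * (ε / 2 * ξ ^ 2 * t : ℝ))) *
    (f₀ ξ + ∫ r in Icc 0 t, Complex.exp (Complex.I * (ε / 2 * ξ ^ 2 * r : ℝ)) * F r ξ)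

lemma enorm_exp_I_mul (x : ℝ) : ‖Complex.exp (Complex.I * (x : ℂ))‖ₑ = 1 := by
  rw [← ofReal_norm, mul_comm, Complex.norm_exp_ofReal_mul_I, ENNReal.ofReal_one]

lemma enorm_exp_neg_I_mul (x : ℝ) : ‖Complex.exp (-(Complex.I * (x : ℂ)))‖ₑ = 1 := by
  rw [← mul_neg, ← Complex.ofReal_neg, enorm_exp_I_mul]

lemma enorm_duhamel_le (ε : ℝ) (f₀ : ℝ → ℂ) (F : ℝ → ℝ → ℂ) (t ξ : ℝ) :
    ‖duhamel ε f₀ F t ξ‖ₑ ≤ ‖f₀ ξ‖ₑ + ∫⁻ r in Icc 0 t, ‖F r ξ‖ₑ := by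
  rw [duhamel, enorm_mul, enorm_exp_neg_I_mul, one_mul]
  refine (enorm_add_le _ _).trans (add_le_add le_rfl
    ((enorm_integral_le_lintegral_enorm _).trans (le_of_eq ?_)))
  simp_rw [enorm_mul, enorm_exp_I_mul, one_mul]

lemma integrableOn_exp_mul {ε ξ : ℝ} {h : ℝ → ℂ} {S : Set ℝ} (hh : IntegrableOn h S) :
    IntegrableOn (fun r : ℝ => Complex.exp (Complex.I * (ε / 2 * ξ ^ 2 * r : ℝ)) * h r) S := by
  refine Integrable.bdd_mul (c := 1) hh (Continuous.aestronglyMeasurable (by fun_prop))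
    (Eventually.of_forall fun r => ?_)
  rw [mul_comm, Complex.norm_exp_ofReal_mul_I]

lemma enorm_duhamel_sub_le (ε : ℝ) (f₀ : ℝ → ℂ) {F F' : ℝ → ℝ → ℂ} {T t ξ : ℝ} (ht : t ∈ Icc 0 T)
    (hF : IntegrableOn (fun r => F r ξ) (Icc 0 T)) (hF' : IntegrableOn (fun r => F' r ξ) (Icc 0 T)) :
    ‖duhamel ε f₀ F t ξ - duhamel ε f₀ F' t ξ‖ₑ ≤ ∫⁻ r in Icc 0 t, ‖F r ξ - F' r ξ‖ₑ := by
  have hs : Icc 0 t ⊆ Icc 0 T := Icc_subset_Icc_right ht.2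
  rw [duhamel, duhamel, ← mul_sub, add_sub_add_left_eq_sub, enorm_mul, enorm_exp_neg_I_mul, one_mul,
    ← integral_sub (integrableOn_exp_mul (hF.mono_set hs)) (integrableOn_exp_mul (hF'.mono_set hs))]
  refine (enorm_integral_le_lintegral_enorm _).trans (le_of_eq ?_)
  simp_rw [← mul_sub, enorm_mul, enorm_exp_I_mul, one_mul]

lemma measurable_duhamel_uncurry (ε : ℝ) {f₀ : ℝ → ℂ} (hf₀ : Measurable f₀) {F : ℝ → ℝ → ℂ}
    (hF : Measurable (Function.uncurry F)) : Measurable (Function.uncurry (duhamel ε f₀ F)) := by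
  have h1 : Measurable fun q : (ℝ × ℝ) × ℝ =>
      Complex.exp (Complex.I * (ε / 2 * q.1.2 ^ 2 * q.2 : ℝ)) * F q.2 q.1.2 :=
    Measurable.mul (by fun_prop)
      (hF.comp (measurable_snd.prodMk (measurable_snd.comp measurable_fst)))
  have hS : MeasurableSet {q : (ℝ × ℝ) × ℝ | 0 ≤ q.2 ∧ q.2 ≤ q.1.1} :=
    (measurableSet_le measurable_const measurable_snd).inter
      (measurableSet_le measurable_snd (measurable_fst.comp measurable_fst))
  have h2 : Measurable fun p : ℝ × ℝ =>
      ∫ r in Icc 0 p.1, Complex.exp (Complex.I * (ε / 2 * p.2 ^ 2 * r : ℝ)) * F r p.2 := by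
    have h3 := (StronglyMeasurable.integral_prod_right'
      (h1.indicator hS).stronglyMeasurable (ν := (volume : Measure ℝ))).measurable
    convert h3 using 2 with p
    rw [← integral_indicator measurableSet_Icc]
    rfl
  refine Measurable.mul (f := fun p : ℝ × ℝ =>
    Complex.exp (-(Complex.I * (ε / 2 * p.2 ^ 2 * p.1 : ℝ)))) (by fun_prop)
    ((hf₀.comp measurable_snd).add h2)

variable {w₀ M T s : ℝ}

lemma supN_duhamel_add_le (ε : ℝ) (hM : 0 < M) {f₀ : ℝ → ℂ} (hf₀ : Measurable f₀)
    {F : ℝ → ℝ → ℂ} (hF : Measurable (Function.uncurry F)) :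
    supN (fun t => w₀ - M * t) M T s (fun t ξ => ‖duhamel ε f₀ F t ξ‖ₑ) ≤
      nrm w₀ s (fun ξ => ‖f₀ ξ‖ₑ) + ENNReal.ofReal (1 / M) *
        intN (fun t => w₀ - M * t) M T (s - 1 / 2) (fun t ξ => ‖F t ξ‖ₑ) := by
  have hw : Measurable fun r : ℝ => w₀ - M * r := by fun_prop
  have hc : Measurable (Function.uncurry fun (_ : ℝ) ξ => ‖f₀ ξ‖ₑ) :=
    (hf₀.comp measurable_snd).enorm
  calc _ ≤ supN (fun t => w₀ - M * t) M T s
        (fun t ξ => ‖f₀ ξ‖ₑ + ∫⁻ r in Icc 0 t, ‖F r ξ‖ₑ) :=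
        supN_mono le_rfl fun t _ => Eventually.of_forall fun ξ => enorm_duhamel_le ε f₀ F t ξ
    _ ≤ _ := supN_add_le hw hc (measurable_duhamel (measurable_enorm_uncurry hF))
    _ ≤ _ := add_le_add (supN_const_le hM hf₀.enorm)
        (supN_duhamel_le hM (measurable_enorm_uncurry hF))

/-- The source is integrable in time at almost every frequency. -/
lemma ae_integrableOn_of_intN (hM : 0 < M) (hT : 0 ≤ T) {F : ℝ → ℝ → ℂ}
    (hF : Measurable (Function.uncurry F))
    (h : intN (fun t => w₀ - M * t) M T s (fun t ξ => ‖F t ξ‖ₑ) ≠ ∞) :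
    ∀ᵐ ξ, IntegrableOn (fun r => F r ξ) (Icc 0 T) := by
  have hw : Measurable fun r : ℝ => w₀ - M * r := by fun_prop
  have hm : Measurable fun p : ℝ × ℝ =>
      ENNReal.ofReal (√(2 * M)) * (wt (w₀ - M * p.2) s p.1 * ‖F p.2 p.1‖ₑ) :=
    Measurable.const_mul (((measurable_wt_uncurry hw s).comp measurable_swap).mul
      (hF.comp measurable_swap).enorm) _
  rw [intN_eq hw (measurable_enorm_uncurry hF)] at h
  have h2 := ae_lt_top_of_ltwo ((hm.pow_const 2).lintegral_prod_right'.pow_const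
    (1 / 2 : ℝ)).aemeasurable h
  filter_upwards [h2] with ξ hξ
  refine ⟨(hF.comp measurable_prodMk_right).aestronglyMeasurable, ?_⟩
  have h3 := wt_mul_duhamel_le (s := s + 1 / 2) (w₀ := w₀) hM (measurable_enorm_uncurry hF)
    (right_mem_Icc.2 hT) ξ
  rw [show s + 1 / 2 - 1 / 2 = s by ring] at h3
  have h4 := h3.trans_lt (ENNReal.mul_lt_top ENNReal.ofReal_lt_top hξ)
  rw [HasFiniteIntegral]
  by_contra hc
  rw [not_lt, top_le_iff] at hc
  rw [hc, ENNReal.mul_top (wt_ne_zero _ _ _)] at h4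
  exact lt_irrefl _ h4

lemma duhamel_congr {ε : ℝ} {f₀ : ℝ → ℂ} {F F' : ℝ → ℝ → ℂ} {t ξ : ℝ}
    (h : ∀ r ∈ Icc 0 t, F r ξ = F' r ξ) : duhamel ε f₀ F t ξ = duhamel ε f₀ F' t ξ := by
  rw [duhamel, duhamel]
  congr 2
  exact setIntegral_congr_fun measurableSet_Icc fun r hr => by simp only [h r hr]

lemma conjHat_duhamel_zero (f₀ : ℝ → ℂ) (F : ℝ → ℝ → ℂ) (t : ℝ) :
    conjHat (duhamel 0 f₀ F t) = duhamel 0 (conjHat f₀) (fun r => conjHat (F r)) t := by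
  ext ξ
  simp [conjHat, duhamel, ← integral_conj]

end Duhamel

/-! ### The fixed point -/

section

/-- A Lipschitz constant, on the ball of radius `K`, valid for both nonlinearities. -/
def nonlinLip (α μ : ℝ) (n m : ℕ) (ℓ : ℝ) (K : ℝ≥0∞) : ℝ≥0∞ :=
  phaseLip α μ n m ℓ K + ampLip α n ℓ K

lemma nonlinLip_ne_top (α μ : ℝ) (n m : ℕ) {ℓ : ℝ} (hℓ : 1 < ℓ) {K : ℝ≥0∞} (hK : K ≠ ∞) :
    nonlinLip α μ n m ℓ K ≠ ∞ :=
  ENNReal.add_ne_top.2 ⟨phaseLip_ne_top α μ n m hℓ hK, ampLip_ne_top α n hℓ hK⟩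

lemma conv_zero_right (f : ℝ → ℂ) : conv f 0 = 0 := by ext ξ; simp [conv]

lemma conv_zero_left (f : ℝ → ℂ) : conv 0 f = 0 := by ext ξ; simp [conv]

lemma dHat_zero : dHat 0 = 0 := by ext ξ; simp [dHat]

lemma convPow_zero (n : ℕ) : convPow 0 n = 0 := by
  cases n with
  | zero => rfl
  | succ n => exact conv_zero_left _

lemma phaseRHS_zero_left (α μ : ℝ) (n m : ℕ) (v : ℝ → ℂ) (ξ : ℝ) :
    phaseRHS α μ n m 0 v ξ = -((μ : ℂ) * convPow (modSq v) m ξ) := by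
  simp [phaseRHS, dHat_zero, conv_zero_right]

lemma phaseRHS_zero (α μ : ℝ) (n m : ℕ) (ξ : ℝ) : phaseRHS α μ n m 0 0 ξ = 0 := by
  simp [phaseRHS_zero_left, modSq, conv_zero_left, convPow_zero]

lemma ampRHS_zero_right (α : ℝ) (n : ℕ) (u : ℝ → ℂ) (ξ : ℝ) : ampRHS α n u 0 ξ = 0 := by
  simp [ampRHS, dHat_zero, conv_zero_right, conv_zero_left]

variable {w : ℝ → ℝ} {w₀ M T s ℓ : ℝ} {K δ : ℝ≥0∞} {f f' u v u' v' : ℝ → ℝ → ℂ}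

lemma supN_zero : supN w M T s (fun _ _ => 0) = 0 := by
  refine le_antisymm (supN_le_iff.2 ⟨fun t _ => ?_, ?_⟩) zero_le <;> simp [nrm, intN, ltwo_zero]

lemma measurable_zero_uncurry : Measurable (Function.uncurry fun _ : ℝ => (0 : ℝ → ℂ)) :=
  measurable_const (a := (0 : ℂ))

lemma Ctl.of_le (hK : 1 ≤ K) (hf : Measurable (Function.uncurry f))
    (hf' : Measurable (Function.uncurry f')) (h : supN w M T s (fun t ξ => ‖f t ξ‖ₑ) ≤ K)
    (h' : supN w M T s (fun t ξ => ‖f' t ξ‖ₑ) ≤ K)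
    (hd : supN w M T s (fun t ξ => ‖f t ξ - f' t ξ‖ₑ) ≤ δ) : Ctl w M T s δ K f f' :=
  ⟨hf, hf', h, h', hd.trans (le_mul_of_one_le_left zero_le hK)⟩

lemma Ctl.refl (hf : Measurable (Function.uncurry f))
    (h : supN w M T s (fun t ξ => ‖f t ξ‖ₑ) ≤ K) : Ctl w M T s δ K f f :=
  ⟨hf, hf, h, h, by simp [supN_zero]⟩

lemma Ctl.zero_right (hf : Measurable (Function.uncurry f))
    (h : supN w M T s (fun t ξ => ‖f t ξ‖ₑ) ≤ K)
    (hd : supN w M T s (fun t ξ => ‖f t ξ‖ₑ) ≤ K * δ) : Ctl w M T s δ K f (fun _ => 0) :=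
  ⟨hf, measurable_zero_uncurry, h, by simp [supN_zero], by simpa using hd⟩

/-- The source of the phase equation, measured by its linear part in `u` and its value at `u = 0`. -/
lemma intN_phaseRHS_le (α μ : ℝ) (n m : ℕ) (hw : Measurable w)
    (hw0 : ∀ t ∈ Icc 0 T, 0 ≤ w t) (hℓ : 1 < ℓ) (hK : K ≠ ∞) (hK1 : 1 ≤ K)
    (hu : Measurable (Function.uncurry u)) (hv : Measurable (Function.uncurry v))
    (nu : supN w M T (ℓ + 1) (fun t ξ => ‖u t ξ‖ₑ) ≤ K)
    (nv : supN w M T ℓ (fun t ξ => ‖v t ξ‖ₑ) ≤ K) :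
    intN w M T (ℓ + 1 - 1 / 2) (fun t ξ => ‖phaseRHS α μ n m (u t) (v t) ξ‖ₑ) ≤
      phaseLip α μ n m ℓ K * supN w M T (ℓ + 1) (fun t ξ => ‖u t ξ‖ₑ) +
      ‖(μ : ℂ)‖ₑ * (algConst ℓ ^ (2 * m + 1) *
        supN w M T ℓ (fun t ξ => ‖v t ξ‖ₑ) ^ (2 * (m + 1))) := by
  have hs : 1 / 2 < ℓ := by linarith
  have e : ℓ + 1 - 1 / 2 = ℓ + 1 / 2 := by ring
  have hl := intN_phaseRHS_sub_le α μ n m hw hw0 hℓ hK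
    (Ctl.zero_right (δ := supN w M T (ℓ + 1) (fun t ξ => ‖u t ξ‖ₑ)) hu nu
      (le_mul_of_one_le_left zero_le hK1)) (Ctl.refl hv nv)
  have hmod := supN_conv_le (M := M) hw hw0 hs hv (measurable_conjHat_uncurry hv)
  rw [supN_conjHat] at hmod
  have hp := supN_convPow_le (M := M) hw hw0 hs (measurable_modSq_uncurry hv) m
  have m1 := measurable_enorm_sub_uncurry (measurable_phaseRHS_uncurry α μ n m hu hv)
    (measurable_phaseRHS_uncurry α μ n m measurable_zero_uncurry hv)
  have m2 : Measurable (Function.uncurry fun t ξ =>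
      ‖(μ : ℂ)‖ₑ * ‖convPow (modSq (v t)) m ξ‖ₑ) :=
    ((measurable_convPow_uncurry (measurable_modSq_uncurry hv) m).enorm).const_mul _
  calc _ ≤ intN w M T (ℓ + 1 - 1 / 2) (fun t ξ =>
        ‖phaseRHS α μ n m (u t) (v t) ξ - phaseRHS α μ n m 0 (v t) ξ‖ₑ +
        ‖(μ : ℂ)‖ₑ * ‖convPow (modSq (v t)) m ξ‖ₑ) := by
        refine intN_mono le_rfl fun t _ => Eventually.of_forall fun ξ => ?_
        have h := phaseRHS_zero_left α μ n m (v t) ξ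
        rw [← enorm_mul, ← enorm_neg ((μ : ℂ) * _), ← h]
        simpa using enorm_add_le (phaseRHS α μ n m (u t) (v t) ξ - phaseRHS α μ n m 0 (v t) ξ)
          (phaseRHS α μ n m 0 (v t) ξ)
    _ ≤ _ := intN_add_le hw m1 m2
    _ ≤ _ := by
        refine add_le_add hl ?_
        rw [intN_const_mul enorm_ne_top, e]
        gcongr
        refine (intN_le_supN.trans hp).trans ?_
        calc _ ≤ algConst ℓ ^ m * (algConst ℓ * (supN w M T ℓ (fun t ξ => ‖v t ξ‖ₑ) *
              supN w M T ℓ (fun t ξ => ‖v t ξ‖ₑ))) ^ (m + 1) := by gcongr; exact hmod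
          _ = _ := by ring

/-- The source of the amplitude equation is linearly bounded in `v`. -/
lemma intN_ampRHS_le (α : ℝ) (n : ℕ) (hw : Measurable w)
    (hw0 : ∀ t ∈ Icc 0 T, 0 ≤ w t) (hℓ : 1 < ℓ) (hK : K ≠ ∞) (hK1 : 1 ≤ K)
    (hu : Measurable (Function.uncurry u)) (hv : Measurable (Function.uncurry v))
    (nu : supN w M T (ℓ + 1) (fun t ξ => ‖u t ξ‖ₑ) ≤ K)
    (nv : supN w M T ℓ (fun t ξ => ‖v t ξ‖ₑ) ≤ K) :
    intN w M T (ℓ - 1 / 2) (fun t ξ => ‖ampRHS α n (u t) (v t) ξ‖ₑ) ≤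
      ampLip α n ℓ K * supN w M T ℓ (fun t ξ => ‖v t ξ‖ₑ) := by
  have hl := intN_ampRHS_sub_le α n hw hw0 hℓ hK (Ctl.refl hu nu)
    (Ctl.zero_right (δ := supN w M T ℓ (fun t ξ => ‖v t ξ‖ₑ)) hv nv
      (le_mul_of_one_le_left zero_le hK1))
  simpa only [ampRHS_zero_right, sub_zero] using hl

lemma intN_phaseRHS_ball (α μ : ℝ) (n m : ℕ) (hw : Measurable w)
    (hw0 : ∀ t ∈ Icc 0 T, 0 ≤ w t) (hℓ : 1 < ℓ) (hK : K ≠ ∞)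
    (hu : Measurable (Function.uncurry u)) (hv : Measurable (Function.uncurry v))
    (nu : supN w M T (ℓ + 1) (fun t ξ => ‖u t ξ‖ₑ) ≤ K)
    (nv : supN w M T ℓ (fun t ξ => ‖v t ξ‖ₑ) ≤ K) :
    intN w M T (ℓ + 1 - 1 / 2) (fun t ξ => ‖phaseRHS α μ n m (u t) (v t) ξ‖ₑ) ≤
      phaseLip α μ n m ℓ K := by
  have hl := intN_phaseRHS_sub_le α μ n m hw hw0 hℓ hK
    (Ctl.zero_right (δ := 1) hu nu (by simpa using nu))
    (Ctl.zero_right (δ := 1) hv nv (by simpa using nv))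
  simpa only [phaseRHS_zero, sub_zero, mul_one] using hl

lemma intN_ampRHS_ball (α : ℝ) (n : ℕ) (hw : Measurable w)
    (hw0 : ∀ t ∈ Icc 0 T, 0 ≤ w t) (hℓ : 1 < ℓ) (hK : K ≠ ∞)
    (hu : Measurable (Function.uncurry u)) (hv : Measurable (Function.uncurry v))
    (nu : supN w M T (ℓ + 1) (fun t ξ => ‖u t ξ‖ₑ) ≤ K)
    (nv : supN w M T ℓ (fun t ξ => ‖v t ξ‖ₑ) ≤ K) :
    intN w M T (ℓ - 1 / 2) (fun t ξ => ‖ampRHS α n (u t) (v t) ξ‖ₑ) ≤ ampLip α n ℓ K := by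
  have hl := intN_ampRHS_sub_le α n hw hw0 hℓ hK
    (Ctl.zero_right (δ := 1) hu nu (by simpa using nu))
    (Ctl.zero_right (δ := 1) hv nv (by simpa using nv))
  simpa only [ampRHS_zero_right, sub_zero, mul_one] using hl

/-- The contraction estimate. If the differences of two pairs are bounded by the time integrals of
the differences of the nonlinearities, evaluated at pairs at distance at most `δ` in the ball of
radius `K`, then the first differences are smaller by the factor `nonlinLip K / M`. -/
lemma contraction (α μ : ℝ) (n m : ℕ) (hM : 0 < M) (hw0 : ∀ t ∈ Icc 0 T, 0 ≤ w₀ - M * t)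
    (hℓ : 1 < ℓ) (hK : K ≠ ∞)
    (hu : Ctl (fun t => w₀ - M * t) M T (ℓ + 1) δ K u u')
    (hv : Ctl (fun t => w₀ - M * t) M T ℓ δ K v v') {U V : ℝ → ℝ → ℝ≥0∞}
    (hU : ∀ t ∈ Icc 0 T, ∀ᵐ ξ, U t ξ ≤ ∫⁻ r in Icc 0 t,
      ‖phaseRHS α μ n m (u r) (v r) ξ - phaseRHS α μ n m (u' r) (v' r) ξ‖ₑ)
    (hV : ∀ t ∈ Icc 0 T, ∀ᵐ ξ, V t ξ ≤ ∫⁻ r in Icc 0 t,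
      ‖ampRHS α n (u r) (v r) ξ - ampRHS α n (u' r) (v' r) ξ‖ₑ) :
    supN (fun t => w₀ - M * t) M T (ℓ + 1) U ≤
        ENNReal.ofReal (1 / M) * nonlinLip α μ n m ℓ K * δ ∧
      supN (fun t => w₀ - M * t) M T ℓ V ≤
        ENNReal.ofReal (1 / M) * nonlinLip α μ n m ℓ K * δ := by
  have hw : Measurable fun r : ℝ => w₀ - M * r := by fun_prop
  constructor
  · refine (supN_mono le_rfl hU).trans ((supN_duhamel_le hM (measurable_enorm_sub_uncurry
      (measurable_phaseRHS_uncurry α μ n m hu.meas hv.meas)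
      (measurable_phaseRHS_uncurry α μ n m hu.meas' hv.meas'))).trans ?_)
    rw [mul_assoc]
    gcongr
    refine (intN_phaseRHS_sub_le α μ n m hw hw0 hℓ hK hu hv).trans ?_
    gcongr
    exact le_self_add
  · refine (supN_mono le_rfl hV).trans ((supN_duhamel_le hM (measurable_enorm_sub_uncurry
      (measurable_ampRHS_uncurry α n hu.meas hv.meas)
      (measurable_ampRHS_uncurry α n hu.meas' hv.meas'))).trans ?_)
    rw [mul_assoc]
    gcongr
    refine (intN_ampRHS_sub_le α n hw hw0 hℓ hK hu hv).trans ?_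
    gcongr
    exact le_add_self

lemma ae_eq_of_supN_eq_zero (hf : Measurable (Function.uncurry f))
    (hf' : Measurable (Function.uncurry f'))
    (h : supN w M T s (fun t ξ => ‖f t ξ - f' t ξ‖ₑ) = 0) {t : ℝ} (ht : t ∈ Icc 0 T) :
    f t =ᵐ[volume] f' t := by
  have h1 : nrm (w t) s (fun ξ => ‖f t ξ - f' t ξ‖ₑ) = 0 :=
    le_antisymm ((nrm_le_supN (F := fun t ξ => ‖f t ξ - f' t ξ‖ₑ) ht).trans h.le) zero_le
  have hm : AEMeasurable fun ξ => wt (w t) s ξ * ‖f t ξ - f' t ξ‖ₑ :=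
    ((measurable_wt _ _).mul ((measurable_slice hf t).sub
      (measurable_slice hf' t)).enorm).aemeasurable
  filter_upwards [ae_eq_zero_of_ltwo_eq_zero hm h1] with ξ hξ
  rcases mul_eq_zero.1 hξ with h0 | h0
  · exact absurd h0 (wt_ne_zero _ _ _)
  · exact sub_eq_zero.1 (enorm_eq_zero.1 h0)

/-- The Picard iterates, started at zero. -/
def picard (α μ : ℝ) (n m : ℕ) (ε : ℝ) (u₀ v₀ : ℝ → ℂ) : ℕ → (ℝ → ℝ → ℂ) × (ℝ → ℝ → ℂ)
  | 0 => (fun _ => 0, fun _ => 0)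
  | k + 1 =>
    (duhamel 0 u₀ fun t => phaseRHS α μ n m ((picard α μ n m ε u₀ v₀ k).1 t)
      ((picard α μ n m ε u₀ v₀ k).2 t),
     duhamel ε v₀ fun t => ampRHS α n ((picard α μ n m ε u₀ v₀ k).1 t)
      ((picard α μ n m ε u₀ v₀ k).2 t))

/-- `(u, v)` solves the system on `[0,T]` in mild form on the Fourier side, at every frequency,
with norms at most `K` and with a real valued phase. -/
structure IsMild (α μ : ℝ) (n m : ℕ) (ε : ℝ) (u₀ v₀ : ℝ → ℂ) (w : ℝ → ℝ) (M T ℓ : ℝ) (K : ℝ≥0∞)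
    (u v : ℝ → ℝ → ℂ) : Prop where
  meas_phase : Measurable (Function.uncurry u)
  meas_amp : Measurable (Function.uncurry v)
  phase_le : supN w M T (ℓ + 1) (fun t ξ => ‖u t ξ‖ₑ) ≤ K
  amp_le : supN w M T ℓ (fun t ξ => ‖v t ξ‖ₑ) ≤ K
  eq_phase : ∀ t ∈ Icc 0 T, ∀ ξ, u t ξ =
    duhamel 0 u₀ (fun r => phaseRHS α μ n m (u r) (v r)) t ξ
  eq_amp : ∀ t ∈ Icc 0 T, ∀ ξ, v t ξ = duhamel ε v₀ (fun r => ampRHS α n (u r) (v r)) t ξ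
  real_phase : ∀ t ∈ Icc 0 T, conjHat (u t) =ᵐ[volume] u t

/-- Existence of a mild solution in the ball of radius `R + 1`, as the limit of the Picard iterates. -/
theorem exists_isMild (α μ : ℝ) (n m : ℕ) (ε : ℝ) {u₀ v₀ : ℝ → ℂ} (hu₀ : Measurable u₀)
    (hv₀ : Measurable v₀) (hreal : conjHat u₀ =ᵐ[volume] u₀) (hM : 0 < M) (hT : 0 ≤ T)
    (hw0 : ∀ t ∈ Icc 0 T, 0 ≤ w₀ - M * t) (hℓ : 1 < ℓ) {R : ℝ≥0∞} (hR : R ≠ ∞)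
    (nu₀ : nrm w₀ (ℓ + 1) (fun ξ => ‖u₀ ξ‖ₑ) ≤ R) (nv₀ : nrm w₀ ℓ (fun ξ => ‖v₀ ξ‖ₑ) ≤ R)
    (hsmall : ENNReal.ofReal (1 / M) * nonlinLip α μ n m ℓ (R + 1) ≤ 1 / 2) :
    ∃ u v, IsMild α μ n m ε u₀ v₀ (fun t => w₀ - M * t) M T ℓ (R + 1) u v := by
  set w : ℝ → ℝ := fun t => w₀ - M * t with hwdef
  have hw : Measurable w := by fun_prop
  set K : ℝ≥0∞ := R + 1 with hKdef
  have hK : K ≠ ∞ := by finiteness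
  have hK1 : 1 ≤ K := le_add_self
  set κ := ENNReal.ofReal (1 / M) * nonlinLip α μ n m ℓ K with hκ
  have hκ1 : κ ≤ 1 := hsmall.trans (ENNReal.div_le_of_le_mul (by norm_num))
  set p := picard α μ n m ε u₀ v₀ with hp
  -- the ball of radius `K` is preserved
  have ball : ∀ k, Measurable (Function.uncurry (p k).1) ∧ Measurable (Function.uncurry (p k).2) ∧
      supN w M T (ℓ + 1) (fun t ξ => ‖(p k).1 t ξ‖ₑ) ≤ K ∧
      supN w M T ℓ (fun t ξ => ‖(p k).2 t ξ‖ₑ) ≤ K := by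
    intro k
    induction k with
    | zero =>
      refine ⟨measurable_zero_uncurry, measurable_zero_uncurry, ?_, ?_⟩ <;>
        simp [hp, picard, supN_zero]
    | succ k ih =>
      obtain ⟨mu, mv, nu, nv⟩ := ih
      have mF := measurable_phaseRHS_uncurry α μ n m mu mv
      have mG := measurable_ampRHS_uncurry α n mu mv
      refine ⟨measurable_duhamel_uncurry _ hu₀ mF, measurable_duhamel_uncurry _ hv₀ mG, ?_, ?_⟩
      · refine (supN_duhamel_add_le 0 hM hu₀ mF).trans (add_le_add nu₀ (le_trans ?_ hκ1))
        rw [hκ]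
        gcongr
        exact (intN_phaseRHS_ball α μ n m hw hw0 hℓ hK mu mv nu nv).trans le_self_add
      · refine (supN_duhamel_add_le ε hM hv₀ mG).trans (add_le_add nv₀ (le_trans ?_ hκ1))
        rw [hκ]
        gcongr
        exact (intN_ampRHS_ball α n hw hw0 hℓ hK mu mv nu nv).trans le_add_self
  -- the Duhamel operator is a contraction there
  have contr : ∀ {u v u' v' : ℝ → ℝ → ℂ} {δ : ℝ≥0∞}, Ctl w M T (ℓ + 1) δ K u u' →
      Ctl w M T ℓ δ K v v' →
      supN w M T (ℓ + 1) (fun t ξ => ‖duhamel 0 u₀ (fun t => phaseRHS α μ n m (u t) (v t)) t ξ -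
        duhamel 0 u₀ (fun t => phaseRHS α μ n m (u' t) (v' t)) t ξ‖ₑ) ≤ κ * δ ∧
      supN w M T ℓ (fun t ξ => ‖duhamel ε v₀ (fun t => ampRHS α n (u t) (v t)) t ξ -
        duhamel ε v₀ (fun t => ampRHS α n (u' t) (v' t)) t ξ‖ₑ) ≤ κ * δ := by
    intro u v u' v' δ cu cv
    have a1 := ae_integrableOn_of_intN hM hT (measurable_phaseRHS_uncurry α μ n m cu.meas cv.meas)
      (ne_top_of_le_ne_top (phaseLip_ne_top α μ n m hℓ hK)
        (intN_phaseRHS_ball α μ n m hw hw0 hℓ hK cu.meas cv.meas cu.le cv.le))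
    have a2 := ae_integrableOn_of_intN hM hT (measurable_phaseRHS_uncurry α μ n m cu.meas' cv.meas')
      (ne_top_of_le_ne_top (phaseLip_ne_top α μ n m hℓ hK)
        (intN_phaseRHS_ball α μ n m hw hw0 hℓ hK cu.meas' cv.meas' cu.le' cv.le'))
    have a3 := ae_integrableOn_of_intN hM hT (measurable_ampRHS_uncurry α n cu.meas cv.meas)
      (ne_top_of_le_ne_top (ampLip_ne_top α n hℓ hK)
        (intN_ampRHS_ball α n hw hw0 hℓ hK cu.meas cv.meas cu.le cv.le))
    have a4 := ae_integrableOn_of_intN hM hT (measurable_ampRHS_uncurry α n cu.meas' cv.meas')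
      (ne_top_of_le_ne_top (ampLip_ne_top α n hℓ hK)
        (intN_ampRHS_ball α n hw hw0 hℓ hK cu.meas' cv.meas' cu.le' cv.le'))
    refine contraction α μ n m hM hw0 hℓ hK cu cv (fun t ht => ?_) (fun t ht => ?_)
    · filter_upwards [a1, a2] with ξ h1 h2
      exact enorm_duhamel_sub_le 0 u₀ ht h1 h2
    · filter_upwards [a3, a4] with ξ h1 h2
      exact enorm_duhamel_sub_le ε v₀ ht h1 h2
  set b : ℕ → ℝ≥0∞ := fun k => K * 2⁻¹ ^ k with hb
  have bsucc : ∀ k, κ * b k ≤ b (k + 1) := fun k => by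
    calc κ * b k ≤ 2⁻¹ * b k := by gcongr; simpa using hsmall
      _ = b (k + 1) := by simp only [hb]; ring
  have step : ∀ k, supN w M T (ℓ + 1) (fun t ξ => ‖(p k).1 t ξ - (p (k + 1)).1 t ξ‖ₑ) ≤ b k ∧
      supN w M T ℓ (fun t ξ => ‖(p k).2 t ξ - (p (k + 1)).2 t ξ‖ₑ) ≤ b k := by
    intro k
    induction k with
    | zero =>
      obtain ⟨-, -, nu, nv⟩ := ball 1
      have e1 : (p 0).1 = fun _ => 0 := rfl
      have e2 : (p 0).2 = fun _ => 0 := rfl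
      simp only [e1, e2, Pi.zero_apply, zero_sub, enorm_neg, zero_add, hb, pow_zero, mul_one]
      exact ⟨nu, nv⟩
    | succ k ih =>
      obtain ⟨mu, mv, nu, nv⟩ := ball k
      obtain ⟨mu', mv', nu', nv'⟩ := ball (k + 1)
      have := contr (Ctl.of_le hK1 mu mu' nu nu' ih.1) (Ctl.of_le hK1 mv mv' nv nv' ih.2)
      exact ⟨this.1.trans (bsucc k), this.2.trans (bsucc k)⟩
  have bsum : ∑' k, b k ≠ ∞ := by
    rw [hb, ENNReal.tsum_mul_left, ENNReal.tsum_geometric]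
    refine ENNReal.mul_ne_top hK ?_
    simp [ENNReal.one_sub_inv_two]
  obtain ⟨u, mu, lu⟩ := exists_supN_limit hw (fun k => (ball k).1) bsum fun k => (step k).1
  obtain ⟨v, mv, lv⟩ := exists_supN_limit hw (fun k => (ball k).2.1) bsum fun k => (step k).2
  set r : ℕ → ℝ≥0∞ := fun k => ∑' j, b (j + k) with hr
  have hr0 : Tendsto r atTop (𝓝 0) := ENNReal.tendsto_sum_nat_add b bsum
  have le_K : ∀ {s : ℝ} {f : ℕ → ℝ → ℝ → ℂ} {g : ℝ → ℝ → ℂ},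
      (∀ k, Measurable (Function.uncurry (f k))) → Measurable (Function.uncurry g) →
      (∀ k, supN w M T s (fun t ξ => ‖f k t ξ‖ₑ) ≤ K) →
      (∀ k, supN w M T s (fun t ξ => ‖f k t ξ - g t ξ‖ₑ) ≤ r k) →
      supN w M T s (fun t ξ => ‖g t ξ‖ₑ) ≤ K := by
    intro s f g mf mg hf hfg
    have h : ∀ k, supN w M T s (fun t ξ => ‖g t ξ‖ₑ) ≤ K + r k := fun k => by
      refine (supN_mono le_rfl fun t _ => Eventually.of_forall fun ξ => ?_).trans
        ((supN_add_le hw (measurable_enorm_uncurry (mf k))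
          (measurable_enorm_sub_uncurry (mf k) mg)).trans (add_le_add (hf k) (hfg k)))
      calc ‖g t ξ‖ₑ = ‖f k t ξ - (f k t ξ - g t ξ)‖ₑ := by rw [sub_sub_cancel]
        _ ≤ _ := enorm_sub_le
    have := ge_of_tendsto' (tendsto_const_nhds.add hr0) h
    simpa using this
  have nu := le_K (fun k => (ball k).1) mu (fun k => (ball k).2.2.1) lu
  have nv := le_K (fun k => (ball k).2.1) mv (fun k => (ball k).2.2.2) lv
  set u' := duhamel 0 u₀ (fun t => phaseRHS α μ n m (u t) (v t)) with hu'
  set v' := duhamel ε v₀ (fun t => ampRHS α n (u t) (v t)) with hv'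
  have mu' : Measurable (Function.uncurry u') :=
    measurable_duhamel_uncurry _ hu₀ (measurable_phaseRHS_uncurry α μ n m mu mv)
  have mv' : Measurable (Function.uncurry v') :=
    measurable_duhamel_uncurry _ hv₀ (measurable_ampRHS_uncurry α n mu mv)
  have zero_of : ∀ x : ℝ≥0∞, (∀ k, x ≤ r k + r (k + 1)) → x = 0 := fun x hx => by
    have := ge_of_tendsto' (hr0.add (hr0.comp (tendsto_add_atTop_nat 1))) hx
    simpa using this
  have small : ∀ k, supN w M T (ℓ + 1) (fun t ξ => ‖u' t ξ - (p (k + 1)).1 t ξ‖ₑ) ≤ r k ∧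
      supN w M T ℓ (fun t ξ => ‖v' t ξ - (p (k + 1)).2 t ξ‖ₑ) ≤ r k := by
    intro k
    obtain ⟨mpu, mpv, npu, npv⟩ := ball k
    have := contr (Ctl.of_le hK1 mu mpu nu npu (supN_sub_comm _ _ ▸ lu k))
      (Ctl.of_le hK1 mv mpv nv npv (supN_sub_comm _ _ ▸ lv k))
    exact ⟨this.1.trans (mul_le_of_le_one_left zero_le hκ1),
      this.2.trans (mul_le_of_le_one_left zero_le hκ1)⟩
  have eu : supN w M T (ℓ + 1) (fun t ξ => ‖u' t ξ - u t ξ‖ₑ) = 0 := zero_of _ fun k =>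
    (supN_sub_le hw mu' (ball (k + 1)).1 mu).trans (add_le_add (small k).1 (lu (k + 1)))
  have ev : supN w M T ℓ (fun t ξ => ‖v' t ξ - v t ξ‖ₑ) = 0 := zero_of _ fun k =>
    (supN_sub_le hw mv' (ball (k + 1)).2.1 mv).trans (add_le_add (small k).2 (lv (k + 1)))
  have au : ∀ t ∈ Icc 0 T, u' t =ᵐ[volume] u t := fun t ht => ae_eq_of_supN_eq_zero mu' mu eu ht
  have av : ∀ t ∈ Icc 0 T, v' t =ᵐ[volume] v t := fun t ht => ae_eq_of_supN_eq_zero mv' mv ev ht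
  -- the phase of each iterate is real valued
  have preal : ∀ k, ∀ t ∈ Icc 0 T, conjHat ((p k).1 t) =ᵐ[volume] (p k).1 t := by
    intro k
    induction k with
    | zero => intro t _; exact Eventually.of_forall fun ξ => by simp [hp, picard, conjHat]
    | succ k ih =>
      intro t ht
      have e : conjHat ((p (k + 1)).1 t) = duhamel 0 (conjHat u₀)
          (fun t => conjHat (phaseRHS α μ n m ((p k).1 t) ((p k).2 t))) t :=
        conjHat_duhamel_zero u₀ _ t
      rw [e]
      filter_upwards [hreal] with ξ hξ
      have e2 : duhamel 0 (conjHat u₀)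
          (fun t => conjHat (phaseRHS α μ n m ((p k).1 t) ((p k).2 t))) t ξ =
          duhamel 0 (conjHat u₀) (fun t => phaseRHS α μ n m ((p k).1 t) ((p k).2 t)) t ξ :=
        duhamel_congr fun r hr => by
          rw [conjHat_phaseRHS, phaseRHS_congr (ih r ⟨hr.1, hr.2.trans ht.2⟩) (EventuallyEq.refl _ _)]
      rw [e2, duhamel, hξ]
      rfl
  have ereal : supN w M T (ℓ + 1) (fun t ξ => ‖conjHat (u t) ξ - u t ξ‖ₑ) = 0 := by
    have h : ∀ k, supN w M T (ℓ + 1) (fun t ξ => ‖conjHat (u t) ξ - u t ξ‖ₑ) ≤ r k + r k := by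
      intro k
      refine (supN_sub_le hw (measurable_conjHat_uncurry mu) (ball k).1 mu).trans
        (add_le_add ?_ (lu k))
      have h1 := supN_conjHat (w := w) (M := M) (T := T) (s := ℓ + 1)
        fun t ξ => (p k).1 t ξ - u t ξ
      rw [supN_sub_comm]
      refine le_trans (le_of_eq ?_) (h1.trans_le (lu k))
      refine le_antisymm ?_ ?_ <;>
      · refine supN_mono le_rfl fun t ht => ?_
        filter_upwards [preal k t ht] with ξ hξ
        rw [← hξ]
        simp [conjHat]
    have := ge_of_tendsto' (hr0.add hr0) h
    simpa using this
  have areal : ∀ t ∈ Icc 0 T, conjHat (u t) =ᵐ[volume] u t := fun t ht =>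
    ae_eq_of_supN_eq_zero (measurable_conjHat_uncurry mu) mu ereal ht
  exact ⟨u', v',
  { meas_phase := mu'
    meas_amp := mv'
    phase_le := (supN_mono le_rfl fun t ht => (au t ht).mono fun ξ h => by rw [h]).trans nu
    amp_le := (supN_mono le_rfl fun t ht => (av t ht).mono fun ξ h => by rw [h]).trans nv
    eq_phase := fun t ht ξ => duhamel_congr fun r hr => by
      have hr' : r ∈ Icc 0 T := ⟨hr.1, hr.2.trans ht.2⟩
      rw [phaseRHS_congr (au r hr') (av r hr')]
    eq_amp := fun t ht ξ => duhamel_congr fun r hr => by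
      have hr' : r ∈ Icc 0 T := ⟨hr.1, hr.2.trans ht.2⟩
      rw [ampRHS_congr (au r hr') (av r hr')]
    real_phase := fun t ht =>
      ((conjHat_congr (au t ht)).trans (areal t ht)).trans (au t ht).symm }⟩

end

/-! ### The Fourier transform on `L²` and Fourier synthesis -/

section

/-- On `L¹ ∩ L²` the inverse Fourier transform of `L²` is given by the Fourier integral. -/
lemma lp_fourierInv_ae_eq {W : ℝ → ℂ} (h1 : Integrable W) (h2 : MemLp W 2) :
    ((𝓕⁻ (h2.toLp W) : Lp ℂ 2 (volume : Measure ℝ)) : ℝ → ℂ) =ᵐ[volume] 𝓕⁻ W := by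
  have hc : Continuous (𝓕⁻ W) := by
    rw [Real.fourierInv_eq_fourier_comp_neg]
    exact VectorFourier.fourierIntegral_continuous (L := innerₗ ℝ) Real.continuous_fourierChar
      continuous_inner h1.comp_neg
  -- both sides are the same tempered distribution, so it suffices to test with smooth functions
  refine ae_eq_of_integral_contDiff_smul_eq
    ((Lp.memLp (𝓕⁻ (h2.toLp W) : Lp ℂ 2 (volume : Measure ℝ))).locallyIntegrable (by norm_num))
    hc.locallyIntegrable fun g hg hgs => ?_
  have hg₁ : HasCompactSupport (Complex.ofRealCLM ∘ g) := hgs.comp_left rfl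
  have hg₂ : ContDiff ℝ (⊤ : ℕ∞) (Complex.ofRealCLM ∘ g) := by fun_prop
  set θ := hg₁.toSchwartzMap hg₂ with hθ
  have e1 : ∫ x, g x • ((𝓕⁻ (h2.toLp W) : Lp ℂ 2 (volume : Measure ℝ)) : ℝ → ℂ) x =
      Lp.toTemperedDistribution (𝓕⁻ (h2.toLp W) : Lp ℂ 2 (volume : Measure ℝ)) θ := by
    rw [Lp.toTemperedDistribution_apply]
    simp [hθ]
  have e2 : ∫ x, (𝓕⁻ θ) x • W x = ∫ x, θ x • 𝓕⁻ W x := by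
    have := VectorFourier.integral_fourierIntegral_smul_eq_flip (L := -innerₗ ℝ) (μ := volume)
      (ν := volume) (e := Real.fourierChar)
      (f := (θ : ℝ → ℂ)) (g := W) Real.continuous_fourierChar
      (by simpa using! continuous_inner.neg) θ.integrable h1
    have k1 : ∀ ξ, (𝓕⁻ θ) ξ = VectorFourier.fourierIntegral 𝐞 volume (-innerₗ ℝ) θ ξ := by
      intro ξ
      rw [SchwartzMap.fourierInv_coe]
      rfl
    have k2 : ∀ ξ, (𝓕⁻ W) ξ = VectorFourier.fourierIntegral 𝐞 volume (-innerₗ ℝ).flip W ξ := by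
      intro ξ
      rw [show (-innerₗ ℝ).flip = -innerₗ ℝ by ext; simp]
      rfl
    simp_rw [k1, k2]
    exact this
  rw [e1, ← Lp.fourierInv_toTemperedDistribution_eq, TemperedDistribution.fourierInv_apply,
    Lp.toTemperedDistribution_apply]
  calc _ = ∫ x, (𝓕⁻ θ) x • W x := by
        refine integral_congr_ae ?_
        filter_upwards [h2.coeFn_toLp] with x hx
        rw [hx]
    _ = _ := by rw [e2]; simp [hθ]

/-- The inverse Fourier transform with the unitary normalisation, as an integral. -/
def synth (f : ℝ → ℂ) (x : ℝ) : ℂ :=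
  fourierConst * ∫ ξ, Complex.exp (Complex.I * ((x * ξ : ℝ) : ℂ)) * f ξ

lemma two_pi_pos : 0 < 2 * Real.pi := by positivity

lemma synth_eq_fourierInv (f : ℝ → ℂ) :
    synth f = 𝓕⁻ fun η => (√(2 * Real.pi) : ℂ) * f (2 * Real.pi * η) := by
  ext x
  have hp := two_pi_pos
  rw [Real.fourierInv_eq']
  have h := Measure.integral_comp_mul_left
    (fun ξ => Complex.exp (Complex.I * ((x * ξ : ℝ) : ℂ)) * f ξ) (2 * Real.pi)
  have e : ∀ v : ℝ, Complex.exp ((((2 * Real.pi * inner ℝ v x : ℝ) : ℂ)) * Complex.I) •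
      ((√(2 * Real.pi) : ℂ) * f (2 * Real.pi * v)) = (√(2 * Real.pi) : ℂ) *
      (Complex.exp (Complex.I * ((x * (2 * Real.pi * v) : ℝ) : ℂ)) * f (2 * Real.pi * v)) := by
    intro v
    rw [show inner ℝ v x = x * v from rfl, smul_eq_mul]
    rw [show ((2 * Real.pi * (x * v) : ℝ) : ℂ) * Complex.I =
      Complex.I * ((x * (2 * Real.pi * v) : ℝ) : ℂ) by push_cast; ring]
    ring
  simp_rw [e]
  rw [integral_const_mul, h, synth, fourierConst, abs_of_pos (inv_pos.2 hp), Complex.real_smul,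
    ← mul_assoc, ← Complex.ofReal_mul]
  congr 2
  have h3 : √(2 * Real.pi) ^ 2 = 2 * Real.pi := Real.sq_sqrt hp.le
  have h4 : 0 < √(2 * Real.pi) := Real.sqrt_pos.2 hp
  field_simp
  linarith

lemma ae_comp_mul_left {p : ℝ → Prop} {c : ℝ} (hc : c ≠ 0) (h : ∀ᵐ x, p x) : ∀ᵐ x, p (c * x) := by
  have : Measure.QuasiMeasurePreserving (fun x : ℝ => c * x) := by
    refine ⟨measurable_const_mul c, ?_⟩
    rw [Real.map_volume_mul_left hc]
    exact Measure.smul_absolutelyContinuous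
  exact this.ae h

lemma MemLp.comp_mul_left {f : ℝ → ℂ} (hf : MemLp f 2) {c : ℝ} (hc : c ≠ 0) :
    MemLp (fun x => f (c * x)) 2 := by
  have h : MemLp f 2 (Measure.map (fun x => c * x) volume) := by
    rw [Real.map_volume_mul_left hc]
    exact hf.smul_measure ENNReal.ofReal_ne_top
  exact h.comp_of_map (measurable_const_mul c).aemeasurable

/-- Fourier inversion: the synthesis of `f ∈ L¹ ∩ L²` is square integrable with transform `f`. -/
lemma memLp_synth_and_hat {f : ℝ → ℂ} (h1 : Integrable f) (h2 : MemLp f 2) :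
    MemLp (synth f) 2 ∧ hat (synth f) =ᵐ[volume] f := by
  have hp := two_pi_pos
  set W : ℝ → ℂ := fun η => (√(2 * Real.pi) : ℂ) * f (2 * Real.pi * η) with hW
  have W1 : Integrable W := (h1.comp_mul_left' hp.ne').const_mul _
  have W2 : MemLp W 2 := (MemLp.comp_mul_left h2 hp.ne').const_mul _
  have key := lp_fourierInv_ae_eq W1 W2
  rw [← synth_eq_fourierInv] at key
  have hm : MemLp (synth f) 2 := (memLp_congr_ae key).1 (Lp.memLp _)
  refine ⟨hm, ?_⟩
  have e : hm.toLp (synth f) = (𝓕⁻ (W2.toLp W) : Lp ℂ 2 (volume : Measure ℝ)) := by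
    apply Lp.ext
    exact hm.coeFn_toLp.trans key.symm
  have e2 : (𝓕 (hm.toLp (synth f)) : Lp ℂ 2 (volume : Measure ℝ)) = W2.toLp W := by
    rw [e]; exact FourierTransform.fourier_fourierInv_eq _
  have e3 := ae_comp_mul_left (inv_ne_zero hp.ne') W2.coeFn_toLp
  rw [hat, dif_pos hm, e2]
  filter_upwards [e3] with ξ hξ
  rw [div_eq_inv_mul, hξ, hW]
  dsimp only
  rw [mul_inv_cancel_left₀ hp.ne', ← mul_assoc, Complex.ofReal_inv, inv_mul_cancel₀, one_mul]
  exact_mod_cast (Real.sqrt_pos.2 hp).ne'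

/-- The Fourier transform on `L²` is injective. -/
lemma ae_eq_of_hat {ψ ψ' : ℝ → ℂ} (h : MemLp ψ 2) (h' : MemLp ψ' 2)
    (he : hat ψ =ᵐ[volume] hat ψ') : ψ =ᵐ[volume] ψ' := by
  have hp := two_pi_pos
  rw [hat, hat, dif_pos h, dif_pos h'] at he
  have he2 := ae_comp_mul_left hp.ne' he
  have hF : (𝓕 (h.toLp ψ) : Lp ℂ 2 (volume : Measure ℝ)) = 𝓕 (h'.toLp ψ') := by
    apply Lp.ext
    filter_upwards [he2] with ξ hξ
    rw [mul_div_cancel_left₀ _ hp.ne'] at hξ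
    refine mul_left_cancel₀ ?_ hξ
    exact_mod_cast (inv_pos.2 (Real.sqrt_pos.2 hp)).ne'
  have := (Lp.fourierTransformₗᵢ ℝ ℂ).injective hF
  exact (MemLp.toLp_eq_toLp_iff h h').1 this

lemma hat_congr {ψ ψ' : ℝ → ℂ} (h : ψ =ᵐ[volume] ψ') : hat ψ = hat ψ' := by
  by_cases hm : MemLp ψ 2
  · have hm' := (memLp_congr_ae h).1 hm
    rw [hat, hat, dif_pos hm, dif_pos hm', (MemLp.toLp_eq_toLp_iff hm hm').2 h]
  · rw [hat, hat, dif_neg hm, dif_neg (fun h' => hm ((memLp_congr_ae h).2 h'))]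

lemma measurable_hat (ψ : ℝ → ℂ) : Measurable (hat ψ) := by
  unfold hat
  split_ifs with h
  · refine Measurable.const_mul ?_ _
    exact (Lp.stronglyMeasurable _).measurable.comp (measurable_id.div_const _)
  · exact measurable_const (a := (0 : ℂ))

lemma continuous_synth {f : ℝ → ℂ} (h1 : Integrable f) : Continuous (synth f) := by
  refine Continuous.mul continuous_const ?_
  refine continuous_of_dominated (F := fun x ξ => Complex.exp (Complex.I * ((x * ξ : ℝ) : ℂ)) * f ξ)
    (bound := fun ξ => ‖f ξ‖) (fun x => ?_) (fun x => Eventually.of_forall fun ξ => ?_) h1.norm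
    (Eventually.of_forall fun ξ => by fun_prop)
  · exact (Continuous.aestronglyMeasurable (by fun_prop)).mul h1.aestronglyMeasurable
  · rw [norm_mul, mul_comm Complex.I, Complex.norm_exp_ofReal_mul_I, one_mul]

/-- Every continuous square integrable function with integrable transform is the synthesis of its
transform. -/
lemma eq_synth_hat {ψ : ℝ → ℂ} (hψ : MemLp ψ 2) (hc : Continuous ψ) (h1 : Integrable (hat ψ))
    (h2 : MemLp (hat ψ) 2) : ψ = synth (hat ψ) := by
  obtain ⟨hm, he⟩ := memLp_synth_and_hat h1 h2
  exact (hc.ae_eq_iff_eq volume (continuous_synth h1)).1 (ae_eq_of_hat hψ hm he.symm)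

lemma ae_eq_of_synth_eq {f g : ℝ → ℂ} (f1 : Integrable f) (f2 : MemLp f 2) (g1 : Integrable g)
    (g2 : MemLp g 2) (h : synth f = synth g) : f =ᵐ[volume] g := by
  have := (memLp_synth_and_hat f1 f2).2
  rw [h] at this
  exact this.symm.trans (memLp_synth_and_hat g1 g2).2

lemma integrable_exp_mul {f : ℝ → ℂ} (h1 : Integrable f) (x : ℝ) :
    Integrable fun ξ => Complex.exp (Complex.I * ((x * ξ : ℝ) : ℂ)) * f ξ := by
  refine Integrable.bdd_mul (c := 1) h1 (Continuous.aestronglyMeasurable (by fun_prop))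
    (Eventually.of_forall fun r => ?_)
  rw [mul_comm, Complex.norm_exp_ofReal_mul_I]

lemma synth_add {f g : ℝ → ℂ} (hf : Integrable f) (hg : Integrable g) (x : ℝ) :
    synth (fun ξ => f ξ + g ξ) x = synth f x + synth g x := by
  simp only [synth, mul_add]
  rw [integral_add (integrable_exp_mul hf x) (integrable_exp_mul hg x), mul_add]

lemma synth_const_mul (c : ℂ) (f : ℝ → ℂ) (x : ℝ) :
    synth (fun ξ => c * f ξ) x = c * synth f x := by
  simp only [synth]
  simp_rw [mul_left_comm _ c]
  rw [integral_const_mul]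
  ring

lemma synth_neg (f : ℝ → ℂ) (x : ℝ) : synth (fun ξ => -f ξ) x = -synth f x := by
  simpa using synth_const_mul (-1) f x

lemma synth_conjHat (f : ℝ → ℂ) (x : ℝ) : synth (conjHat f) x = (starRingEnd ℂ) (synth f x) := by
  rw [synth, synth, map_mul, fourierConst, Complex.conj_ofReal, ← integral_conj,
    ← integral_neg_eq_self]
  congr 2
  ext ξ
  rw [conjHat, neg_neg, map_mul, ← Complex.exp_conj, map_mul, Complex.conj_I, Complex.conj_ofReal]
  congr 2
  push_cast; ring

/-- Convolution on the Fourier side is the product of functions. -/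
lemma synth_conv {f g : ℝ → ℂ} (hf : Integrable f) (hg : Integrable g) (x : ℝ) :
    synth (conv f g) x = synth f x * synth g x := by
  set e : ℝ → ℂ := fun ξ => Complex.exp (Complex.I * ((x * ξ : ℝ) : ℂ)) with he
  have h := integral_convolution (ContinuousLinearMap.mul ℂ ℂ) (μ := volume) (ν := volume)
    (integrable_exp_mul hf x) (integrable_exp_mul hg x)
  have h2 : ∀ ξ, e ξ * conv f g ξ = fourierConst * convolution (fun ξ => e ξ * f ξ)
      (fun ξ => e ξ * g ξ) (ContinuousLinearMap.mul ℂ ℂ) volume ξ := by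
    intro ξ
    rw [conv, convolution_def, mul_left_comm, ← integral_const_mul]
    congr 2
    ext η
    rw [ContinuousLinearMap.mul_apply', show e ξ = e η * e (ξ - η) by
      rw [he]; dsimp only; rw [← Complex.exp_add]; congr 1; push_cast; ring]
    ring
  rw [synth, synth, synth]
  rw [integral_congr_ae (Eventually.of_forall h2), integral_const_mul, h, ContinuousLinearMap.mul_apply']
  ring

lemma hasDerivAt_synth {f : ℝ → ℂ} (hf : Integrable f) (hd : Integrable (dHat f)) (x : ℝ) :
    HasDerivAt (synth f) (synth (dHat f) x) x := by
  refine HasDerivAt.const_mul _ ?_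
  refine (hasDerivAt_integral_of_dominated_loc_of_deriv_le (𝕜 := ℝ)
    (F := fun x ξ => Complex.exp (Complex.I * ((x * ξ : ℝ) : ℂ)) * f ξ)
    (F' := fun x ξ => Complex.exp (Complex.I * ((x * ξ : ℝ) : ℂ)) * dHat f ξ)
    (bound := fun ξ => ‖dHat f ξ‖) (s := univ) univ_mem
    (Eventually.of_forall fun x => (integrable_exp_mul hf x).aestronglyMeasurable)
    (integrable_exp_mul hf x) (integrable_exp_mul hd x).aestronglyMeasurable
    (Eventually.of_forall fun ξ x _ => ?_) hd.norm (Eventually.of_forall fun ξ x _ => ?_)).2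
  · rw [norm_mul, mul_comm Complex.I, Complex.norm_exp_ofReal_mul_I, one_mul]
  · have h1 : HasDerivAt (fun x : ℝ => ((x * ξ : ℝ) : ℂ)) (ξ : ℂ) x := by
      have := ((hasDerivAt_id x).mul_const ξ).ofReal_comp
      simpa using this
    have h2 := ((h1.const_mul Complex.I).cexp).mul_const (f ξ)
    refine h2.congr_deriv ?_
    change _ = _ * (Complex.I * ξ * f ξ)
    ring

/-! ### Exponentially decaying transforms -/

/-- Any exponential gain in the weight dominates any loss of powers of `⟨ξ⟩`. -/
lemma exists_wt_le {w w' : ℝ} (hw : w < w') (s s' : ℝ) :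
    ∃ C : ℝ≥0∞, C ≠ ∞ ∧ ∀ ξ, wt w s ξ ≤ C * wt w' s' ξ := by
  obtain ⟨N, hN⟩ := exists_nat_ge (s - s')
  set d := w' - w with hd
  have hd0 : 0 < d := sub_pos.2 hw
  refine ⟨ENNReal.ofReal (N.factorial / d ^ N), ENNReal.ofReal_ne_top, fun ξ => ?_⟩
  have h1 := one_le_bracket ξ
  have h0 := bracket_pos ξ
  rw [wt, wt, ← ENNReal.ofReal_mul (by positivity)]
  refine ENNReal.ofReal_le_ofReal ?_
  have e1 : bracket ξ ^ s ≤ bracket ξ ^ N * bracket ξ ^ s' := by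
    rw [← Real.rpow_natCast, ← Real.rpow_add h0]
    exact Real.rpow_le_rpow_of_exponent_le h1 (by linarith)
  have e2 : bracket ξ ^ N ≤ N.factorial / d ^ N * Real.exp (d * bracket ξ) := by
    have := Real.pow_div_factorial_le_exp (x := d * bracket ξ) (by positivity) N
    rw [div_le_iff₀ (by positivity), mul_pow] at this
    rw [div_mul_eq_mul_div, le_div_iff₀ (by positivity)]
    linarith
  have e3 : Real.exp (w' * bracket ξ) = Real.exp (d * bracket ξ) * Real.exp (w * bracket ξ) := by
    rw [← Real.exp_add, hd]; congr 1; ring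
  calc bracket ξ ^ s * Real.exp (w * bracket ξ)
      ≤ (N.factorial / d ^ N * Real.exp (d * bracket ξ)) * bracket ξ ^ s' *
        Real.exp (w * bracket ξ) := by
        gcongr
        exact e1.trans (by gcongr)
    _ = _ := by rw [e3]; ring

lemma exists_nrm_le {w w' : ℝ} (hw : w < w') (s s' : ℝ) :
    ∃ C : ℝ≥0∞, C ≠ ∞ ∧ ∀ F : ℝ → ℝ≥0∞, nrm w s F ≤ C * nrm w' s' F := by
  obtain ⟨C, hC, h⟩ := exists_wt_le hw s s'
  refine ⟨C, hC, fun F => ?_⟩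
  rw [nrm, nrm, ← ltwo_const_mul hC]
  refine ltwo_mono fun ξ => ?_
  rw [← mul_assoc]
  gcongr
  exact h ξ

/-- Functions on the Fourier side that are square integrable against some growing exponential
weight. Their syntheses are the analytic functions of the problem. -/
def ExpDecay (f : ℝ → ℂ) : Prop :=
  Measurable f ∧ ∃ κ > 0, nrm κ 0 (fun ξ => ‖f ξ‖ₑ) ≠ ∞

variable {f g : ℝ → ℂ}

lemma expDecay_of_nrm {w s : ℝ} (hw : 0 < w) (hf : Measurable f)
    (h : nrm w s (fun ξ => ‖f ξ‖ₑ) ≠ ∞) : ExpDecay f := by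
  obtain ⟨C, hC, hle⟩ := exists_nrm_le (half_lt_self hw) 0 s
  exact ⟨hf, w / 2, half_pos hw, ne_top_of_le_ne_top (by finiteness) (hle _)⟩

lemma ExpDecay.nrm_ne_top (hf : ExpDecay f) :
    ∃ κ > 0, ∀ s, nrm κ s (fun ξ => ‖f ξ‖ₑ) ≠ ∞ := by
  obtain ⟨hm, κ, hκ, h⟩ := hf
  refine ⟨κ / 2, half_pos hκ, fun s => ?_⟩
  obtain ⟨C, hC, hle⟩ := exists_nrm_le (half_lt_self hκ) s 0
  exact ne_top_of_le_ne_top (by finiteness) (hle _)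

lemma ltwo_enorm_ne_top_iff (hf : AEStronglyMeasurable f) :
    ltwo volume (fun ξ => ‖f ξ‖ₑ) ≠ ∞ ↔ MemLp f 2 := by
  rw [MemLp, eLpNorm_eq_lintegral_rpow_enorm_toReal (by norm_num) (by norm_num), ltwo,
    ← lt_top_iff_ne_top]
  simp [hf]

lemma ExpDecay.memLp (hf : ExpDecay f) : MemLp f 2 := by
  obtain ⟨hm, κ, hκ, h⟩ := hf
  exact (ltwo_enorm_ne_top_iff hm.aestronglyMeasurable).1
    (ne_top_of_le_ne_top h (ltwo_le_nrm hκ.le le_rfl _))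

lemma lintegral_le_nrm {F : ℝ → ℝ≥0∞} (hF : AEMeasurable F) {w s : ℝ} (hw : 0 ≤ w) :
    ∫⁻ ξ, F ξ ≤ embConst s * nrm w s F := by
  refine le_trans (lintegral_mono fun ξ => ?_) (lintegral_wt_le hF w s)
  exact le_mul_of_one_le_left zero_le (one_le_wt hw le_rfl ξ)

lemma integrable_of_nrm {w s : ℝ} (hw : 0 ≤ w) (hs : 1 / 2 < s) (hf : Measurable f)
    (h : nrm w s (fun ξ => ‖f ξ‖ₑ) ≠ ∞) : Integrable f := by
  have := embConst_ne_top hs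
  exact ⟨hf.aestronglyMeasurable,
    (lintegral_le_nrm hf.enorm.aemeasurable hw).trans_lt (by finiteness)⟩

lemma ExpDecay.integrable (hf : ExpDecay f) : Integrable f := by
  obtain ⟨κ, hκ, h⟩ := hf.nrm_ne_top
  exact integrable_of_nrm hκ.le (by norm_num) hf.1 (h 1)

lemma ExpDecay.dHat (hf : ExpDecay f) : ExpDecay (dHat f) := by
  obtain ⟨κ, hκ, h⟩ := hf.nrm_ne_top
  have hm : Measurable (WKB.dHat f) := (Complex.measurable_ofReal.const_mul _).mul hf.1
  exact ⟨hm, κ, hκ, ne_top_of_le_ne_top (h (0 + 1)) (nrm_dHat_le _ _ _)⟩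

lemma ExpDecay.conjHat (hf : ExpDecay f) : ExpDecay (conjHat f) := by
  obtain ⟨hm, κ, hκ, h⟩ := hf
  have hm : Measurable (WKB.conjHat f) :=
    Complex.continuous_conj.measurable.comp (hm.comp measurable_neg)
  exact ⟨hm, κ, hκ, by rwa [nrm_conjHat]⟩

lemma ExpDecay.const_mul (hf : ExpDecay f) (c : ℂ) : ExpDecay fun ξ => c * f ξ := by
  obtain ⟨hm, κ, hκ, h⟩ := hf
  refine ⟨hm.const_mul c, κ, hκ, ?_⟩
  simp_rw [enorm_mul]
  rw [nrm_const_mul enorm_ne_top]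
  finiteness

lemma ExpDecay.neg (hf : ExpDecay f) : ExpDecay fun ξ => -f ξ := by
  simpa using hf.const_mul (-1)

lemma ExpDecay.add (hf : ExpDecay f) (hg : ExpDecay g) : ExpDecay fun ξ => f ξ + g ξ := by
  obtain ⟨mf, κ, hκ, h⟩ := hf
  obtain ⟨mg, κ', hκ', h'⟩ := hg
  refine ⟨mf.add mg, min κ κ', lt_min hκ hκ', ?_⟩
  have hh : nrm (min κ κ') 0 (fun ξ => ‖f ξ + g ξ‖ₑ) ≤
      nrm κ 0 (fun ξ => ‖f ξ‖ₑ) + nrm κ' 0 (fun ξ => ‖g ξ‖ₑ) :=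
    (nrm_mono le_rfl le_rfl (Eventually.of_forall fun ξ => enorm_add_le _ _)).trans
      ((nrm_add_le mf.enorm.aemeasurable mg.enorm.aemeasurable).trans (add_le_add
        (nrm_mono (min_le_left _ _) le_rfl (Eventually.of_forall fun _ => le_rfl))
        (nrm_mono (min_le_right _ _) le_rfl (Eventually.of_forall fun _ => le_rfl))))
  exact ne_top_of_le_ne_top (by finiteness) hh

lemma measurable_conv (hf : Measurable f) (hg : Measurable g) : Measurable (conv f g) :=
  measurable_slice (measurable_conv_uncurry (f := fun _ => f) (g := fun _ => g)
    (hf.comp measurable_snd) (hg.comp measurable_snd)) 0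

lemma ExpDecay.conv (hf : ExpDecay f) (hg : ExpDecay g) : ExpDecay (conv f g) := by
  obtain ⟨κ, hκ, h⟩ := hf.nrm_ne_top
  obtain ⟨κ', hκ', h'⟩ := hg.nrm_ne_top
  have hE := embConst_ne_top (r := 1) (by norm_num)
  have k0 := lt_min hκ hκ'
  refine ⟨measurable_conv hf.1 hg.1, min κ κ', k0, ?_⟩
  have a : ∀ s, nrm (min κ κ') s (fun ξ => ‖f ξ‖ₑ) ≠ ∞ := fun s => ne_top_of_le_ne_top (h s)
    (nrm_mono (min_le_left _ _) le_rfl (Eventually.of_forall fun _ => le_rfl))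
  have b : ∀ s, nrm (min κ κ') s (fun ξ => ‖g ξ‖ₑ) ≠ ∞ := fun s => ne_top_of_le_ne_top (h' s)
    (nrm_mono (min_le_right _ _) le_rfl (Eventually.of_forall fun _ => le_rfl))
  refine ne_top_of_le_ne_top ?_ ((nrm_mono le_rfl le_rfl (Eventually.of_forall fun ξ =>
    enorm_conv_le f g ξ)).trans (nrm_lconv_le k0.le le_rfl 1 hf.1.enorm hg.1.enorm))
  have := a 0; have := a 1; have := b 0; have := b 1
  finiteness

lemma ExpDecay.convPow (hf : ExpDecay f) (n : ℕ) : ExpDecay (convPow f n) := by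
  induction n with
  | zero => exact hf
  | succ n ih => exact hf.conv ih

lemma ExpDecay.modSq (hf : ExpDecay f) : ExpDecay (modSq f) := hf.conv hf.conjHat

lemma ExpDecay.hasDerivAt (hf : ExpDecay f) (x : ℝ) :
    HasDerivAt (synth f) (synth (WKB.dHat f) x) x :=
  hasDerivAt_synth hf.integrable hf.dHat.integrable x

lemma ExpDecay.deriv_synth (hf : ExpDecay f) : deriv (synth f) = synth (WKB.dHat f) :=
  funext fun x => (hf.hasDerivAt x).deriv

lemma ExpDecay.iteratedDeriv_two (hf : ExpDecay f) :
    iteratedDeriv 2 (synth f) = synth (WKB.dHat (WKB.dHat f)) := by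
  rw [iteratedDeriv_succ, iteratedDeriv_one, hf.deriv_synth, hf.dHat.deriv_synth]

lemma ExpDecay.contDiff (hf : ExpDecay f) : ContDiff ℝ (⊤ : ℕ∞) (synth f) := by
  rw [contDiff_infty]
  intro n
  induction n generalizing f with
  | zero =>
    exact contDiff_zero.2 (continuous_synth hf.integrable)
  | succ n ih =>
    have : ((n + 1 : ℕ) : WithTop ℕ∞) = (n : WithTop ℕ∞) + 1 := by norm_cast
    rw [this, contDiff_succ_iff_deriv]
    refine ⟨fun x => (hf.hasDerivAt x).differentiableAt, by simp, ?_⟩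
    rw [hf.deriv_synth]
    exact ih hf.dHat

/-! ### The nonlinearity in physical space -/

lemma synth_convPow (hf : ExpDecay f) (n : ℕ) (x : ℝ) :
    synth (convPow f n) x = synth f x ^ (n + 1) := by
  induction n with
  | zero => simp [convPow]
  | succ n ih =>
    rw [convPow, synth_conv hf.integrable (hf.convPow n).integrable, ih]; ring

lemma synth_modSq (hf : ExpDecay f) (x : ℝ) : synth (modSq f) x = ((‖synth f x‖ ^ 2 : ℝ) : ℂ) := by
  rw [modSq, synth_conv hf.integrable hf.conjHat.integrable, synth_conjHat, Complex.mul_conj,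
    Complex.normSq_eq_norm_sq]

lemma ExpDecay.phaseRHS (hf : ExpDecay f) (hg : ExpDecay g) (α μ : ℝ) (n m : ℕ) :
    ExpDecay (phaseRHS α μ n m f g) :=
  ((((hf.dHat.conv hf.dHat).const_mul _).add (((hg.modSq.convPow n).conv hf.dHat).const_mul _)).add
    ((hg.modSq.convPow m).const_mul _)).neg

lemma ExpDecay.ampRHS (hf : ExpDecay f) (hg : ExpDecay g) (α : ℝ) (n : ℕ) :
    ExpDecay (ampRHS α n f g) :=
  (((hf.dHat.conv hg.dHat).add ((hg.conv hf.dHat.dHat).const_mul _)).add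
    (((hg.modSq.convPow n).conv hg).dHat.const_mul _)).neg

lemma synth_phaseRHS (hf : ExpDecay f) (hg : ExpDecay g) (α μ : ℝ) (n m : ℕ) (x : ℝ) :
    synth (phaseRHS α μ n m f g) x =
      -(1 / 2 * deriv (synth f) x ^ 2 +
        1 / 2 * ((α * (‖synth g x‖ ^ 2) ^ (n + 1) : ℝ) : ℂ) * deriv (synth f) x +
        ((μ * (‖synth g x‖ ^ 2) ^ (m + 1) : ℝ) : ℂ)) := by
  have h1 := hf.dHat.conv hf.dHat
  have h2 := (hg.modSq.convPow n).conv hf.dHat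
  have h3 := hg.modSq.convPow m
  have e : synth (phaseRHS α μ n m f g) x = -(1 / 2 * synth (conv (dHat f) (dHat f)) x +
      (α : ℂ) / 2 * synth (conv (convPow (modSq g) n) (dHat f)) x +
      (μ : ℂ) * synth (convPow (modSq g) m) x) := by
    rw [← synth_const_mul, ← synth_const_mul, ← synth_const_mul,
      ← synth_add (h1.const_mul _).integrable (h2.const_mul _).integrable,
      ← synth_add ((h1.const_mul _).add (h2.const_mul _)).integrable (h3.const_mul _).integrable,
      ← synth_neg]
    rfl
  rw [e, synth_conv hf.dHat.integrable hf.dHat.integrable,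
    synth_conv (hg.modSq.convPow n).integrable hf.dHat.integrable, synth_convPow hg.modSq,
    synth_convPow hg.modSq, synth_modSq hg, hf.deriv_synth]
  push_cast
  ring

lemma synth_ampRHS (hf : ExpDecay f) (hg : ExpDecay g) (α : ℝ) (n : ℕ) (x : ℝ) :
    synth (ampRHS α n f g) x =
      -(deriv (synth f) x * deriv (synth g) x +
        1 / 2 * synth g x * iteratedDeriv 2 (synth f) x +
        1 / 2 * deriv (fun y => ((α * (‖synth g y‖ ^ 2) ^ (n + 1) : ℝ) : ℂ) * synth g y) x) := by
  have h1 := hf.dHat.conv hg.dHat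
  have h2 := hg.conv hf.dHat.dHat
  have h3 := (hg.modSq.convPow n).conv hg
  have e : synth (ampRHS α n f g) x = -(synth (conv (dHat f) (dHat g)) x +
      1 / 2 * synth (conv g (dHat (dHat f))) x +
      (α : ℂ) / 2 * synth (dHat (conv (convPow (modSq g) n) g)) x) := by
    rw [← synth_const_mul, ← synth_const_mul,
      ← synth_add h1.integrable (h2.const_mul _).integrable,
      ← synth_add (h1.add (h2.const_mul _)).integrable (h3.dHat.const_mul _).integrable,
      ← synth_neg]
    rfl
  have e2 : (fun y => ((α * (‖synth g y‖ ^ 2) ^ (n + 1) : ℝ) : ℂ) * synth g y) =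
      fun y => (α : ℂ) * synth (conv (convPow (modSq g) n) g) y := by
    ext y
    rw [synth_conv (hg.modSq.convPow n).integrable hg.integrable, synth_convPow hg.modSq,
      synth_modSq hg]
    push_cast; ring
  rw [e, synth_conv hf.dHat.integrable hg.dHat.integrable,
    synth_conv hg.integrable hf.dHat.dHat.integrable, e2,
    ((h3.hasDerivAt x).const_mul (α : ℂ)).deriv, hf.deriv_synth, hg.deriv_synth,
    hf.iteratedDeriv_two]
  ring

end

/-! ### The Duhamel formula as an integral equation -/

lemma integral_Icc_deriv {E E' : ℝ → ℂ} (hE : ∀ r, HasDerivAt E (E' r) r) (hE' : Continuous E')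
    {s t : ℝ} (hst : s ≤ t) : ∫ r in Icc s t, E' r = E t - E s := by
  rw [integral_Icc_eq_integral_Ioc, ← intervalIntegral.integral_of_le hst]
  exact intervalIntegral.integral_eq_sub_of_hasDerivAt (fun r _ => hE r)
    (hE'.intervalIntegrable _ _)

/-- The product rule for a smooth function and a primitive of a merely integrable function. -/
lemma mul_primitive_eq {E E' k : ℝ → ℂ} (hE : ∀ r, HasDerivAt E (E' r) r) (hE' : Continuous E')
    {t : ℝ} (ht : 0 ≤ t) (hk : IntegrableOn k (Icc 0 t)) (z₀ : ℂ) :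
    E t * (z₀ + ∫ r in Icc 0 t, k r) = E 0 * z₀ +
      ∫ r in Icc 0 t, (E' r * (z₀ + ∫ s in Icc 0 r, k s) + E r * k r) := by
  set ν := volume.restrict (Icc 0 t) with hν
  have hEc : Continuous E := continuous_iff_continuousAt.2 fun r => (hE r).continuousAt
  have iE' : Integrable E' ν := hE'.continuousOn.integrableOn_Icc
  have iprim : Integrable (fun r => E' r * ∫ s in Icc 0 r, k s) ν := by
    refine IntegrableOn.mono_set (t := Icc 0 t) ?_ subset_rfl
    exact ContinuousOn.integrableOn_Icc
      (hE'.continuousOn.mul (intervalIntegral.continuousOn_primitive_Icc hk))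
  have iEk : Integrable (fun r => E r * k r) ν :=
    IntegrableOn.continuousOn_mul hEc.continuousOn hk isCompact_Icc
  have iprod : Integrable (Function.uncurry fun r s =>
      {p : ℝ × ℝ | p.2 ≤ p.1}.indicator (fun p => E' p.1 * k p.2) (r, s)) (ν.prod ν) :=
    (Integrable.mul_prod iE' hk).indicator (measurableSet_le measurable_snd measurable_fst)
  -- Fubini's theorem on the triangle `0 ≤ s ≤ r ≤ t`; `k` need not be continuous, which rules out
  -- the usual integration by parts
  have key : ∫ r in Icc 0 t, E' r * ∫ s in Icc 0 r, k s =
      ∫ s in Icc 0 t, (E t - E s) * k s := by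
    have e1 : ∀ r ∈ Icc 0 t, E' r * ∫ s in Icc 0 r, k s =
        ∫ s, {p : ℝ × ℝ | p.2 ≤ p.1}.indicator (fun p => E' p.1 * k p.2) (r, s) ∂ν := by
      intro r hr
      have : ∀ s, {p : ℝ × ℝ | p.2 ≤ p.1}.indicator (fun p => E' p.1 * k p.2) (r, s) =
          (Iic r).indicator (fun s => E' r * k s) s := fun s => rfl
      simp_rw [this]
      rw [integral_indicator measurableSet_Iic, hν, Measure.restrict_restrict measurableSet_Iic,
        integral_const_mul]
      congr 4
      ext s
      exact ⟨fun h => ⟨h.2, h.1, h.2.trans hr.2⟩, fun h => ⟨h.2.1, h.1⟩⟩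
    have e2 : ∀ s ∈ Icc 0 t, (E t - E s) * k s =
        ∫ r, {p : ℝ × ℝ | p.2 ≤ p.1}.indicator (fun p => E' p.1 * k p.2) (r, s) ∂ν := by
      intro s hs
      have : ∀ r, {p : ℝ × ℝ | p.2 ≤ p.1}.indicator (fun p => E' p.1 * k p.2) (r, s) =
          (Ici s).indicator (fun r => E' r * k s) r := fun r => rfl
      simp_rw [this]
      rw [integral_indicator measurableSet_Ici, hν, Measure.restrict_restrict measurableSet_Ici,
        integral_mul_const, ← integral_Icc_deriv hE hE' hs.2]
      congr 4
      ext r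
      exact ⟨fun h => ⟨h.1, hs.1.trans h.1, h.2⟩, fun h => ⟨h.1, h.2.2⟩⟩
    rw [setIntegral_congr_fun measurableSet_Icc e1, setIntegral_congr_fun measurableSet_Icc e2]
    exact integral_integral_swap iprod
  have h1 : ∫ r in Icc 0 t, (E' r * (z₀ + ∫ s in Icc 0 r, k s) + E r * k r) =
      (E t - E 0) * z₀ + (∫ s in Icc 0 t, (E t - E s) * k s) + ∫ r in Icc 0 t, E r * k r := by
    have a1 := integral_add (iE'.mul_const z₀) iprim
    have a2 := integral_add ((iE'.mul_const z₀).add iprim) iEk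
    simp only [Pi.add_apply] at a2
    rw [← key, ← integral_Icc_deriv hE hE' ht, ← integral_mul_const, ← a1, ← a2]
    refine integral_congr_ae (Eventually.of_forall fun r => ?_)
    simp only
    ring
  have h2 : ∫ s in Icc 0 t, (E t - E s) * k s =
      E t * (∫ s in Icc 0 t, k s) - ∫ s in Icc 0 t, E s * k s := by
    rw [← integral_const_mul, ← integral_sub (hk.const_mul _) iEk]
    refine integral_congr_ae (Eventually.of_forall fun r => ?_)
    simp only
    ring
  rw [h1, h2]
  ring

lemma hasDerivAt_exp_I_mul (c r : ℝ) :
    HasDerivAt (fun r : ℝ => Complex.exp (Complex.I * ((c * r : ℝ) : ℂ)))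
      (Complex.I * c * Complex.exp (Complex.I * ((c * r : ℝ) : ℂ))) r := by
  have h1 : HasDerivAt (fun x : ℝ => ((c * x : ℝ) : ℂ)) (c : ℂ) r := by
    have := ((hasDerivAt_id r).const_mul c).ofReal_comp
    simpa using this
  refine ((h1.const_mul Complex.I).cexp).congr_deriv ?_
  ring

/-- Duhamel's formula solves the integrated form of `∂ₜ y = h - i ε/2 ξ² y`. -/
lemma duhamel_eq_integral {ε ξ T t : ℝ} {f₀ : ℝ → ℂ} {F : ℝ → ℝ → ℂ} (ht : t ∈ Icc 0 T)
    (hF : IntegrableOn (fun r => F r ξ) (Icc 0 T)) :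
    duhamel ε f₀ F t ξ = f₀ ξ + ∫ r in Icc 0 t,
      (F r ξ - Complex.I * (ε / 2 * ξ ^ 2 : ℝ) * duhamel ε f₀ F r ξ) := by
  have hF' : IntegrableOn (fun r => F r ξ) (Icc 0 t) := hF.mono_set (Icc_subset_Icc_right ht.2)
  have h := mul_primitive_eq (hasDerivAt_exp_I_mul (-(ε / 2 * ξ ^ 2)))
    (by fun_prop) ht.1 (integrableOn_exp_mul (ε := ε) (ξ := ξ) hF') (f₀ ξ)
  have e : ∀ r : ℝ, Complex.exp (-(Complex.I * ((ε / 2 * ξ ^ 2 * r : ℝ) : ℂ))) =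
      Complex.exp (Complex.I * ((-(ε / 2 * ξ ^ 2) * r : ℝ) : ℂ)) := by
    intro r; congr 1; push_cast; ring
  rw [duhamel, e, h]
  congr 1
  · simp
  · refine integral_congr_ae (Eventually.of_forall fun r => ?_)
    simp only [duhamel, e]
    rw [← mul_assoc, ← Complex.exp_add, show Complex.I * ((-(ε / 2 * ξ ^ 2) * r : ℝ) : ℂ) +
      Complex.I * ((ε / 2 * ξ ^ 2 * r : ℝ) : ℂ) = 0 by push_cast; ring, Complex.exp_zero]
    push_cast
    ring

/-- Conversely, the integrated equation implies Duhamel's formula. -/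
lemma eq_duhamel_of_eq_integral {ε ξ T : ℝ} {f₀ : ℝ → ℂ} {F z : ℝ → ℝ → ℂ}
    (hF : IntegrableOn (fun r => F r ξ) (Icc 0 T)) (hz : IntegrableOn (fun r => z r ξ) (Icc 0 T))
    (h : ∀ t ∈ Icc 0 T, z t ξ = f₀ ξ + ∫ r in Icc 0 t,
      (F r ξ - Complex.I * (ε / 2 * ξ ^ 2 : ℝ) * z r ξ)) {t : ℝ} (ht : t ∈ Icc 0 T) :
    z t ξ = duhamel ε f₀ F t ξ := by
  have hs : Icc 0 t ⊆ Icc 0 T := Icc_subset_Icc_right ht.2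
  have h' := mul_primitive_eq (hasDerivAt_exp_I_mul (ε / 2 * ξ ^ 2)) (by fun_prop) ht.1
    ((hF.mono_set hs).sub ((hz.mono_set hs).const_mul (Complex.I * (ε / 2 * ξ ^ 2 : ℝ)))) (f₀ ξ)
  simp only [Pi.sub_apply] at h'
  rw [← h t ht] at h'
  refine mul_left_cancel₀ (Complex.exp_ne_zero
    (Complex.I * ((ε / 2 * ξ ^ 2 * t : ℝ) : ℂ))) ?_
  rw [h', duhamel, ← mul_assoc, ← Complex.exp_add, add_neg_cancel, Complex.exp_zero, one_mul]
  congr 1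
  · simp
  · refine setIntegral_congr_fun measurableSet_Icc fun r hr => ?_
    rw [← h r (hs hr)]
    ring

/-! ### Families dominated uniformly in time -/

/-- A family of functions on the Fourier side that is dominated for `t ∈ [0,T]` by a single
exponentially decaying function, and continuous in `t` at almost every frequency. -/
structure DecayFam (T : ℝ) (f : ℝ → ℝ → ℂ) : Prop where
  meas : ∀ t, Measurable (f t)
  bound : ∃ Θ : ℝ → ℂ, ExpDecay Θ ∧ ∀ᵐ ξ, ∀ t ∈ Icc 0 T, ‖f t ξ‖ ≤ ‖Θ ξ‖
  cont : ∀ᵐ ξ, ContinuousOn (fun t => f t ξ) (Icc 0 T)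

lemma ExpDecay.of_norm_le {f Θ : ℝ → ℂ} (hΘ : ExpDecay Θ) (hf : Measurable f)
    (h : ∀ᵐ ξ, ‖f ξ‖ ≤ ‖Θ ξ‖) : ExpDecay f := by
  obtain ⟨-, κ, hκ, hn⟩ := hΘ
  exact ⟨hf, κ, hκ, ne_top_of_le_ne_top hn (nrm_mono le_rfl le_rfl
    (h.mono fun ξ hξ => enorm_le_iff_norm_le.2 hξ))⟩

lemma ExpDecay.norm {Θ : ℝ → ℂ} (hΘ : ExpDecay Θ) : ExpDecay fun ξ => ((‖Θ ξ‖ : ℝ) : ℂ) :=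
  hΘ.of_norm_le (Complex.measurable_ofReal.comp hΘ.1.norm)
    (Eventually.of_forall fun ξ => by simp)

lemma ExpDecay.integrable_mul_sub {f g : ℝ → ℂ} (hf : ExpDecay f) (hg : ExpDecay g) (ξ : ℝ) :
    Integrable fun η => f η * g (ξ - η) :=
  integrable_conv hf.1 hg.1 ((ltwo_enorm_ne_top_iff hf.1.aestronglyMeasurable).2 hf.memLp)
    ((ltwo_enorm_ne_top_iff hg.1.aestronglyMeasurable).2 hg.memLp) ξ

namespace DecayFam

variable {T : ℝ} {f g : ℝ → ℝ → ℂ}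

lemma expDecay (hf : DecayFam T f) {t : ℝ} (ht : t ∈ Icc 0 T) : ExpDecay (f t) := by
  obtain ⟨Θ, hΘ, h⟩ := hf.bound
  exact hΘ.of_norm_le (hf.meas t) (h.mono fun ξ hξ => hξ t ht)

/-- The convolution is dominated by that of the absolute values of the dominating functions. -/
lemma conv (hf : DecayFam T f) (hg : DecayFam T g) : DecayFam T fun t => conv (f t) (g t) := by
  obtain ⟨Θ, hΘ, h⟩ := hf.bound
  obtain ⟨Θ', hΘ', h'⟩ := hg.bound
  have hi := fun ξ => (hΘ.norm.integrable_mul_sub hΘ'.norm ξ).norm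
  have hle : ∀ t ∈ Icc 0 T, ∀ ξ, ∀ᵐ η, ‖f t η * g t (ξ - η)‖ ≤
      ‖((‖Θ η‖ : ℝ) : ℂ) * ((‖Θ' (ξ - η)‖ : ℝ) : ℂ)‖ := by
    intro t ht ξ
    filter_upwards [h, ae_comp_sub_left h' ξ] with η h1 h2
    simp only [norm_mul, Complex.norm_real, norm_norm]
    exact mul_le_mul (h1 t ht) (h2 t ht) (norm_nonneg _) (norm_nonneg _)
  refine ⟨fun t => measurable_conv (hf.meas t) (hg.meas t),
    ⟨_, hΘ.norm.conv hΘ'.norm, Eventually.of_forall fun ξ t ht => ?_⟩, Eventually.of_forall fun ξ => ?_⟩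
  · rw [WKB.conv, WKB.conv, norm_mul, norm_mul]
    refine mul_le_mul_of_nonneg_left ?_ (norm_nonneg _)
    refine (norm_integral_le_of_norm_le (hi ξ) (hle t ht ξ)).trans ?_
    have e : (fun η => ((‖Θ η‖ : ℝ) : ℂ) * ((‖Θ' (ξ - η)‖ : ℝ) : ℂ)) =
        fun η => ((‖Θ η‖ * ‖Θ' (ξ - η)‖ : ℝ) : ℂ) := by ext η; push_cast; rfl
    rw [e, integral_complex_ofReal, Complex.norm_real]
    refine le_trans (le_of_eq ?_) (le_abs_self _)
    refine integral_congr_ae (Eventually.of_forall fun η => ?_)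
    simp
  · refine ContinuousOn.mul continuousOn_const ?_
    refine continuousOn_of_dominated (F := fun t η => f t η * g t (ξ - η)) (fun t ht => ?_)
      (fun t ht => hle t ht ξ) (hi ξ) ?_
    · exact ((hf.meas t).mul ((hg.meas t).comp
        (measurable_const.sub measurable_id))).aestronglyMeasurable
    · filter_upwards [hf.cont, ae_comp_sub_left hg.cont ξ] with η h1 h2
      exact h1.mul h2

lemma dHat (hf : DecayFam T f) : DecayFam T fun t => dHat (f t) := by
  obtain ⟨Θ, hΘ, h⟩ := hf.bound
  refine ⟨fun t => (Complex.measurable_ofReal.const_mul _).mul (hf.meas t),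
    ⟨_, hΘ.dHat, h.mono fun ξ hξ t ht => ?_⟩, ?_⟩
  · rw [WKB.dHat, WKB.dHat, norm_mul, norm_mul _ (Θ ξ)]
    exact mul_le_mul_of_nonneg_left (hξ t ht) (norm_nonneg _)
  · filter_upwards [hf.cont] with ξ h1
    exact continuousOn_const.mul h1

lemma conjHat (hf : DecayFam T f) : DecayFam T fun t => conjHat (f t) := by
  obtain ⟨Θ, hΘ, h⟩ := hf.bound
  refine ⟨fun t => Complex.continuous_conj.measurable.comp ((hf.meas t).comp measurable_neg),
    ⟨_, hΘ.conjHat, ((Measure.measurePreserving_neg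
    volume).quasiMeasurePreserving.ae h).mono fun ξ hξ t ht => ?_⟩, ?_⟩
  · simpa only [WKB.conjHat, RCLike.norm_conj] using hξ t ht
  · filter_upwards [(Measure.measurePreserving_neg volume).quasiMeasurePreserving.ae hf.cont]
      with ξ h1
    exact Complex.continuous_conj.comp_continuousOn h1

lemma const_mul (hf : DecayFam T f) (c : ℂ) : DecayFam T fun t ξ => c * f t ξ := by
  obtain ⟨Θ, hΘ, h⟩ := hf.bound
  refine ⟨fun t => (hf.meas t).const_mul c, ⟨_, hΘ.const_mul c, h.mono fun ξ hξ t ht => ?_⟩, ?_⟩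
  · rw [norm_mul, norm_mul]
    exact mul_le_mul_of_nonneg_left (hξ t ht) (norm_nonneg _)
  · filter_upwards [hf.cont] with ξ h1
    exact continuousOn_const.mul h1

lemma neg (hf : DecayFam T f) : DecayFam T fun t ξ => -f t ξ := by
  simpa using hf.const_mul (-1)

lemma add (hf : DecayFam T f) (hg : DecayFam T g) : DecayFam T fun t ξ => f t ξ + g t ξ := by
  obtain ⟨Θ, hΘ, h⟩ := hf.bound
  obtain ⟨Θ', hΘ', h'⟩ := hg.bound
  refine ⟨fun t => (hf.meas t).add (hg.meas t), ⟨_, hΘ.norm.add hΘ'.norm, ?_⟩, ?_⟩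
  · filter_upwards [h, h'] with ξ h1 h2 t ht
    refine (norm_add_le _ _).trans ((add_le_add (h1 t ht) (h2 t ht)).trans ?_)
    rw [← Complex.ofReal_add, Complex.norm_real]
    exact le_abs_self _
  · filter_upwards [hf.cont, hg.cont] with ξ h1 h2
    exact h1.add h2

lemma convPow (hf : DecayFam T f) (n : ℕ) : DecayFam T fun t => convPow (f t) n := by
  induction n with
  | zero => exact hf
  | succ n ih => exact hf.conv ih

lemma modSq (hf : DecayFam T f) : DecayFam T fun t => modSq (f t) := hf.conv hf.conjHat

lemma phaseRHS (hf : DecayFam T f) (hg : DecayFam T g) (α μ : ℝ) (n m : ℕ) :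
    DecayFam T fun t => phaseRHS α μ n m (f t) (g t) :=
  ((((hf.dHat.conv hf.dHat).const_mul _).add (((hg.modSq.convPow n).conv hf.dHat).const_mul _)).add
    ((hg.modSq.convPow m).const_mul _)).neg

lemma ampRHS (hf : DecayFam T f) (hg : DecayFam T g) (α : ℝ) (n : ℕ) :
    DecayFam T fun t => ampRHS α n (f t) (g t) :=
  (((hf.dHat.conv hg.dHat).add ((hg.conv hf.dHat.dHat).const_mul _)).add
    (((hg.modSq.convPow n).conv hg).dHat.const_mul _)).neg

lemma continuousOn_synth (hf : DecayFam T f) (x : ℝ) :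
    ContinuousOn (fun t => synth (f t) x) (Icc 0 T) := by
  obtain ⟨Θ, hΘ, h⟩ := hf.bound
  refine ContinuousOn.mul continuousOn_const ?_
  refine continuousOn_of_dominated
    (F := fun t ξ => Complex.exp (Complex.I * ((x * ξ : ℝ) : ℂ)) * f t ξ) (fun t ht => ?_)
    (fun t ht => h.mono fun ξ hξ => ?_) hΘ.integrable.norm ?_
  · exact (integrable_exp_mul (hf.expDecay ht).integrable x).aestronglyMeasurable
  · rw [norm_mul, mul_comm Complex.I, Complex.norm_exp_ofReal_mul_I, one_mul]
    exact hξ t ht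
  · filter_upwards [hf.cont] with ξ h1
    exact continuousOn_const.mul h1

end DecayFam

/-- Fubini's theorem for the synthesis of a time integral. -/
lemma synth_integral {t : ℝ} {f : ℝ → ℝ → ℂ}
    (hf : Integrable (Function.uncurry f) ((volume.restrict (Icc 0 t)).prod volume)) (x : ℝ) :
    synth (fun ξ => ∫ r in Icc 0 t, f r ξ) x = ∫ r in Icc 0 t, synth (f r) x := by
  have hi : Integrable (Function.uncurry fun r ξ =>
      Complex.exp (Complex.I * ((x * ξ : ℝ) : ℂ)) * f r ξ)
      ((volume.restrict (Icc 0 t)).prod volume) := by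
    refine Integrable.bdd_mul (c := 1) hf (f := fun p : ℝ × ℝ =>
      Complex.exp (Complex.I * ((x * p.2 : ℝ) : ℂ)))
      (Continuous.aestronglyMeasurable (by fun_prop)) (Eventually.of_forall fun r => ?_)
    rw [mul_comm, Complex.norm_exp_ofReal_mul_I]
  simp only [synth]
  rw [integral_const_mul, integral_integral_swap hi]
  congr 2
  ext ξ
  rw [integral_const_mul]

lemma integrable_uncurry_of_lintegral {t : ℝ} {f : ℝ → ℝ → ℂ}
    (hf : Measurable (Function.uncurry f))
    (h : ∫⁻ r in Icc 0 t, ∫⁻ ξ, ‖f r ξ‖ₑ ≠ ∞) :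
    Integrable (Function.uncurry f) ((volume.restrict (Icc 0 t)).prod volume) := by
  refine ⟨hf.aestronglyMeasurable, ?_⟩
  rw [HasFiniteIntegral, lintegral_prod _ hf.enorm.aemeasurable]
  exact lt_top_iff_ne_top.2 h

/-- Since the weight is bounded below, finiteness of any of the norms `intN` implies integrability
in time and frequency. -/
lemma lintegral_lintegral_ne_top_of_intN {w : ℝ → ℝ} {M T s κ : ℝ} (hw : Measurable w)
    (hκ : 0 < κ) (hwκ : ∀ t ∈ Icc 0 T, κ ≤ w t) (hM : 0 < M) {F : ℝ → ℝ → ℝ≥0∞}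
    (hF : Measurable (Function.uncurry F)) (h : intN w M T s F ≠ ∞) :
    ∫⁻ r in Icc 0 T, ∫⁻ ξ, F r ξ ≠ ∞ := by
  have hE := embConst_ne_top (r := 1) (by norm_num)
  obtain ⟨C, hC, hle⟩ := exists_nrm_le (half_lt_self hκ) 1 s
  have h1 : ∫⁻ r in Icc 0 T, ∫⁻ ξ, F r ξ ≤
      (embConst 1 * C) * ∫⁻ r in Icc 0 T, nrm (w r) s (F r) := by
    rw [← lintegral_const_mul' _ _ (ENNReal.mul_ne_top hE hC)]
    refine setLIntegral_mono' measurableSet_Icc fun r hr =>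
      (lintegral_le_nrm (s := 1) (measurable_slice hF r).aemeasurable (half_pos hκ).le).trans ?_
    rw [mul_assoc]
    gcongr
    refine (hle _).trans ?_
    gcongr
    exact nrm_mono (hwκ r hr) le_rfl (Eventually.of_forall fun _ => le_rfl)
  have hp : 0 < √(2 * M) := Real.sqrt_pos.2 (by positivity)
  have h2 := lintegral_mul_le_ltwo (μ := volume.restrict (Icc 0 T)) (F := fun _ => 1)
    (G := fun r => nrm (w r) s (F r)) aemeasurable_const (measurable_nrm hw s hF).aemeasurable
  simp only [one_mul] at h2
  have h3 : ltwo (volume.restrict (Icc 0 T)) (fun r => nrm (w r) s (F r)) ≠ ∞ := by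
    intro h4
    rw [intN, ltwo_const_mul ENNReal.ofReal_ne_top, h4, ENNReal.mul_top] at h
    · exact h rfl
    · exact (ENNReal.ofReal_pos.2 hp).ne'
  have h4 : ltwo (volume.restrict (Icc 0 T)) (fun _ => 1) ≠ ∞ := by
    rw [ltwo]
    simp
  exact ne_top_of_le_ne_top (by finiteness) (h1.trans (mul_le_mul' le_rfl h2))

/-! ### The function spaces on the Fourier side -/

lemma wt_sq (w s ξ : ℝ) :
    wt w s ξ ^ 2 = ENNReal.ofReal (bracket ξ ^ (2 * s) * Real.exp (2 * w * bracket ξ)) := by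
  have h0 := bracket_pos ξ
  rw [wt, ← ENNReal.ofReal_pow (by positivity), mul_pow, ← Real.exp_nat_mul, ← Real.rpow_natCast,
    ← Real.rpow_mul h0.le]
  congr 2
  · congr 1; push_cast; ring
  · congr 1; push_cast; ring

lemma wt_mul_enorm_exp_mul (w s ξ : ℝ) (z : ℂ) :
    wt 0 s ξ * ‖((Real.exp (w * bracket ξ) : ℝ) : ℂ) * z‖ₑ = wt w s ξ * ‖z‖ₑ := by
  rw [enorm_mul, ← mul_assoc, ← ofReal_norm (((Real.exp (w * bracket ξ) : ℝ) : ℂ)),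
    Complex.norm_real, Real.norm_of_nonneg (Real.exp_pos _).le, wt, wt,
    ← ENNReal.ofReal_mul (mul_nonneg (Real.rpow_nonneg (bracket_pos ξ).le _)
      (Real.exp_pos _).le)]
  simp

lemma normSq_eq (w s : ℝ) (ψ : ℝ → ℂ) : normSq w s ψ = nrm w s (fun ξ => ‖hat ψ ξ‖ₑ) ^ 2 := by
  rw [normSq, nrm, ltwo_sq]
  refine lintegral_congr fun ξ => ?_
  rw [mul_pow, wt_sq]

lemma normSq_synth (w s : ℝ) {f : ℝ → ℂ} (hf : ExpDecay f) :
    normSq w s (synth f) = nrm w s (fun ξ => ‖f ξ‖ₑ) ^ 2 := by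
  rw [normSq_eq, nrm_congr]
  filter_upwards [(memLp_synth_and_hat hf.integrable hf.memLp).2] with ξ h
  rw [h]

lemma ofReal_mul_lintegral_nrm_sq {w : ℝ → ℝ} {M T s : ℝ} (hM : 0 < M) (F : ℝ → ℝ → ℝ≥0∞) :
    ENNReal.ofReal (2 * M) * ∫⁻ t in Icc 0 T, nrm (w t) s (F t) ^ 2 = intN w M T s F ^ 2 := by
  rw [intN, ltwo_const_mul ENNReal.ofReal_ne_top, mul_pow, ofReal_sqrt_sq (by positivity), ltwo_sq]

lemma tripleSq_le_supN_sq {w : ℝ → ℝ} {M T s : ℝ} (hM : 0 < M) {ψ : ℝ → ℝ → ℂ}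
    {F : ℝ → ℝ → ℝ≥0∞} (h : ∀ t ∈ Icc 0 T, ∀ r, normSq (w t) r (ψ t) = nrm (w t) r (F t) ^ 2) :
    tripleSq w M s T ψ ≤ supN w M T s F ^ 2 := by
  refine max_le (iSup₂_le fun t ht => ?_) ?_
  · rw [h t ht]
    exact pow_le_pow_left' (nrm_le_supN ht) 2
  · rw [setLIntegral_congr_fun measurableSet_Icc (fun t ht => h t ht _),
      ofReal_mul_lintegral_nrm_sq hM]
    exact pow_le_pow_left' intN_le_supN 2

/-- A family of functions on the Fourier side whose weighted versions
`⟨ξ⟩^s e^{w(t)⟨ξ⟩} |f(t,ξ)|` are dominated by a single square integrable function, and which is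
continuous in time at almost every frequency. -/
structure WtFam (w : ℝ → ℝ) (T s : ℝ) (f : ℝ → ℝ → ℂ) : Prop where
  meas : ∀ t, Measurable (f t)
  bound : ∃ Θ : ℝ → ℝ≥0∞, Measurable Θ ∧ ltwo volume Θ ≠ ∞ ∧
    ∀ t ∈ Icc 0 T, ∀ ξ, wt (w t) s ξ * ‖f t ξ‖ₑ ≤ Θ ξ
  cont : ∀ᵐ ξ, ContinuousOn (fun t => f t ξ) (Icc 0 T)

/-- The dominating function comes from the bound `wt_mul_duhamel_le`, which is uniform in time at each
frequency. -/
lemma wtFam_duhamel {w₀ M T s : ℝ} (ε : ℝ) (hM : 0 < M) (hT : 0 ≤ T) {f₀ : ℝ → ℂ}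
    (hf₀ : Measurable f₀) (nf₀ : nrm w₀ s (fun ξ => ‖f₀ ξ‖ₑ) ≠ ∞) {F : ℝ → ℝ → ℂ}
    (hF : Measurable (Function.uncurry F))
    (nF : intN (fun t => w₀ - M * t) M T (s - 1 / 2) (fun t ξ => ‖F t ξ‖ₑ) ≠ ∞) :
    WtFam (fun t => w₀ - M * t) T s (duhamel ε f₀ F) := by
  have hw : Measurable fun r : ℝ => w₀ - M * r := by fun_prop
  have hFe := measurable_enorm_uncurry hF
  set L : ℝ → ℝ≥0∞ := fun ξ => ltwo (volume.restrict (Icc 0 T)) fun t =>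
    ENNReal.ofReal (√(2 * M)) * (wt (w₀ - M * t) (s - 1 / 2) ξ * ‖F t ξ‖ₑ) with hL
  have mL : Measurable L := by
    have : Measurable fun p : ℝ × ℝ => (ENNReal.ofReal (√(2 * M)) *
        (wt (w₀ - M * p.2) (s - 1 / 2) p.1 * ‖F p.2 p.1‖ₑ)) ^ 2 :=
      (Measurable.const_mul (((measurable_wt_uncurry hw (s - 1 / 2)).comp measurable_swap).mul
        (hF.comp measurable_swap).enorm) _).pow_const 2
    exact this.lintegral_prod_right'.pow_const _
  refine ⟨fun t => measurable_slice (measurable_duhamel_uncurry ε hf₀ hF) t,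
    ⟨fun ξ => wt w₀ s ξ * ‖f₀ ξ‖ₑ + ENNReal.ofReal (1 / (2 * M)) * L ξ, ?_, ?_, ?_⟩, ?_⟩
  · exact ((measurable_wt _ _).mul hf₀.enorm).add (mL.const_mul _)
  · rw [intN_eq hw hFe] at nF
    refine ne_top_of_le_ne_top ?_ (ltwo_add_le ((measurable_wt _ _).mul hf₀.enorm).aemeasurable
      (mL.const_mul _).aemeasurable)
    rw [ltwo_const_mul ENNReal.ofReal_ne_top]
    exact ENNReal.add_ne_top.2 ⟨nf₀, ENNReal.mul_ne_top ENNReal.ofReal_ne_top nF⟩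
  · intro t ht ξ
    refine (mul_le_mul_right (enorm_duhamel_le _ _ _ _ _) _).trans ?_
    rw [mul_add]
    refine add_le_add ?_ (wt_mul_duhamel_le hM hFe ht ξ)
    gcongr
    refine wt_mono ?_ le_rfl ξ
    have := mul_nonneg hM.le ht.1
    linarith
  · filter_upwards [ae_integrableOn_of_intN hM hT hF nF] with ξ hξ
    refine ContinuousOn.mul (by fun_prop) (continuousOn_const.add ?_)
    exact intervalIntegral.continuousOn_primitive_Icc (integrableOn_exp_mul hξ)

namespace WtFam

variable {w : ℝ → ℝ} {T s κ : ℝ} {f : ℝ → ℝ → ℂ}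

lemma congr (hf : WtFam w T s f) {g : ℝ → ℝ → ℂ} (hg : ∀ t, Measurable (g t))
    (h : ∀ t ∈ Icc 0 T, ∀ ξ, g t ξ = f t ξ) : WtFam w T s g := by
  obtain ⟨Θ, h1, h2, h3⟩ := hf.bound
  refine ⟨hg, ⟨Θ, h1, h2, fun t ht ξ => by rw [h t ht]; exact h3 t ht ξ⟩, ?_⟩
  filter_upwards [hf.cont] with ξ hξ
  exact hξ.congr fun t ht => h t ht ξ

lemma decayFam (hf : WtFam w T s f) (hκ : 0 < κ) (hw : ∀ t ∈ Icc 0 T, κ ≤ w t) :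
    DecayFam T f := by
  obtain ⟨Θ, h1, h2, h3⟩ := hf.bound
  refine ⟨hf.meas, ⟨fun ξ => ((Θ ξ / wt κ s ξ).toReal : ℂ), ?_, ?_⟩, hf.cont⟩
  · refine expDecay_of_nrm hκ (s := s) (Complex.measurable_ofReal.comp
      (h1.div (measurable_wt κ s)).ennreal_toReal) (ne_top_of_le_ne_top h2 (ltwo_mono fun ξ => ?_))
    dsimp only
    rw [← ofReal_norm, Complex.norm_real, Real.norm_of_nonneg ENNReal.toReal_nonneg]
    exact (mul_le_mul_right ENNReal.ofReal_toReal_le _).trans ENNReal.mul_div_le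
  · filter_upwards [ae_lt_top_of_ltwo h1.aemeasurable h2] with ξ hξ t ht
    rw [Complex.norm_real, Real.norm_of_nonneg ENNReal.toReal_nonneg, ← toReal_enorm]
    refine ENNReal.toReal_mono (ENNReal.div_ne_top hξ.ne (wt_ne_zero _ _ _)) ?_
    rw [ENNReal.le_div_iff_mul_le (Or.inl (wt_ne_zero _ _ _)) (Or.inl (wt_ne_top _ _ _)), mul_comm]
    exact (mul_le_mul_left (wt_mono (hw t ht) le_rfl ξ) _).trans (h3 t ht ξ)

lemma nrm_ne_top (hf : WtFam w T s f) {t : ℝ} (ht : t ∈ Icc 0 T) :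
    nrm (w t) s (fun ξ => ‖f t ξ‖ₑ) ≠ ∞ := by
  obtain ⟨Θ, h1, h2, h3⟩ := hf.bound
  exact ne_top_of_le_ne_top h2 (ltwo_mono (h3 t ht))

lemma memC (hf : WtFam w T s f) (hκ : 0 < κ) (hw : ∀ t ∈ Icc 0 T, κ ≤ w t)
    (hwc : Continuous w) : MemC w T s fun t => synth (f t) := by
  have hd := hf.decayFam hκ hw
  have hhat : ∀ t ∈ Icc 0 T, hat (synth (f t)) =ᵐ[volume] f t := fun t ht =>
    (memLp_synth_and_hat (hd.expDecay ht).integrable (hd.expDecay ht).memLp).2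
  refine ⟨fun t ht => ⟨(memLp_synth_and_hat (hd.expDecay ht).integrable (hd.expDecay ht).memLp).1,
    ?_⟩, fun t₀ ht₀ => ?_⟩
  · rw [normSq_synth _ _ (hd.expDecay ht)]
    exact ENNReal.pow_lt_top (lt_top_iff_ne_top.2 (hf.nrm_ne_top ht))
  obtain ⟨Θ, h1, h2, h3⟩ := hf.bound
  set H : ℝ → ℝ → ℝ≥0∞ := fun t ξ => ENNReal.ofReal (bracket ξ ^ (2 * s)) *
      ‖((Real.exp (w t * bracket ξ) : ℝ) : ℂ) * f t ξ
        - ((Real.exp (w t₀ * bracket ξ) : ℝ) : ℂ) * f t₀ ξ‖ₑ ^ 2 with hH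
  have mf : ∀ t, Measurable fun ξ => ((Real.exp (w t * bracket ξ) : ℝ) : ℂ) * f t ξ := fun t =>
    (Complex.measurable_ofReal.comp (Real.measurable_exp.comp
      (continuous_bracket.measurable.const_mul _))).mul (hf.meas t)
  have hle : ∀ t ∈ Icc 0 T, ∀ ξ,
      wt 0 s ξ * ‖((Real.exp (w t * bracket ξ) : ℝ) : ℂ) * f t ξ‖ₑ ≤ Θ ξ := by
    intro t ht ξ
    exact (wt_mul_enorm_exp_mul _ _ _ _).trans_le (h3 t ht ξ)
  have hbd : ∀ t ∈ Icc 0 T, ∀ ξ, H t ξ ≤ (Θ ξ + Θ ξ) ^ 2 := by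
    intro t ht ξ
    have : ENNReal.ofReal (bracket ξ ^ (2 * s)) = wt 0 s ξ ^ 2 := by rw [wt_sq]; simp
    rw [hH]
    simp only
    rw [this, ← mul_pow]
    refine pow_le_pow_left' ((mul_le_mul_right enorm_sub_le _).trans ?_) 2
    rw [mul_add]
    exact add_le_add (hle t ht ξ) (hle t₀ ht₀ ξ)
  have lim : Tendsto (fun t => ∫⁻ ξ, H t ξ) (𝓝[Icc 0 T] t₀) (𝓝 (∫⁻ _ : ℝ, 0)) := by
    refine tendsto_lintegral_filter_of_dominated_convergence (fun ξ => (Θ ξ + Θ ξ) ^ 2)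
      (Eventually.of_forall fun t => ?_) ?_ ?_ ?_
    · exact Measurable.mul (ENNReal.measurable_ofReal.comp
        (continuous_bracket.measurable.pow_const _)) (((mf t).sub (mf t₀)).enorm.pow_const 2)
    · filter_upwards [self_mem_nhdsWithin] with t ht
      exact Eventually.of_forall (hbd t ht)
    · rw [← ltwo_sq]
      have := ltwo_add_le (μ := volume) h1.aemeasurable h1.aemeasurable
      exact ENNReal.pow_ne_top (ne_top_of_le_ne_top (by finiteness) this)
    · filter_upwards [hf.cont] with ξ hξ
      have c1 : ContinuousOn (fun t => ((Real.exp (w t * bracket ξ) : ℝ) : ℂ) * f t ξ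
          - ((Real.exp (w t₀ * bracket ξ) : ℝ) : ℂ) * f t₀ ξ) (Icc 0 T) := by
        refine ContinuousOn.sub (ContinuousOn.mul (Continuous.continuousOn ?_) hξ)
          continuousOn_const
        fun_prop
      have c2 := (c1 t₀ ht₀).enorm
      have c3 := (ENNReal.continuous_pow 2).continuousAt.tendsto.comp c2
      have c4 := ENNReal.Tendsto.const_mul (a := ENNReal.ofReal (bracket ξ ^ (2 * s))) c3
        (Or.inr ENNReal.ofReal_ne_top)
      simpa [hH, Function.comp_def] using c4
  rw [lintegral_zero] at lim
  refine lim.congr' ?_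
  filter_upwards [self_mem_nhdsWithin] with t ht
  refine lintegral_congr_ae ?_
  filter_upwards [hhat t ht, hhat t₀ ht₀] with ξ e1 e2
  rw [hH, e1, e2]

end WtFam

/-! ### From mild to classical solutions -/

lemma synth_congr {f g : ℝ → ℂ} (h : f =ᵐ[volume] g) : synth f = synth g := by
  ext x
  rw [synth, synth]
  congr 1
  refine integral_congr_ae ?_
  filter_upwards [h] with ξ hξ
  rw [hξ]

lemma DecayFam.integrable_uncurry {T : ℝ} {f : ℝ → ℝ → ℂ} (hf : DecayFam T f)
    (hm : Measurable (Function.uncurry f)) :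
    Integrable (Function.uncurry f) ((volume.restrict (Icc 0 T)).prod volume) := by
  obtain ⟨Θ, hΘ, h⟩ := hf.bound
  refine integrable_uncurry_of_lintegral hm (ne_top_of_le_ne_top
    (b := ∫⁻ _ in Icc 0 T, ∫⁻ ξ, ‖Θ ξ‖ₑ) ?_ ?_)
  · rw [setLIntegral_const]
    exact ENNReal.mul_ne_top hΘ.integrable.2.ne (by simp)
  · exact setLIntegral_mono' measurableSet_Icc fun r hr =>
      lintegral_mono_ae (h.mono fun ξ hξ => enorm_le_iff_norm_le.2 (hξ r hr))

lemma hasDerivWithinAt_of_eq_integral {T : ℝ} {k y : ℝ → ℂ} {y₀ : ℂ}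
    (hk : ContinuousOn k (Icc 0 T)) (h : ∀ t ∈ Icc 0 T, y t = y₀ + ∫ r in Icc 0 t, k r)
    {t : ℝ} (ht : t ∈ Icc 0 T) : HasDerivWithinAt y (k t) (Icc 0 T) t := by
  have hT : 0 ≤ T := ht.1.trans ht.2
  set k' : ℝ → ℂ := IccExtend hT ((Icc 0 T).domRestrict k) with hk'
  have hc : Continuous k' := hk.domRestrict.Icc_extend'
  have he : ∀ r ∈ Icc 0 T, k' r = k r := fun r hr => by rw [hk', IccExtend_of_mem _ _ hr]; rfl
  have h1 : HasDerivAt (fun t => y₀ + ∫ r in (0 : ℝ)..t, k' r) (k' t) t :=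
    ((hc.integral_hasStrictDerivAt 0 t).hasDerivAt).const_add y₀
  rw [he t ht] at h1
  have e : ∀ s ∈ Icc 0 T, y s = y₀ + ∫ r in (0 : ℝ)..s, k' r := by
    intro s hs
    rw [h s hs, intervalIntegral.integral_of_le hs.1, ← integral_Icc_eq_integral_Ioc]
    congr 1
    exact setIntegral_congr_fun measurableSet_Icc fun r hr => (he r ⟨hr.1, hr.2.trans hs.2⟩).symm
  exact h1.hasDerivWithinAt.congr e (e t ht)

lemma dHat_dHat (f : ℝ → ℂ) (ξ : ℝ) : dHat (dHat f) ξ = -((ξ : ℂ) ^ 2) * f ξ := by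
  rw [dHat, dHat]
  linear_combination (ξ : ℂ) ^ 2 * f ξ * Complex.I_sq

/-- The synthesis of a mild solution is a classical solution of the linear equation
`∂ₜ y = (iε/2) ∂ₓ² y + F`. -/
lemma hasDerivWithinAt_synth_of_duhamel {ε T : ℝ} {f₀ : ℝ → ℂ} {f F : ℝ → ℝ → ℂ}
    (hf₀ : ExpDecay f₀) (hf : DecayFam T f) (mf : Measurable (Function.uncurry f))
    (hF : DecayFam T F) (mF : Measurable (Function.uncurry F))
    (h : ∀ t ∈ Icc 0 T, ∀ ξ, f t ξ = duhamel ε f₀ F t ξ) (x : ℝ) {t : ℝ} (ht : t ∈ Icc 0 T) :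
    HasDerivWithinAt (fun s => synth (f s) x)
      (synth (F t) x + Complex.I * ε / 2 * iteratedDeriv 2 (synth (f t)) x) (Icc 0 T) t := by
  set k : ℝ → ℝ → ℂ := fun r ξ => F r ξ + Complex.I * ε / 2 * dHat (dHat (f r)) ξ with hk
  have hD := (hf.dHat.dHat.const_mul (Complex.I * ε / 2))
  have hkd : DecayFam T k := hF.add hD
  have mk : Measurable (Function.uncurry k) :=
    mF.add ((measurable_dHat_uncurry (measurable_dHat_uncurry mf)).const_mul _)
  have iF := hF.integrable_uncurry mF
  have ik := hkd.integrable_uncurry mk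
  have e : synth (F t) x + Complex.I * ε / 2 * iteratedDeriv 2 (synth (f t)) x =
      synth (k t) x := by
    rw [(hf.expDecay ht).iteratedDeriv_two, hk, ← synth_const_mul, ← synth_add
      (hF.expDecay ht).integrable (hD.expDecay ht).integrable]
  rw [e]
  refine hasDerivWithinAt_of_eq_integral (y₀ := synth f₀ x) (hkd.continuousOn_synth x)
    (fun s hs => ?_) ht
  have iks : Integrable (Function.uncurry k) ((volume.restrict (Icc 0 s)).prod volume) :=
    ik.mono_measure (Measure.prod_mono (Measure.restrict_mono (Icc_subset_Icc_right hs.2) le_rfl)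
      le_rfl)
  have i2 : Integrable fun ξ => ∫ r in Icc 0 s, k r ξ := iks.integral_prod_right
  rw [← synth_integral iks, ← synth_add hf₀.integrable i2]
  refine congrFun (synth_congr ?_) x
  filter_upwards [iF.prod_left_ae] with ξ hξ
  rw [h s hs, duhamel_eq_integral hs hξ]
  congr 1
  refine setIntegral_congr_fun measurableSet_Icc fun r hr => ?_
  simp only [hk]
  rw [← h r ⟨hr.1, hr.2.trans hs.2⟩, dHat_dHat]
  push_cast
  ring

lemma hasDerivAt_toC {φ : ℝ → ℝ} (h : Differentiable ℝ φ) (x : ℝ) :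
    HasDerivAt (toC φ) ((deriv φ x : ℝ) : ℂ) x := (h x).hasDerivAt.ofReal_comp

lemma deriv_toC {φ : ℝ → ℝ} (h : Differentiable ℝ φ) : deriv (toC φ) = toC (deriv φ) :=
  funext fun x => (hasDerivAt_toC h x).deriv

lemma iteratedDeriv_two_toC {φ : ℝ → ℝ} (h : ContDiff ℝ (⊤ : ℕ∞) φ) :
    iteratedDeriv 2 (toC φ) = toC (iteratedDeriv 2 φ) := by
  have h1 : ContDiff ℝ 2 φ := contDiff_infty.1 h 2
  rw [iteratedDeriv_succ, iteratedDeriv_one, iteratedDeriv_succ, iteratedDeriv_one,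
    deriv_toC (h1.differentiable (by norm_num)), deriv_toC]
  exact h1.differentiable_deriv_two

/-- The right-hand sides of the system, in terms of the Fourier transforms of the solution. -/
lemma synth_rhs_eq {φ : ℝ → ℝ} {a u v : ℝ → ℂ} (α μ : ℝ) (n m : ℕ) (hφ : ContDiff ℝ (⊤ : ℕ∞) φ)
    (hu : ExpDecay u) (hv : ExpDecay v) (eφ : toC φ = synth u) (ea : a = synth v) (x : ℝ) :
    synth (phaseRHS α μ n m u v) x =
        ((-(1 / 2 * deriv φ x ^ 2 + 1 / 2 * (α * (‖a x‖ ^ 2) ^ (n + 1)) * deriv φ x +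
          μ * (‖a x‖ ^ 2) ^ (m + 1)) : ℝ) : ℂ) ∧
      synth (ampRHS α n u v) x = -(((deriv φ x : ℝ) : ℂ) * deriv a x +
        1 / 2 * a x * ((iteratedDeriv 2 φ x : ℝ) : ℂ) +
        1 / 2 * deriv (fun y => ((α * (‖a y‖ ^ 2) ^ (n + 1) : ℝ) : ℂ) * a y) x) := by
  have h1 : deriv (synth u) x = ((deriv φ x : ℝ) : ℂ) := by
    rw [← eφ, deriv_toC (hφ.differentiable (by simp))]; rfl
  have h2 : iteratedDeriv 2 (synth u) x = ((iteratedDeriv 2 φ x : ℝ) : ℂ) := by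
    rw [← eφ, iteratedDeriv_two_toC hφ]; rfl
  rw [synth_phaseRHS hu hv, synth_ampRHS hu hv, h1, h2, ea]
  refine ⟨?_, rfl⟩
  push_cast
  ring

lemma MemC.congr {w : ℝ → ℝ} {T s : ℝ} {ψ ψ' : ℝ → ℝ → ℂ} (h : MemC w T s ψ)
    (he : ∀ t ∈ Icc 0 T, ψ' t = ψ t) : MemC w T s ψ' := by
  refine ⟨fun t ht => by rw [he t ht]; exact h.1 t ht, fun t₀ ht₀ => ?_⟩
  refine (h.2 t₀ ht₀).congr' ?_
  filter_upwards [self_mem_nhdsWithin] with t ht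
  rw [he t ht, he t₀ ht₀]

lemma lintegral_nrm_sq_lt_top {w : ℝ → ℝ} {M T s : ℝ} (hM : 0 < M) {F : ℝ → ℝ → ℝ≥0∞}
    (h : supN w M T s F ≠ ∞) : ∫⁻ t in Icc 0 T, nrm (w t) (s + 1 / 2) (F t) ^ 2 < ∞ := by
  have h1 : ENNReal.ofReal (2 * M) * ∫⁻ t in Icc 0 T, nrm (w t) (s + 1 / 2) (F t) ^ 2 ≠ ∞ := by
    rw [ofReal_mul_lintegral_nrm_sq hM]
    exact ENNReal.pow_ne_top (ne_top_of_le_ne_top h intN_le_supN)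
  refine lt_top_iff_ne_top.2 fun h2 => h1 ?_
  rw [h2, ENNReal.mul_top]
  exact (ENNReal.ofReal_pos.2 (by positivity)).ne'

lemma memY_synth {w : ℝ → ℝ} {M T s κ : ℝ} {f : ℝ → ℝ → ℂ} (hf : WtFam w T s f) (hκ : 0 < κ)
    (hw : ∀ t ∈ Icc 0 T, κ ≤ w t) (hwc : Continuous w) (hM : 0 < M)
    (h : supN w M T s (fun t ξ => ‖f t ξ‖ₑ) ≠ ∞) {ψ : ℝ → ℝ → ℂ}
    (he : ∀ t ∈ Icc 0 T, ψ t = synth (f t)) : MemY w T s ψ := by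
  refine ⟨(hf.memC hκ hw hwc).congr he, ?_⟩
  rw [setLIntegral_congr_fun (g := fun t => nrm (w t) (s + 1 / 2) (fun ξ => ‖f t ξ‖ₑ) ^ 2)
    measurableSet_Icc fun t ht => ?_]
  · exact lintegral_nrm_sq_lt_top hM h
  · simp only
    rw [he t ht, normSq_synth _ _ ((hf.decayFam hκ hw).expDecay ht)]

lemma duhamel_zero (ε : ℝ) (f₀ : ℝ → ℂ) (F : ℝ → ℝ → ℂ) : duhamel ε f₀ F 0 = f₀ := by
  ext ξ
  simp [duhamel]

namespace IsMild

variable {α μ ε w₀ M T ℓ : ℝ} {n m : ℕ} {u₀ v₀ : ℝ → ℂ} {K : ℝ≥0∞} {u v : ℝ → ℝ → ℂ}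

lemma wtFam_phase (h : IsMild α μ n m ε u₀ v₀ (fun t => w₀ - M * t) M T ℓ K u v) (hM : 0 < M)
    (hT : 0 ≤ T) (hw : 0 < w₀ - M * T) (hℓ : 1 < ℓ) (hK : K ≠ ∞) (hu₀ : Measurable u₀)
    (nu₀ : nrm w₀ (ℓ + 1) (fun ξ => ‖u₀ ξ‖ₑ) ≠ ∞) :
    WtFam (fun t => w₀ - M * t) T (ℓ + 1) u := by
  have hw0 : ∀ t ∈ Icc 0 T, 0 ≤ w₀ - M * t := fun t ht => by
    have := mul_le_mul_of_nonneg_left ht.2 hM.le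
    linarith
  refine (wtFam_duhamel 0 hM hT hu₀ nu₀ (measurable_phaseRHS_uncurry α μ n m h.meas_phase
    h.meas_amp) ?_).congr (measurable_slice h.meas_phase) h.eq_phase
  exact ne_top_of_le_ne_top (phaseLip_ne_top α μ n m hℓ hK) (intN_phaseRHS_ball α μ n m (by fun_prop) hw0
    hℓ hK h.meas_phase h.meas_amp h.phase_le h.amp_le)

lemma wtFam_amp (h : IsMild α μ n m ε u₀ v₀ (fun t => w₀ - M * t) M T ℓ K u v) (hM : 0 < M)
    (hT : 0 ≤ T) (hw : 0 < w₀ - M * T) (hℓ : 1 < ℓ) (hK : K ≠ ∞) (hv₀ : Measurable v₀)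
    (nv₀ : nrm w₀ ℓ (fun ξ => ‖v₀ ξ‖ₑ) ≠ ∞) :
    WtFam (fun t => w₀ - M * t) T ℓ v := by
  have hw0 : ∀ t ∈ Icc 0 T, 0 ≤ w₀ - M * t := fun t ht => by
    have := mul_le_mul_of_nonneg_left ht.2 hM.le
    linarith
  refine (wtFam_duhamel ε hM hT hv₀ nv₀ (measurable_ampRHS_uncurry α n h.meas_phase
    h.meas_amp) ?_).congr (measurable_slice h.meas_amp) h.eq_amp
  exact ne_top_of_le_ne_top (ampLip_ne_top α n hℓ hK) (intN_ampRHS_ball α n (by fun_prop) hw0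
    hℓ hK h.meas_phase h.meas_amp h.phase_le h.amp_le)

/-- A mild solution on the Fourier side is the transform of a classical solution. -/
lemma isSolution (h : IsMild α μ n m ε u₀ v₀ (fun t => w₀ - M * t) M T ℓ K u v) (hM : 0 < M)
    (hT : 0 ≤ T) (hw : 0 < w₀ - M * T) (hℓ : 1 < ℓ) (hK : K ≠ ∞) (hu₀ : Measurable u₀)
    (nu₀ : nrm w₀ (ℓ + 1) (fun ξ => ‖u₀ ξ‖ₑ) ≠ ∞) (hv₀ : Measurable v₀)
    (nv₀ : nrm w₀ ℓ (fun ξ => ‖v₀ ξ‖ₑ) ≠ ∞) {φ₀ : ℝ → ℝ} {a₀ : ℝ → ℂ}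
    (hφ₀ : synth u₀ =ᵐ[volume] toC φ₀) (ha₀ : synth v₀ =ᵐ[volume] a₀)
    {φ : ℝ → ℝ → ℝ} {a : ℝ → ℝ → ℂ} (hφ : ∀ t ∈ Icc 0 T, toC (φ t) = synth (u t))
    (ha : ∀ t ∈ Icc 0 T, a t = synth (v t)) :
    MemX (fun t => w₀ - M * t) T ℓ φ a ∧
      IsSolution (fun s => μ * s ^ (m + 1)) (fun s => α * s ^ (n + 1)) ε T φ₀ a₀ φ a := by
  have hw1 : ∀ t ∈ Icc 0 T, w₀ - M * T ≤ w₀ - M * t := fun t ht => by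
    have := mul_le_mul_of_nonneg_left ht.2 hM.le
    linarith
  have hwc : Continuous fun t => w₀ - M * t := by fun_prop
  have h0 : (0 : ℝ) ∈ Icc 0 T := ⟨le_rfl, hT⟩
  have Wu := h.wtFam_phase hM hT hw hℓ hK hu₀ nu₀
  have Wv := h.wtFam_amp hM hT hw hℓ hK hv₀ nv₀
  have Du := Wu.decayFam hw hw1
  have Dv := Wv.decayFam hw hw1
  have hw₀ : 0 < w₀ := hw.trans_le (by nlinarith)
  have re : ∀ t ∈ Icc 0 T, φ t = fun x => (synth (u t) x).re := fun t ht => by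
    rw [← hφ t ht]; rfl
  have sφ : ∀ t ∈ Icc 0 T, ContDiff ℝ (⊤ : ℕ∞) (φ t) := fun t ht => by
    rw [re t ht]
    exact Complex.reCLM.contDiff.comp (Du.expDecay ht).contDiff
  have rhs := fun t ht x => synth_rhs_eq α μ n m (sφ t ht) (Du.expDecay ht) (Dv.expDecay ht)
    (hφ t ht) (ha t ht) x
  refine ⟨⟨memY_synth Wu hw hw1 hwc hM (ne_top_of_le_ne_top hK h.phase_le) hφ,
    memY_synth Wv hw hw1 hwc hM (ne_top_of_le_ne_top hK h.amp_le) ha⟩, sφ, fun t ht => ?_, ?_, ?_,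
    fun t ht x => ?_, fun t ht x => ?_⟩
  · rw [ha t ht]
    exact (Dv.expDecay ht).contDiff
  · have e : u 0 = u₀ := by
      ext ξ; rw [h.eq_phase 0 h0, duhamel_zero]
    have := hφ 0 h0
    rw [e] at this
    rw [← this] at hφ₀
    filter_upwards [hφ₀] with x hx
    exact Complex.ofReal_injective hx
  · have e : v 0 = v₀ := by
      ext ξ; rw [h.eq_amp 0 h0, duhamel_zero]
    rw [ha 0 h0, e]
    exact ha₀
  · have d := hasDerivWithinAt_synth_of_duhamel (expDecay_of_nrm hw₀ hu₀ nu₀) Du h.meas_phase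
      (Du.phaseRHS Dv α μ n m) (measurable_phaseRHS_uncurry α μ n m h.meas_phase h.meas_amp)
      h.eq_phase x ht
    rw [(rhs t ht x).1, Complex.ofReal_zero, mul_zero, zero_div, zero_mul, add_zero] at d
    have d2 := Complex.reCLM.hasFDerivAt.comp_hasDerivWithinAt t d
    refine (d2.congr (fun s hs => ?_) ?_).congr_deriv ?_
    · rw [re s hs]; rfl
    · rw [re t ht]; rfl
    · rfl
  · have d := hasDerivWithinAt_synth_of_duhamel (expDecay_of_nrm hw₀ hv₀ nv₀) Dv h.meas_amp
      (Du.ampRHS Dv α n) (measurable_ampRHS_uncurry α n h.meas_phase h.meas_amp)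
      h.eq_amp x ht
    rw [(rhs t ht x).2] at d
    refine (d.congr (fun s hs => by rw [ha s hs]) (by rw [ha t ht])).congr_deriv ?_
    rw [← ha t ht]
    ring

/-- The phase of a mild solution is real valued. -/
lemma toC_re_synth (h : IsMild α μ n m ε u₀ v₀ (fun t => w₀ - M * t) M T ℓ K u v) {t : ℝ}
    (ht : t ∈ Icc 0 T) : toC (fun x => (synth (u t) x).re) = synth (u t) := by
  ext x
  refine Complex.conj_eq_iff_re.1 ?_
  rw [← synth_conjHat, synth_congr (h.real_phase t ht)]

end IsMild

/-! ### Regularity in time of elements of the spaces -/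

section

variable {w : ℝ → ℝ} {T s : ℝ} {ψ : ℝ → ℝ → ℂ}

/-- The weighted transform `e^{w(t)⟨ξ⟩} ψ̂(t,ξ)`. -/
def wHat (w : ℝ → ℝ) (ψ : ℝ → ℝ → ℂ) (t ξ : ℝ) : ℂ :=
  ((Real.exp (w t * bracket ξ) : ℝ) : ℂ) * hat (ψ t) ξ

lemma measurable_wHat (w : ℝ → ℝ) (ψ : ℝ → ℝ → ℂ) (t : ℝ) : Measurable (wHat w ψ t) :=
  (Complex.measurable_ofReal.comp (Real.measurable_exp.comp
    (continuous_bracket.measurable.const_mul _))).mul (measurable_hat _)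

lemma nrm_wHat (w : ℝ → ℝ) (s : ℝ) (ψ : ℝ → ℝ → ℂ) (t : ℝ) :
    nrm 0 s (fun ξ => ‖wHat w ψ t ξ‖ₑ) = nrm (w t) s (fun ξ => ‖hat (ψ t) ξ‖ₑ) := by
  rw [nrm, nrm]
  congr 1
  ext ξ
  exact wt_mul_enorm_exp_mul _ _ _ _

lemma MemC.nrm_ne_top (h : MemC w T s ψ) {t : ℝ} (ht : t ∈ Icc 0 T) :
    nrm (w t) s (fun ξ => ‖hat (ψ t) ξ‖ₑ) ≠ ∞ := by
  have := (h.1 t ht).2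
  rw [normSq_eq] at this
  intro h'
  rw [h'] at this
  simp at this

lemma MemC.tendsto_nrm_sub (h : MemC w T s ψ) {t₀ : ℝ} (ht₀ : t₀ ∈ Icc 0 T) :
    Tendsto (fun t => nrm 0 s (fun ξ => ‖wHat w ψ t ξ - wHat w ψ t₀ ξ‖ₑ)) (𝓝[Icc 0 T] t₀)
      (𝓝 0) := by
  have h1 := (ENNReal.continuous_rpow_const (y := 1 / 2)).continuousAt.tendsto.comp (h.2 t₀ ht₀)
  rw [ENNReal.zero_rpow_of_pos (by norm_num)] at h1
  refine h1.congr fun t => ?_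
  rw [nrm, ltwo, Function.comp_apply]
  congr 1
  refine lintegral_congr fun ξ => ?_
  rw [mul_pow, wt_sq, mul_zero, zero_mul, Real.exp_zero, mul_one]
  rfl

lemma nrm_wHat_le (w : ℝ → ℝ) (s : ℝ) (ψ : ℝ → ℝ → ℂ) (t t₀ : ℝ) :
    nrm 0 s (fun ξ => ‖wHat w ψ t ξ‖ₑ) ≤ nrm 0 s (fun ξ => ‖wHat w ψ t₀ ξ‖ₑ) +
      nrm 0 s (fun ξ => ‖wHat w ψ t ξ - wHat w ψ t₀ ξ‖ₑ) := by
  refine le_trans (nrm_mono le_rfl le_rfl (Eventually.of_forall fun ξ => ?_))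
    (nrm_add_le (measurable_wHat w ψ t₀).enorm.aemeasurable
    ((measurable_wHat w ψ t).sub (measurable_wHat w ψ t₀)).enorm.aemeasurable)
  refine le_trans (le_of_eq ?_) (enorm_add_le _ _)
  rw [add_sub_cancel]

lemma MemC.continuousOn_nrm (h : MemC w T s ψ) :
    ContinuousOn (fun t => nrm (w t) s (fun ξ => ‖hat (ψ t) ξ‖ₑ)) (Icc 0 T) := by
  intro t₀ ht₀
  have hD := h.tendsto_nrm_sub ht₀
  have hN := h.nrm_ne_top ht₀
  simp_rw [← nrm_wHat] at hN ⊢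
  have h1 := ENNReal.Tendsto.sub (tendsto_const_nhds (x := nrm 0 s (fun ξ => ‖wHat w ψ t₀ ξ‖ₑ)))
    hD (Or.inl hN)
  have h2 := (tendsto_const_nhds (x := nrm 0 s (fun ξ => ‖wHat w ψ t₀ ξ‖ₑ))).add hD
  rw [tsub_zero] at h1
  rw [add_zero] at h2
  refine tendsto_of_tendsto_of_tendsto_of_le_of_le h1 h2 (fun t => ?_)
    (fun t => nrm_wHat_le w s ψ t t₀)
  refine tsub_le_iff_right.2 ((nrm_wHat_le w s ψ t₀ t).trans (le_of_eq ?_))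
  congr 2
  ext ξ
  rw [← enorm_neg, neg_sub]

lemma MemC.exists_bound (h : MemC w T s ψ) (hT : 0 ≤ T) :
    ∃ C : ℝ≥0∞, C ≠ ∞ ∧ ∀ t ∈ Icc 0 T, nrm (w t) s (fun ξ => ‖hat (ψ t) ξ‖ₑ) ≤ C := by
  obtain ⟨t, ht, hmax⟩ := isCompact_Icc.exists_isMaxOn ⟨0, le_rfl, hT⟩ h.continuousOn_nrm
  exact ⟨_, h.nrm_ne_top ht, fun r hr => hmax hr⟩

/-- An element of `C([0,T], 𝓗_w^s)` has a Fourier transform that is jointly measurable in time and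
frequency. It is obtained by differentiating in `ξ` the primitive of the transform, which is
jointly continuous. -/
lemma MemC.exists_measurable_hat (h : MemC w T s ψ) (hs : 1 / 2 < s) (hT : 0 ≤ T)
    (hw : Measurable w) :
    ∃ u : ℝ → ℝ → ℂ, Measurable (Function.uncurry u) ∧ ∀ t ∈ Icc 0 T, u t =ᵐ[volume] hat (ψ t) := by
  -- Continuity is available for the weighted transform; times outside `[0,T]` are projected onto it.
  set V : ℝ → ℝ → ℂ := fun t => wHat w ψ (projIcc 0 T hT t) with hV
  have hmem : ∀ t : ℝ, (projIcc 0 T hT t : ℝ) ∈ Icc 0 T := fun t => (projIcc 0 T hT t).2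
  have iV : ∀ t, Integrable (V t) := fun t => integrable_of_nrm le_rfl hs (measurable_wHat w ψ _)
    (by rw [nrm_wHat]; exact h.nrm_ne_top (hmem t))
  have hE := embConst_ne_top hs
  set G : ℝ → ℝ → ℂ := fun t ξ => ∫ η in (0 : ℝ)..ξ, V t η with hG
  have cG : Continuous (Function.uncurry G) := by
    refine continuous_iff_continuousAt.2 fun p => ?_
    obtain ⟨t₀, ξ₀⟩ := p
    have hproj : Tendsto (fun t : ℝ => (projIcc 0 T hT t : ℝ)) (𝓝 t₀)
        (𝓝[Icc 0 T] (projIcc 0 T hT t₀ : ℝ)) :=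
      tendsto_nhdsWithin_iff.2 ⟨(continuous_subtype_val.comp continuous_projIcc).tendsto t₀,
        Eventually.of_forall hmem⟩
    have hD := (h.tendsto_nrm_sub (hmem t₀)).comp hproj
    have hD1 := ENNReal.Tendsto.const_mul (a := embConst s) hD (Or.inr hE)
    rw [mul_zero] at hD1
    have hD2 := (ENNReal.tendsto_toReal ENNReal.zero_ne_top).comp hD1
    have hc : Continuous (G t₀) := intervalIntegral.continuous_primitive
      (fun a b => (iV t₀).intervalIntegrable) 0
    have hc1 : Tendsto (fun ξ => ‖G t₀ ξ - G t₀ ξ₀‖) (𝓝 ξ₀) (𝓝 0) :=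
      tendsto_iff_norm_sub_tendsto_zero.1 (hc.tendsto ξ₀)
    rw [ContinuousAt, tendsto_iff_norm_sub_tendsto_zero, nhds_prod_eq]
    have hsum := (hD2.comp tendsto_fst).add (hc1.comp (tendsto_snd (f := 𝓝 t₀)))
    rw [ENNReal.toReal_zero, add_zero] at hsum
    refine squeeze_zero' (Eventually.of_forall fun _ => norm_nonneg _) ?_ hsum
    have hfin : ∀ᶠ t in 𝓝 t₀, embConst s * nrm 0 s (fun ξ => ‖V t ξ - V t₀ ξ‖ₑ) < 1 :=
      hD1.eventually (gt_mem_nhds one_pos)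
    filter_upwards [hfin.prod_inl (𝓝 ξ₀)] with p hp
    have e : Function.uncurry G p - Function.uncurry G (t₀, ξ₀) =
        (∫ η in (0 : ℝ)..p.2, (V p.1 η - V t₀ η)) + (G t₀ p.2 - G t₀ ξ₀) := by
      rw [intervalIntegral.integral_sub (iV _).intervalIntegrable (iV _).intervalIntegrable]
      simp only [Function.uncurry, hG]
      ring
    rw [e]
    refine (norm_add_le _ _).trans (add_le_add ?_ le_rfl)
    have m : Measurable fun η => V p.1 η - V t₀ η :=
      (measurable_wHat w ψ _).sub (measurable_wHat w ψ _)
    rw [← toReal_enorm]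
    refine ENNReal.toReal_mono (hp.trans ENNReal.one_lt_top).ne ?_
    calc _ ≤ ∫⁻ η in uIoc 0 p.2, ‖V p.1 η - V t₀ η‖ₑ := by
          rw [← ofReal_norm, intervalIntegral.norm_intervalIntegral_eq, ofReal_norm]
          exact enorm_integral_le_lintegral_enorm _
      _ ≤ ∫⁻ η, ‖V p.1 η - V t₀ η‖ₑ := setLIntegral_le_lintegral _ _
      _ ≤ _ := lintegral_le_nrm m.enorm.aemeasurable le_rfl
  have mD := measurable_deriv_with_param cG
  refine ⟨fun t ξ => ((Real.exp (-(w t * bracket ξ)) : ℝ) : ℂ) * deriv (G t) ξ, ?_, fun t ht => ?_⟩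
  · refine Measurable.mul (Complex.measurable_ofReal.comp (Real.measurable_exp.comp ?_)) mD
    exact ((hw.comp measurable_fst).mul (continuous_bracket.measurable.comp measurable_snd)).neg
  · filter_upwards [LocallyIntegrable.ae_hasDerivAt_integral (iV t).locallyIntegrable] with ξ hξ
    rw [(hξ 0).deriv, hV]
    simp only [wHat, projIcc_of_mem hT ht]
    rw [← mul_assoc, ← Complex.ofReal_mul, ← Real.exp_add, neg_add_cancel, Real.exp_zero,
      Complex.ofReal_one, one_mul]

end

/-! ### From classical to mild solutions -/

section

lemma duhamel_zero_eq (f₀ : ℝ → ℂ) (F : ℝ → ℝ → ℂ) (t ξ : ℝ) :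
    duhamel 0 f₀ F t ξ = f₀ ξ + ∫ r in Icc 0 t, F r ξ := by
  simp [duhamel]

variable {ε w₀ M T s s' : ℝ}

/-- The time integral of a source with finite norm decays exponentially in frequency. The
regularity index `s` may be negative. -/
lemma expDecay_integral (hM : 0 < M) {t : ℝ} (ht : t ∈ Icc 0 T) (hw : 0 < w₀ - M * T)
    {k : ℝ → ℝ → ℂ} (mk : Measurable (Function.uncurry k))
    (nk : intN (fun t => w₀ - M * t) M T s (fun t ξ => ‖k t ξ‖ₑ) ≠ ∞) :
    ExpDecay fun ξ => ∫ r in Icc 0 t, k r ξ := by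
  have hwt : 0 < w₀ - M * t := by
    have := mul_le_mul_of_nonneg_left ht.2 hM.le
    linarith
  have hmeas : Measurable fun ξ => ∫ r in Icc 0 t, k r ξ := by
    have := measurable_slice (measurable_duhamel_uncurry 0 (f₀ := 0) measurable_zero mk) t
    rwa [show duhamel 0 0 k t = fun ξ => ∫ r in Icc 0 t, k r ξ from
      funext fun ξ => by rw [duhamel_zero_eq, Pi.zero_apply, zero_add]] at this
  refine expDecay_of_nrm (s := s + 1 / 2) hwt hmeas (ne_top_of_le_ne_top
    (ENNReal.mul_ne_top ENNReal.ofReal_ne_top nk) (b := ENNReal.ofReal (1 / M) * _) ?_)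
  have h1 := supN_duhamel_le (T := T) (s := s + 1 / 2) (w₀ := w₀) hM (measurable_enorm_uncurry mk)
  rw [add_sub_cancel_right] at h1
  refine le_trans (nrm_mono le_rfl le_rfl (Eventually.of_forall fun ξ => ?_))
    ((nrm_le_supN (F := fun t ξ => ∫⁻ r in Icc 0 t, ‖k r ξ‖ₑ) ht).trans h1)
  exact enorm_integral_le_lintegral_enorm _

/-- If the syntheses of a family solve `∂ₜ y = K` classically, then the family is a primitive of the
Fourier transform of `K` at almost every frequency. -/
lemma ae_eq_integral_of_hasDerivWithinAt (hM : 0 < M) (hw : 0 < w₀ - M * T) {f k : ℝ → ℝ → ℂ}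
    (mk : Measurable (Function.uncurry k))
    (nk : intN (fun t => w₀ - M * t) M T s (fun t ξ => ‖k t ξ‖ₑ) ≠ ∞)
    (hf : ∀ t ∈ Icc 0 T, ExpDecay (f t))
    (h : ∀ t ∈ Icc 0 T, ∀ x, HasDerivWithinAt (fun s => synth (f s) x) (synth (k t) x) (Icc 0 T) t)
    {t : ℝ} (ht : t ∈ Icc 0 T) : f t =ᵐ[volume] fun ξ => f 0 ξ + ∫ r in Icc 0 t, k r ξ := by
  have hw1 : ∀ t ∈ Icc 0 T, w₀ - M * T ≤ w₀ - M * t := fun t ht => by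
    have := mul_le_mul_of_nonneg_left ht.2 hM.le
    linarith
  have h0 : (0 : ℝ) ∈ Icc 0 T := ⟨le_rfl, ht.1.trans ht.2⟩
  have hs : Icc 0 t ⊆ Icc 0 T := Icc_subset_Icc_right ht.2
  have ik := integrable_uncurry_of_lintegral mk (lintegral_lintegral_ne_top_of_intN (by fun_prop)
    hw hw1 hM (measurable_enorm_uncurry mk) nk)
  have ikt : Integrable (Function.uncurry k) ((volume.restrict (Icc 0 t)).prod volume) :=
    ik.mono_measure (Measure.prod_mono (Measure.restrict_mono hs le_rfl) le_rfl)
  have g := expDecay_integral hM ht hw mk nk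
  refine ae_eq_of_synth_eq (hf t ht).integrable (hf t ht).memLp ((hf 0 h0).add g).integrable
    ((hf 0 h0).add g).memLp ?_
  ext x
  rw [synth_add (hf 0 h0).integrable g.integrable, synth_integral ikt]
  have hi : IntegrableOn (fun r => synth (k r) x) (Icc 0 t) := by
    have : Integrable (Function.uncurry fun r ξ =>
        Complex.exp (Complex.I * ((x * ξ : ℝ) : ℂ)) * k r ξ)
        ((volume.restrict (Icc 0 t)).prod volume) := by
      refine Integrable.bdd_mul (c := 1) ikt (f := fun p : ℝ × ℝ =>
        Complex.exp (Complex.I * ((x * p.2 : ℝ) : ℂ)))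
        (Continuous.aestronglyMeasurable (by fun_prop)) (Eventually.of_forall fun r => ?_)
      rw [mul_comm, Complex.norm_exp_ofReal_mul_I]
    exact this.integral_prod_left.const_mul _
  have := intervalIntegral.integral_eq_sub_of_hasDerivAt_of_le ht.1
    (f := fun s => synth (f s) x) (f' := fun r => synth (k r) x)
    (fun r hr => ((h r (hs hr) x).continuousWithinAt).mono hs)
    (fun r hr => (h r (hs ⟨hr.1.le, hr.2.le⟩) x).hasDerivAt
      (Icc_mem_nhds hr.1 (hr.2.trans_le ht.2)))
    ((intervalIntegrable_iff_integrableOn_Icc_of_le ht.1).2 hi)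
  rw [integral_Icc_eq_integral_Ioc, ← intervalIntegral.integral_of_le ht.1, this]
  ring

/-- The transform of a classical solution of `∂ₜ y = (iε/2) ∂ₓ² y + F` satisfies Duhamel's
formula. -/
lemma ae_eq_duhamel_of_hasDerivWithinAt (hM : 0 < M) (hw : 0 < w₀ - M * T)
    {f F : ℝ → ℝ → ℂ} (mf : Measurable (Function.uncurry f)) (mF : Measurable (Function.uncurry F))
    (nf : intN (fun t => w₀ - M * t) M T s' (fun t ξ => ‖f t ξ‖ₑ) ≠ ∞)
    (nF : intN (fun t => w₀ - M * t) M T s (fun t ξ => ‖F t ξ‖ₑ) ≠ ∞)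
    (hf : ∀ t ∈ Icc 0 T, ExpDecay (f t)) (hF : ∀ t ∈ Icc 0 T, ExpDecay (F t)) {f₀ : ℝ → ℂ}
    (mf₀ : Measurable f₀) (hf₀ : f 0 =ᵐ[volume] f₀)
    (h : ∀ t ∈ Icc 0 T, ∀ x, HasDerivWithinAt (fun s => synth (f s) x)
      (synth (F t) x + Complex.I * ε / 2 * iteratedDeriv 2 (synth (f t)) x) (Icc 0 T) t)
    {t : ℝ} (ht : t ∈ Icc 0 T) : f t =ᵐ[volume] duhamel ε f₀ F t := by
  have hwm : Measurable fun t => w₀ - M * t := by fun_prop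
  have hw1 : ∀ t ∈ Icc 0 T, w₀ - M * T ≤ w₀ - M * t := fun t ht => by
    have := mul_le_mul_of_nonneg_left ht.2 hM.le
    linarith
  set k : ℝ → ℝ → ℂ := fun r ξ => F r ξ + Complex.I * ε / 2 * dHat (dHat (f r)) ξ with hk
  have mD := measurable_dHat_uncurry (measurable_dHat_uncurry mf)
  have mk : Measurable (Function.uncurry k) := mF.add (mD.const_mul _)
  set c : ℝ≥0∞ := ‖Complex.I * ε / 2‖ₑ with hc
  -- two derivatives are lost in `∂ₓ² y`; the exponential weight makes the regularity index irrelevant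
  have nk : intN (fun t => w₀ - M * t) M T (min s (s' - 2)) (fun t ξ => ‖k t ξ‖ₑ) ≠ ∞ := by
    have e1 : intN (fun t => w₀ - M * t) M T (min s (s' - 2)) (fun t ξ => ‖F t ξ‖ₑ) ≠ ∞ :=
      ne_top_of_le_ne_top nF (intN_mono (min_le_left _ _)
        fun t ht => Eventually.of_forall fun ξ => le_rfl)
    have e2 : intN (fun t => w₀ - M * t) M T (min s (s' - 2))
        (fun t ξ => ‖dHat (dHat (f t)) ξ‖ₑ) ≠ ∞ := by
      refine ne_top_of_le_ne_top nf (((intN_dHat_le _).trans (intN_dHat_le f)).trans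
        (intN_mono ?_ fun t ht => Eventually.of_forall fun ξ => le_rfl))
      have := min_le_right s (s' - 2)
      linarith
    refine ne_top_of_le_ne_top ?_ ((intN_mono le_rfl fun t ht => Eventually.of_forall fun ξ =>
      enorm_add_le (F t ξ) (Complex.I * ε / 2 * dHat (dHat (f t)) ξ)).trans
      (intN_add_le hwm (measurable_enorm_uncurry mF) (mD.const_mul _).enorm))
    simp_rw [enorm_mul, ← hc]
    rw [intN_const_mul enorm_ne_top]
    finiteness
  have hd : ∀ t ∈ Icc 0 T, ∀ x,
      HasDerivWithinAt (fun s => synth (f s) x) (synth (k t) x) (Icc 0 T) t := by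
    intro t ht x
    refine (h t ht x).congr_deriv ?_
    rw [(hf t ht).iteratedDeriv_two, hk, ← synth_const_mul, ← synth_add
      (hF t ht).integrable ((hf t ht).dHat.dHat.const_mul _).integrable]
  -- `f` equals the primitive `z` at almost every frequency for each time, hence, by Fubini's theorem,
  -- at almost every time for almost every frequency. So `z`, which is defined by the same formula at
  -- all times, solves the integral equation at almost every frequency.
  set z : ℝ → ℝ → ℂ := duhamel 0 f₀ k with hz
  have mz : Measurable (Function.uncurry z) := measurable_duhamel_uncurry 0 mf₀ mk
  have fz : ∀ t ∈ Icc 0 T, f t =ᵐ[volume] z t := by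
    intro t ht
    filter_upwards [ae_eq_integral_of_hasDerivWithinAt hM hw mk nk hf hd ht, hf₀] with ξ h1 h2
    rw [h1, h2, hz, duhamel_zero_eq]
  have fz' : ∀ᵐ ξ, ∀ᵐ r ∂volume.restrict (Icc 0 T), f r ξ = z r ξ := by
    rw [← Measure.ae_ae_comm (p := fun r ξ => f r ξ = z r ξ) (measurableSet_eq_fun mf mz)]
    exact (ae_restrict_iff' measurableSet_Icc).2 (Eventually.of_forall fz)
  have ik := integrable_uncurry_of_lintegral mk (lintegral_lintegral_ne_top_of_intN hwm
    hw hw1 hM (measurable_enorm_uncurry mk) nk)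
  have iF := integrable_uncurry_of_lintegral mF (lintegral_lintegral_ne_top_of_intN hwm
    hw hw1 hM (measurable_enorm_uncurry mF) nF)
  filter_upwards [fz t ht, fz', ik.prod_left_ae, iF.prod_left_ae] with ξ h1 h2 h3 h4
  rw [h1]
  have zc : ContinuousOn (fun r => z r ξ) (Icc 0 T) := by
    simp_rw [hz, duhamel_zero_eq]
    exact continuousOn_const.add (intervalIntegral.continuousOn_primitive_Icc h3)
  refine eq_duhamel_of_eq_integral h4 zc.integrableOn_Icc (fun t ht => ?_) ht
  rw [hz, duhamel_zero_eq, ← hz]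
  congr 1
  refine integral_congr_ae ?_
  have hs : Icc 0 t ⊆ Icc 0 T := Icc_subset_Icc_right ht.2
  filter_upwards [ae_mono (Measure.restrict_mono hs le_rfl) h2] with r hr
  rw [← hr, hk]
  simp only
  rw [dHat_dHat]
  push_cast
  ring

end

/-! ### Uniqueness -/

/-- Induction on a compact interval for a relatively closed property. -/
lemma forall_Icc_of_exists_gt {T : ℝ} {P : ℝ → Prop} (hcl : IsClosed {t | t ∈ Icc 0 T ∧ P t})
    (h0 : P 0) (hstep : ∀ t ∈ Ico 0 T, (∀ r ∈ Icc 0 t, P r) →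
      ∃ t' ∈ Ioc t T, ∀ r ∈ Icc 0 t', P r) : ∀ t ∈ Icc 0 T, P t := by
  set S : Set ℝ := {t | ∀ r ∈ Icc 0 t, P r} with hS
  have key : Icc 0 T ⊆ S := by
    refine IsClosed.Icc_subset_of_forall_exists_gt ?_ ?_ ?_
    · refine isClosed_of_closure_subset fun x hx => ?_
      have hxI : x ∈ Icc 0 T := isClosed_Icc.closure_subset_iff.2 inter_subset_right hx
      refine ⟨fun r hr => ?_, hxI⟩
      rcases hr.2.lt_or_eq with h | rfl
      · obtain ⟨y, hy1, hy2⟩ := mem_closure_iff.1 hx (Ioi r) isOpen_Ioi h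
        exact hy2.1 r ⟨hr.1, hy1.le⟩
      · exact ((hcl.closure_subset_iff (s := S ∩ Icc 0 T)).2
          (fun y hy => ⟨hy.2, hy.1 y ⟨hy.2.1, le_rfl⟩⟩) hx).2
    · intro r hr
      rwa [le_antisymm hr.2 hr.1]
    · rintro x ⟨hx, hxI⟩ y hy
      obtain ⟨t', ht', h⟩ := hstep x hxI hx
      exact ⟨min t' y, fun r hr => h r ⟨hr.1, hr.2.trans (min_le_left _ _)⟩,
        lt_min ht'.1 hy, min_le_right _ _⟩
  exact fun t ht => key ht t ⟨ht.1, le_rfl⟩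

section

variable {w : ℝ → ℝ} {M T s : ℝ} {F : ℝ → ℝ → ℝ≥0∞} {B : ℝ≥0∞}

/-- The norm `supN` on `[0,t]` is right continuous in `t`. -/
lemma exists_supN_le_add_one (hM : 0 < M)
    (hN : ContinuousOn (fun r => nrm (w r) s (F r)) (Icc 0 T))
    (hI : ∫⁻ r in Icc 0 T, nrm (w r) (s + 1 / 2) (F r) ^ 2 ≠ ∞) {t : ℝ} (ht : t ∈ Ico 0 T)
    (h : supN w M t s F ≤ B) (hB : B ≠ ∞) :
    ∃ δ > 0, ∀ t' ∈ Icc t T, t' < t + δ → supN w M t' s F ≤ B + 1 := by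
  have hB1 : B < B + 1 := ENNReal.lt_add_right hB one_ne_zero
  have htt : t ∈ Icc 0 t := ⟨ht.1, le_rfl⟩
  obtain ⟨δ₁, hδ₁, h1⟩ := Metric.mem_nhdsWithin_iff.1
    ((hN t ⟨ht.1, ht.2.le⟩).eventually (gt_mem_nhds (((nrm_le_supN htt).trans h).trans_lt hB1)))
  have hI' : ∫⁻ r in Icc 0 T, ENNReal.ofReal (2 * M) * nrm (w r) (s + 1 / 2) (F r) ^ 2 ≠ ∞ := by
    rw [lintegral_const_mul' _ _ ENNReal.ofReal_ne_top]
    exact ENNReal.mul_ne_top ENNReal.ofReal_ne_top hI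
  obtain ⟨δ₂, hδ₂, h2⟩ := exists_pos_setLIntegral_lt_of_measure_lt hI' one_ne_zero
  have hδ₂' : 0 < (min δ₂ 1).toReal := ENNReal.toReal_pos (lt_min hδ₂ one_pos).ne'
    (ne_top_of_le_ne_top ENNReal.one_ne_top (min_le_right _ _))
  refine ⟨min δ₁ (min δ₂ 1).toReal, lt_min hδ₁ hδ₂', fun t' ht' hlt => ?_⟩
  refine supN_le_iff.2 ⟨fun r hr => ?_, ?_⟩
  · rcases le_or_gt r t with hrt | hrt
    · exact ((nrm_le_supN ⟨hr.1, hrt⟩).trans h).trans hB1.le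
    · have hmem : r ∈ Metric.ball t δ₁ ∩ Icc 0 T := by
        refine ⟨?_, hr.1, hr.2.trans ht'.2⟩
        rw [Metric.mem_ball, Real.dist_eq, abs_of_pos (sub_pos.2 hrt)]
        have := hr.2
        have := min_le_left δ₁ (min δ₂ 1).toReal
        linarith
      exact (h1 hmem).le
  · have e : ∀ τ, ∫⁻ r in Icc 0 τ, ENNReal.ofReal (2 * M) * nrm (w r) (s + 1 / 2) (F r) ^ 2 =
        intN w M τ (s + 1 / 2) F ^ 2 := fun τ => by
      rw [lintegral_const_mul' _ _ ENNReal.ofReal_ne_top, ofReal_mul_lintegral_nrm_sq hM]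
    refine (ENNReal.pow_le_pow_left_iff two_ne_zero).1 ?_
    rw [← e, ← Icc_union_Ioc_eq_Icc ht.1 ht'.1]
    refine (lintegral_union_le _ _ _).trans ?_
    have h3 : ∫⁻ r in Ioc t t', ENNReal.ofReal (2 * M) * nrm (w r) (s + 1 / 2) (F r) ^ 2 ≤ 1 := by
      have hsub : Ioc t t' ⊆ Icc 0 T := fun r hr => ⟨ht.1.trans hr.1.le, hr.2.trans ht'.2⟩
      have := h2 (Ioc t t') ?_
      · rw [Measure.restrict_restrict measurableSet_Ioc, inter_eq_left.2 hsub] at this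
        exact this.le
      · refine (Measure.restrict_apply_le _ _).trans_lt ?_
        rw [Real.volume_Ioc]
        refine lt_of_lt_of_le ?_ (min_le_left δ₂ 1)
        refine (ENNReal.ofReal_lt_iff_lt_toReal (sub_nonneg.2 ht'.1)
          (ne_top_of_le_ne_top ENNReal.one_ne_top (min_le_right _ _))).2 ?_
        have := min_le_right δ₁ (min δ₂ 1).toReal
        linarith
    rw [e]
    have h4 : intN w M t (s + 1 / 2) F ≤ B := intN_le_supN.trans h
    calc _ ≤ B ^ 2 + 1 := add_le_add (pow_le_pow_left' h4 2) h3
      _ ≤ B ^ 2 + 1 + 2 * B := le_self_add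
      _ = (B + 1) ^ 2 := by ring

end

section

variable {α μ ε w₀ M T ℓ : ℝ} {n m : ℕ} {u₀ v₀ : ℝ → ℂ} {K : ℝ≥0∞} {u v u' v' : ℝ → ℝ → ℂ}

/-- Two mild solutions in the ball of radius `K` agree, by the contraction estimate. -/
lemma ae_eq_of_mild (hM : 0 < M) (hT : 0 ≤ T) (hw0 : ∀ t ∈ Icc 0 T, 0 ≤ w₀ - M * t) (hℓ : 1 < ℓ)
    (hK : K ≠ ∞) (hK1 : 1 ≤ K) (hsmall : ENNReal.ofReal (1 / M) * nonlinLip α μ n m ℓ K ≤ 1 / 2)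
    (mu : Measurable (Function.uncurry u)) (mv : Measurable (Function.uncurry v))
    (mu' : Measurable (Function.uncurry u')) (mv' : Measurable (Function.uncurry v'))
    (nu : supN (fun t => w₀ - M * t) M T (ℓ + 1) (fun t ξ => ‖u t ξ‖ₑ) ≤ K)
    (nv : supN (fun t => w₀ - M * t) M T ℓ (fun t ξ => ‖v t ξ‖ₑ) ≤ K)
    (nu' : supN (fun t => w₀ - M * t) M T (ℓ + 1) (fun t ξ => ‖u' t ξ‖ₑ) ≤ K)
    (nv' : supN (fun t => w₀ - M * t) M T ℓ (fun t ξ => ‖v' t ξ‖ₑ) ≤ K)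
    (eu : ∀ t ∈ Icc 0 T, u t =ᵐ[volume] duhamel 0 u₀ (fun r => phaseRHS α μ n m (u r) (v r)) t)
    (ev : ∀ t ∈ Icc 0 T, v t =ᵐ[volume] duhamel ε v₀ (fun r => ampRHS α n (u r) (v r)) t)
    (eu' : ∀ t ∈ Icc 0 T,
      u' t =ᵐ[volume] duhamel 0 u₀ (fun r => phaseRHS α μ n m (u' r) (v' r)) t)
    (ev' : ∀ t ∈ Icc 0 T, v' t =ᵐ[volume] duhamel ε v₀ (fun r => ampRHS α n (u' r) (v' r)) t)
    {t : ℝ} (ht : t ∈ Icc 0 T) : u t =ᵐ[volume] u' t ∧ v t =ᵐ[volume] v' t := by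
  have hwm : Measurable fun t => w₀ - M * t := by fun_prop
  set δ := max (supN (fun t => w₀ - M * t) M T (ℓ + 1) (fun t ξ => ‖u t ξ - u' t ξ‖ₑ))
    (supN (fun t => w₀ - M * t) M T ℓ (fun t ξ => ‖v t ξ - v' t ξ‖ₑ)) with hδ
  have fin : ∀ {s : ℝ} {f g : ℝ → ℝ → ℂ}, Measurable (Function.uncurry f) →
      Measurable (Function.uncurry g) →
      supN (fun t => w₀ - M * t) M T s (fun t ξ => ‖f t ξ‖ₑ) ≤ K →
      supN (fun t => w₀ - M * t) M T s (fun t ξ => ‖g t ξ‖ₑ) ≤ K →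
      supN (fun t => w₀ - M * t) M T s (fun t ξ => ‖f t ξ - g t ξ‖ₑ) ≠ ∞ := by
    intro s f g mf mg hf hg
    refine ne_top_of_le_ne_top (ENNReal.add_ne_top.2 ⟨hK, hK⟩) (le_trans (supN_mono le_rfl
      fun t _ => Eventually.of_forall fun ξ => enorm_sub_le) ((supN_add_le hwm
      (measurable_enorm_uncurry mf) (measurable_enorm_uncurry mg)).trans (add_le_add hf hg)))
  have hδ1 : δ ≠ ∞ := (max_lt (lt_top_iff_ne_top.2 (fin mu mu' nu nu'))
    (lt_top_iff_ne_top.2 (fin mv mv' nv nv'))).ne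
  have cu := Ctl.of_le hK1 mu mu' nu nu' (le_max_left _ _ : _ ≤ δ)
  have cv := Ctl.of_le hK1 mv mv' nv nv' (le_max_right _ _ : _ ≤ δ)
  have iP : ∀ {u v : ℝ → ℝ → ℂ}, Measurable (Function.uncurry u) →
      Measurable (Function.uncurry v) →
      supN (fun t => w₀ - M * t) M T (ℓ + 1) (fun t ξ => ‖u t ξ‖ₑ) ≤ K →
      supN (fun t => w₀ - M * t) M T ℓ (fun t ξ => ‖v t ξ‖ₑ) ≤ K →
      (∀ᵐ ξ, IntegrableOn (fun r => phaseRHS α μ n m (u r) (v r) ξ) (Icc 0 T)) ∧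
      (∀ᵐ ξ, IntegrableOn (fun r => ampRHS α n (u r) (v r) ξ) (Icc 0 T)) := by
    intro u v mu mv nu nv
    exact ⟨ae_integrableOn_of_intN hM hT (measurable_phaseRHS_uncurry α μ n m mu mv)
      (ne_top_of_le_ne_top (phaseLip_ne_top α μ n m hℓ hK)
        (intN_phaseRHS_ball α μ n m hwm hw0 hℓ hK mu mv nu nv)),
      ae_integrableOn_of_intN hM hT (measurable_ampRHS_uncurry α n mu mv)
      (ne_top_of_le_ne_top (ampLip_ne_top α n hℓ hK)
        (intN_ampRHS_ball α n hwm hw0 hℓ hK mu mv nu nv))⟩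
  obtain ⟨p1, a1⟩ := iP mu mv nu nv
  obtain ⟨p2, a2⟩ := iP mu' mv' nu' nv'
  obtain ⟨hU, hV⟩ := contraction α μ n m hM hw0 hℓ hK cu cv
    (U := fun t ξ => ‖u t ξ - u' t ξ‖ₑ) (V := fun t ξ => ‖v t ξ - v' t ξ‖ₑ)
    (fun t ht => by
      filter_upwards [eu t ht, eu' t ht, p1, p2] with ξ h1 h2 h3 h4
      rw [h1, h2]
      exact enorm_duhamel_sub_le 0 u₀ ht h3 h4)
    (fun t ht => by
      filter_upwards [ev t ht, ev' t ht, a1, a2] with ξ h1 h2 h3 h4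
      rw [h1, h2]
      exact enorm_duhamel_sub_le ε v₀ ht h3 h4)
  have hδ0 : δ = 0 := by
    have h1 : δ ≤ 1 / 2 * δ := (max_le hU hV).trans (by gcongr)
    by_contra h0
    refine absurd h1 (not_le.2 ?_)
    rw [one_div, mul_comm, ← div_eq_mul_inv]
    exact ENNReal.half_lt_self h0 hδ1
  exact ⟨ae_eq_of_supN_eq_zero mu mu' (le_antisymm ((le_max_left _ _).trans hδ0.le) zero_le) ht,
    ae_eq_of_supN_eq_zero mv mv' (le_antisymm ((le_max_right _ _).trans hδ0.le) zero_le) ht⟩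

end

/-- The transform of an element of the solution space: a jointly measurable representative with
finite norm. -/
lemma MemY.exists_transform {w : ℝ → ℝ} {M T s κ : ℝ} {ψ : ℝ → ℝ → ℂ} (h : MemY w T s ψ)
    (hs : 1 / 2 < s) (hT : 0 ≤ T) (hw : Measurable w) (hκ : 0 < κ) (hwκ : ∀ t ∈ Icc 0 T, κ ≤ w t)
    (hc : ∀ t ∈ Icc 0 T, Continuous (ψ t)) :
    ∃ f : ℝ → ℝ → ℂ, Measurable (Function.uncurry f) ∧ (∀ t ∈ Icc 0 T, f t =ᵐ[volume] hat (ψ t)) ∧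
      (∀ t ∈ Icc 0 T, ExpDecay (f t)) ∧ (∀ t ∈ Icc 0 T, ψ t = synth (f t)) ∧
      supN w M T s (fun t ξ => ‖f t ξ‖ₑ) ≠ ∞ ∧
      ContinuousOn (fun t => nrm (w t) s (fun ξ => ‖f t ξ‖ₑ)) (Icc 0 T) ∧
      ∫⁻ t in Icc 0 T, nrm (w t) (s + 1 / 2) (fun ξ => ‖f t ξ‖ₑ) ^ 2 ≠ ∞ := by
  obtain ⟨f, mf, hf⟩ := h.1.exists_measurable_hat hs hT hw
  have en : ∀ t ∈ Icc 0 T, ∀ r, nrm (w t) r (fun ξ => ‖f t ξ‖ₑ) =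
      nrm (w t) r (fun ξ => ‖hat (ψ t) ξ‖ₑ) := fun t ht r => by
    refine nrm_congr ?_
    filter_upwards [hf t ht] with ξ hξ
    rw [hξ]
  have hE : ∀ t ∈ Icc 0 T, ExpDecay (hat (ψ t)) := fun t ht =>
    expDecay_of_nrm (hκ.trans_le (hwκ t ht)) (measurable_hat _) (h.1.nrm_ne_top ht)
  have hI : ∫⁻ t in Icc 0 T, nrm (w t) (s + 1 / 2) (fun ξ => ‖f t ξ‖ₑ) ^ 2 ≠ ∞ := by
    have := h.2.ne
    rw [setLIntegral_congr_fun measurableSet_Icc (fun t ht => normSq_eq (w t) (s + 1 / 2) (ψ t))]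
      at this
    rwa [setLIntegral_congr_fun measurableSet_Icc (fun t ht => by rw [en t ht])]
  refine ⟨f, mf, hf, fun t ht => (hE t ht).of_norm_le (measurable_slice mf t) ?_, fun t ht => ?_,
    ?_, h.1.continuousOn_nrm.congr fun t ht => en t ht s, hI⟩
  · filter_upwards [hf t ht] with ξ hξ
    rw [hξ]
  · rw [synth_congr (hf t ht)]
    exact eq_synth_hat (h.1.1 t ht).1 (hc t ht) (hE t ht).integrable (hE t ht).memLp
  · obtain ⟨C, hC, hle⟩ := h.1.exists_bound hT
    have hIN : intN w M T (s + 1 / 2) (fun t ξ => ‖f t ξ‖ₑ) ≠ ∞ := by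
      rw [intN, ltwo_const_mul ENNReal.ofReal_ne_top]
      refine ENNReal.mul_ne_top ENNReal.ofReal_ne_top fun h' => hI ?_
      rw [← ltwo_sq, h']
      rfl
    refine (max_lt (lt_of_le_of_lt (iSup₂_le fun t ht => ?_) (lt_top_iff_ne_top.2 hC))
      (lt_top_iff_ne_top.2 hIN)).ne
    rw [en t ht]
    exact hle t ht

/-- Uniqueness: a classical solution in the solution space agrees with a mild solution whose data
are the transforms of its initial data. As long as it agrees, its norm is at most `K`, hence at most
`K + 1` for a little longer, and there the contraction estimate applies. -/
theorem IsMild.unique {α μ ε w₀ M T ℓ : ℝ} {n m : ℕ} {u₀ v₀ : ℝ → ℂ} {K : ℝ≥0∞} {u v : ℝ → ℝ → ℂ}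
    (h : IsMild α μ n m ε u₀ v₀ (fun t => w₀ - M * t) M T ℓ K u v) (hM : 0 < M)
    (hT : 0 ≤ T) (hw : 0 < w₀ - M * T) (hℓ : 1 < ℓ) (hK : K ≠ ∞) {φ₀ : ℝ → ℝ} {a₀ : ℝ → ℂ}
    (hu₀ : u₀ = hat (toC φ₀)) (nu₀ : nrm w₀ (ℓ + 1) (fun ξ => ‖u₀ ξ‖ₑ) ≠ ∞)
    (hv₀ : v₀ = hat a₀) (nv₀ : nrm w₀ ℓ (fun ξ => ‖v₀ ξ‖ₑ) ≠ ∞)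
    (hsmall : ENNReal.ofReal (1 / M) * nonlinLip α μ n m ℓ (K + 1) ≤ 1 / 2)
    {φ : ℝ → ℝ → ℝ} {a : ℝ → ℝ → ℂ} (hX : MemX (fun t => w₀ - M * t) T ℓ φ a)
    (hS : IsSolution (fun s => μ * s ^ (m + 1)) (fun s => α * s ^ (n + 1)) ε T φ₀ a₀ φ a)
    {t : ℝ} (ht : t ∈ Icc 0 T) : toC (φ t) = synth (u t) ∧ a t = synth (v t) := by
  have hwm : Measurable fun t => w₀ - M * t := by fun_prop
  have hw1 : ∀ t ∈ Icc 0 T, w₀ - M * T ≤ w₀ - M * t := fun t ht => by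
    have := mul_le_mul_of_nonneg_left ht.2 hM.le
    linarith
  have hw0 : ∀ t ∈ Icc 0 T, 0 ≤ w₀ - M * t := fun t ht => hw.le.trans (hw1 t ht)
  have h0 : (0 : ℝ) ∈ Icc 0 T := ⟨le_rfl, hT⟩
  have mu₀ : Measurable u₀ := hu₀ ▸ measurable_hat _
  have mv₀ : Measurable v₀ := hv₀ ▸ measurable_hat _
  obtain ⟨U, mU, aU, EU, sU, nU, cU, IU⟩ := hX.1.exists_transform (M := M) (by linarith) hT hwm hw
    hw1 fun t ht => Complex.continuous_ofReal.comp (hS.smooth_phase t ht).continuous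
  obtain ⟨V, mV, aV, EV, sV, nV, cV, IV⟩ := hX.2.exists_transform (M := M) (by linarith) hT hwm hw
    hw1 fun t ht => (hS.smooth_amplitude t ht).continuous
  set L := max (supN (fun t => w₀ - M * t) M T (ℓ + 1) (fun t ξ => ‖U t ξ‖ₑ))
    (supN (fun t => w₀ - M * t) M T ℓ (fun t ξ => ‖V t ξ‖ₑ)) with hL
  have hL1 : L ≠ ∞ := (max_lt (lt_top_iff_ne_top.2 nU) (lt_top_iff_ne_top.2 nV)).ne
  have mP := measurable_phaseRHS_uncurry α μ n m mU mV
  have mA := measurable_ampRHS_uncurry α n mU mV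
  have rhs := fun t ht x => synth_rhs_eq α μ n m (hS.smooth_phase t ht) (EU t ht) (EV t ht)
    (sU t ht) (sV t ht) x
  have e₀ : U 0 =ᵐ[volume] u₀ := by
    rw [hu₀, ← hat_congr (ψ := toC (φ 0))]
    · exact aU 0 h0
    · filter_upwards [hS.init_phase] with x hx
      simp only [toC, hx]
  have e₁ : V 0 =ᵐ[volume] v₀ := by
    rw [hv₀, ← hat_congr hS.init_amplitude]
    exact aV 0 h0
  -- the classical solution satisfies Duhamel's formula
  have dU : ∀ t ∈ Icc 0 T, U t =ᵐ[volume]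
      duhamel 0 u₀ (fun r => phaseRHS α μ n m (U r) (V r)) t := by
    intro t ht
    refine ae_eq_duhamel_of_hasDerivWithinAt hM hw mU mP
      (ne_top_of_le_ne_top nU intN_le_supN) (ne_top_of_le_ne_top (phaseLip_ne_top α μ n m hℓ hL1)
        (intN_phaseRHS_ball α μ n m hwm hw0 hℓ hL1 mU mV (le_max_left _ _) (le_max_right _ _)))
      EU (fun t ht => (EU t ht).phaseRHS (EV t ht) α μ n m) mu₀ e₀ (fun t ht x => ?_) ht
    refine (((hS.eq_phase t ht x).ofReal_comp).congr (fun r hr => ?_) ?_).congr_deriv ?_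
    · rw [← sU r hr]; rfl
    · rw [← sU t ht]; rfl
    · rw [(rhs t ht x).1]
      simp
  have dV : ∀ t ∈ Icc 0 T, V t =ᵐ[volume]
      duhamel ε v₀ (fun r => ampRHS α n (U r) (V r)) t := by
    intro t ht
    refine ae_eq_duhamel_of_hasDerivWithinAt hM hw mV mA
      (ne_top_of_le_ne_top nV intN_le_supN) (ne_top_of_le_ne_top (ampLip_ne_top α n hℓ hL1)
        (intN_ampRHS_ball α n hwm hw0 hℓ hL1 mU mV (le_max_left _ _) (le_max_right _ _)))
      EV (fun t ht => (EU t ht).ampRHS (EV t ht) α n) mv₀ e₁ (fun t ht x => ?_) ht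
    refine ((hS.eq_amplitude t ht x).congr (fun r hr => ?_) ?_).congr_deriv ?_
    · rw [← sV r hr]
    · rw [← sV t ht]
    · rw [(rhs t ht x).2, ← sV t ht]
      ring
  have Wu := h.wtFam_phase hM hT hw hℓ hK mu₀ nu₀
  have Wv := h.wtFam_amp hM hT hw hℓ hK mv₀ nv₀
  have Du := Wu.decayFam hw hw1
  have Dv := Wv.decayFam hw hw1
  -- agreement of the syntheses at time `t` is agreement of the transforms
  have iff_ae : ∀ t ∈ Icc 0 T, (toC (φ t) = synth (u t) ∧ a t = synth (v t)) ↔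
      (U t =ᵐ[volume] u t ∧ V t =ᵐ[volume] v t) := by
    intro t ht
    rw [sU t ht, sV t ht]
    constructor
    · rintro ⟨h1, h2⟩
      exact ⟨ae_eq_of_synth_eq (EU t ht).integrable (EU t ht).memLp (Du.expDecay ht).integrable
        (Du.expDecay ht).memLp h1, ae_eq_of_synth_eq (EV t ht).integrable (EV t ht).memLp
        (Dv.expDecay ht).integrable (Dv.expDecay ht).memLp h2⟩
    · rintro ⟨h1, h2⟩
      exact ⟨synth_congr h1, synth_congr h2⟩
  refine forall_Icc_of_exists_gt (P := fun t => toC (φ t) = synth (u t) ∧ a t = synth (v t))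
    ?_ ?_ ?_ t ht
  · have hset : {t | t ∈ Icc 0 T ∧ toC (φ t) = synth (u t) ∧ a t = synth (v t)} =
        ⋂ x : ℝ, ({t ∈ Icc 0 T | toC (φ t) x = synth (u t) x} ∩
          {t ∈ Icc 0 T | a t x = synth (v t) x}) := by
      ext t
      simp only [mem_ofPred_eq, mem_iInter, mem_inter_iff, funext_iff]
      exact ⟨fun h x => ⟨⟨h.1, h.2.1 x⟩, h.1, h.2.2 x⟩,
        fun h => ⟨(h 0).1.1, fun x => (h x).1.2, fun x => (h x).2.2⟩⟩
    rw [hset]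
    refine isClosed_iInter fun x => (isClosed_Icc.isClosed_eq ?_ (Du.continuousOn_synth x)).inter
      (isClosed_Icc.isClosed_eq ?_ (Dv.continuousOn_synth x))
    · exact fun t ht => ((hS.eq_phase t ht x).ofReal_comp).continuousWithinAt
    · exact fun t ht => (hS.eq_amplitude t ht x).continuousWithinAt
  · refine (iff_ae 0 h0).2 ⟨?_, ?_⟩
    · rw [show u 0 = u₀ from funext fun ξ => by rw [h.eq_phase 0 h0, duhamel_zero]]
      exact e₀
    · rw [show v 0 = v₀ from funext fun ξ => by rw [h.eq_amp 0 h0, duhamel_zero]]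
      exact e₁
  -- agreement up to time `t < T` persists up to some later time `t'`
  · intro t ht hP
    have hP' : ∀ r ∈ Icc 0 t, U r =ᵐ[volume] u r ∧ V r =ᵐ[volume] v r := fun r hr =>
      (iff_ae r ⟨hr.1, hr.2.trans ht.2.le⟩).1 (hP r hr)
    have bU : supN (fun t => w₀ - M * t) M t (ℓ + 1) (fun t ξ => ‖U t ξ‖ₑ) ≤ K :=
      (supN_mono le_rfl fun r hr => by
        filter_upwards [(hP' r hr).1] with ξ hξ
        rw [hξ]).trans ((supN_mono_time ht.2.le).trans h.phase_le)
    have bV : supN (fun t => w₀ - M * t) M t ℓ (fun t ξ => ‖V t ξ‖ₑ) ≤ K :=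
      (supN_mono le_rfl fun r hr => by
        filter_upwards [(hP' r hr).2] with ξ hξ
        rw [hξ]).trans ((supN_mono_time ht.2.le).trans h.amp_le)
    obtain ⟨δ₁, hδ₁, h1⟩ := exists_supN_le_add_one hM cU IU ht bU hK
    obtain ⟨δ₂, hδ₂, h2⟩ := exists_supN_le_add_one hM cV IV ht bV hK
    set t' := min T (t + min δ₁ δ₂ / 2) with ht'
    have hδ : 0 < min δ₁ δ₂ := lt_min hδ₁ hδ₂
    have l1 : t < t' := lt_min ht.2 (by linarith)
    have l2 : t' ≤ T := min_le_left _ _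
    have l3 : t' < t + min δ₁ δ₂ := (min_le_right _ _).trans_lt (by linarith)
    have hsub : Icc 0 t' ⊆ Icc 0 T := Icc_subset_Icc_right l2
    refine ⟨t', ⟨l1, l2⟩, fun r hr => (iff_ae r (hsub hr)).2 ?_⟩
    exact ae_eq_of_mild (u₀ := u₀) (v₀ := v₀) (ε := ε) hM (ht.1.trans l1.le)
      (fun r hr => hw0 r (hsub hr)) hℓ
      (ENNReal.add_ne_top.2 ⟨hK, ENNReal.one_ne_top⟩) le_add_self hsmall mU mV h.meas_phase
      h.meas_amp (h1 t' ⟨l1.le, l2⟩ (l3.trans_le (by gcongr; exact min_le_left _ _)))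
      (h2 t' ⟨l1.le, l2⟩ (l3.trans_le (by gcongr; exact min_le_right _ _)))
      (((supN_mono_time l2).trans h.phase_le).trans le_self_add)
      (((supN_mono_time l2).trans h.amp_le).trans le_self_add)
      (fun r hr => dU r (hsub hr)) (fun r hr => dV r (hsub hr))
      (fun r hr => Eventually.of_forall (h.eq_phase r (hsub hr)))
      (fun r hr => Eventually.of_forall (h.eq_amp r (hsub hr))) hr

/-! ### Bounds for the solution -/

section

lemma seven_mul_le {A b : ℝ≥0∞} (hA : A ≠ ∞) (h : 8 * A ≤ 8 * b + A) : 7 * A ≤ 8 * b := by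
  rw [show 8 * A = 7 * A + A by ring] at h
  exact (ENNReal.add_le_add_iff_right hA).1 h

lemma sq_le_two_mul_sq {A b : ℝ≥0∞} (hA : A ≠ ∞) (hb : b ≠ ∞) (h : 7 * A ≤ 8 * b) :
    A ^ 2 ≤ 2 * b ^ 2 := by
  lift A to ℝ≥0 using hA
  lift b to ℝ≥0 using hb
  norm_cast at h ⊢
  rw [← NNReal.coe_le_coe] at h ⊢
  push_cast at h ⊢
  nlinarith [A.coe_nonneg, b.coe_nonneg, mul_self_le_mul_self (by positivity) h]

lemma sq_le_four_mul_sq_add_sq {A b c : ℝ≥0∞} (hA : A ≠ ∞) (hb : b ≠ ∞) (hc : c ≠ ∞)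
    (h : 7 * A ≤ 8 * b + c) : A ^ 2 ≤ 4 * b ^ 2 + c ^ 2 := by
  lift A to ℝ≥0 using hA
  lift b to ℝ≥0 using hb
  lift c to ℝ≥0 using hc
  norm_cast at h ⊢
  rw [← NNReal.coe_le_coe] at h ⊢
  push_cast at h ⊢
  nlinarith [A.coe_nonneg, b.coe_nonneg, c.coe_nonneg, mul_self_le_mul_self (by positivity) h,
    sq_nonneg (8 * (b : ℝ) - c)]

variable {α μ ε w₀ M T ℓ : ℝ} {n m : ℕ} {u₀ v₀ : ℝ → ℂ} {K : ℝ≥0∞} {u v : ℝ → ℝ → ℂ}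

/-- The bounds for the solution, by absorbing the terms with the small factor `1 / M`. The source
`μ |a|^{2σ}` is the only term of the phase equation that does not vanish for `u = 0`. -/
lemma IsMild.supN_sq_le (h : IsMild α μ n m ε u₀ v₀ (fun t => w₀ - M * t) M T ℓ K u v) (hM : 0 < M)
    (hw0 : ∀ t ∈ Icc 0 T, 0 ≤ w₀ - M * t) (hℓ : 1 < ℓ) (hK : K ≠ ∞) (hK1 : 1 ≤ K)
    (mu₀ : Measurable u₀) (mv₀ : Measurable v₀)
    (nu₀ : nrm w₀ (ℓ + 1) (fun ξ => ‖u₀ ξ‖ₑ) ≠ ∞) (nv₀ : nrm w₀ ℓ (fun ξ => ‖v₀ ξ‖ₑ) ≠ ∞)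
    (hs1 : 8 * (ENNReal.ofReal (1 / M) * nonlinLip α μ n m ℓ K) ≤ 1)
    (hs2 : 8 * (ENNReal.ofReal (1 / M) *
      (‖(μ : ℂ)‖ₑ * algConst ℓ ^ (2 * m + 1) * 2 ^ (m + 1))) ≤ 1) :
    supN (fun t => w₀ - M * t) M T (ℓ + 1) (fun t ξ => ‖u t ξ‖ₑ) ^ 2 ≤
        4 * nrm w₀ (ℓ + 1) (fun ξ => ‖u₀ ξ‖ₑ) ^ 2 +
          (nrm w₀ ℓ (fun ξ => ‖v₀ ξ‖ₑ) ^ 2) ^ (2 * (m + 1)) ∧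
      supN (fun t => w₀ - M * t) M T ℓ (fun t ξ => ‖v t ξ‖ₑ) ^ 2 ≤
        2 * nrm w₀ ℓ (fun ξ => ‖v₀ ξ‖ₑ) ^ 2 := by
  have hwm : Measurable fun t => w₀ - M * t := by fun_prop
  set P := supN (fun t => w₀ - M * t) M T (ℓ + 1) (fun t ξ => ‖u t ξ‖ₑ) with hP
  set A := supN (fun t => w₀ - M * t) M T ℓ (fun t ξ => ‖v t ξ‖ₑ) with hA
  set p := nrm w₀ (ℓ + 1) (fun ξ => ‖u₀ ξ‖ₑ) with hp
  set a := nrm w₀ ℓ (fun ξ => ‖v₀ ξ‖ₑ) with ha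
  set c := ENNReal.ofReal (1 / M) with hc
  have hP1 : P ≠ ∞ := ne_top_of_le_ne_top hK h.phase_le
  have hA1 : A ≠ ∞ := ne_top_of_le_ne_top hK h.amp_le
  have iA : A ≤ a + c * (ampLip α n ℓ K * A) := by
    refine (supN_mono le_rfl fun t ht => Eventually.of_forall fun ξ => ?_).trans
      ((supN_duhamel_add_le (T := T) (s := ℓ) ε hM mv₀ (measurable_ampRHS_uncurry α n h.meas_phase
        h.meas_amp)).trans ?_)
    · rw [h.eq_amp t ht ξ]
    · gcongr
      exact intN_ampRHS_le α n hwm hw0 hℓ hK hK1 h.meas_phase h.meas_amp h.phase_le h.amp_le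
  have iP : P ≤ p + c * (phaseLip α μ n m ℓ K * P +
      ‖(μ : ℂ)‖ₑ * (algConst ℓ ^ (2 * m + 1) * A ^ (2 * (m + 1)))) := by
    refine (supN_mono le_rfl fun t ht => Eventually.of_forall fun ξ => ?_).trans
      ((supN_duhamel_add_le (T := T) (s := ℓ + 1) 0 hM mu₀ (measurable_phaseRHS_uncurry α μ n m
        h.meas_phase h.meas_amp)).trans ?_)
    · rw [h.eq_phase t ht ξ]
    · gcongr
      exact intN_phaseRHS_le α μ n m hwm hw0 hℓ hK hK1 h.meas_phase h.meas_amp h.phase_le h.amp_le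
  have absorb : ∀ {y X : ℝ≥0∞}, y ≤ nonlinLip α μ n m ℓ K → 8 * (c * (y * X)) ≤ X := by
    intro y X hy
    calc 8 * (c * (y * X)) = 8 * (c * y) * X := by ring
      _ ≤ 8 * (c * nonlinLip α μ n m ℓ K) * X := by gcongr
      _ ≤ 1 * X := by gcongr
      _ = X := one_mul X
  have hAa : A ^ 2 ≤ 2 * a ^ 2 := by
    refine sq_le_two_mul_sq hA1 nv₀ (seven_mul_le hA1 ?_)
    calc 8 * A ≤ 8 * (a + c * (ampLip α n ℓ K * A)) := by gcongr
      _ = 8 * a + 8 * (c * (ampLip α n ℓ K * A)) := by ring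
      _ ≤ _ := by
        gcongr
        exact absorb le_add_self
  refine ⟨?_, hAa⟩
  have hsrc : 8 * (c * (‖(μ : ℂ)‖ₑ * (algConst ℓ ^ (2 * m + 1) * A ^ (2 * (m + 1))))) ≤
      (a ^ 2) ^ (m + 1) := by
    calc _ ≤ 8 * (c * (‖(μ : ℂ)‖ₑ * (algConst ℓ ^ (2 * m + 1) * (2 * a ^ 2) ^ (m + 1)))) := by
          rw [pow_mul]
          gcongr
      _ = 8 * (c * (‖(μ : ℂ)‖ₑ * algConst ℓ ^ (2 * m + 1) * 2 ^ (m + 1))) * (a ^ 2) ^ (m + 1) := by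
          rw [mul_pow]; ring
      _ ≤ 1 * (a ^ 2) ^ (m + 1) := by gcongr
      _ = _ := one_mul _
  have h7 : 7 * P ≤ 8 * p + (a ^ 2) ^ (m + 1) := by
    have : 8 * P ≤ 8 * p + (a ^ 2) ^ (m + 1) + P := by
      calc 8 * P ≤ 8 * (p + c * (phaseLip α μ n m ℓ K * P +
            ‖(μ : ℂ)‖ₑ * (algConst ℓ ^ (2 * m + 1) * A ^ (2 * (m + 1))))) := by gcongr
        _ = 8 * p + 8 * (c * (‖(μ : ℂ)‖ₑ * (algConst ℓ ^ (2 * m + 1) * A ^ (2 * (m + 1))))) +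
            8 * (c * (phaseLip α μ n m ℓ K * P)) := by ring
        _ ≤ _ := by
          gcongr
          exact absorb le_self_add
    rw [show 8 * P = 7 * P + P by ring] at this
    exact (ENNReal.add_le_add_iff_right hP1).1 this
  rw [mul_comm 2 (m + 1), pow_mul]
  exact sq_le_four_mul_sq_add_sq hP1 nu₀ (by finiteness) h7

lemma synth_hat_ae_eq {w s : ℝ} {ψ : ℝ → ℂ} (hw : 0 < w) (h : MemH w s ψ) :
    synth (hat ψ) =ᵐ[volume] ψ := by
  have hn : nrm w s (fun ξ => ‖hat ψ ξ‖ₑ) ≠ ∞ := fun h' => by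
    have := h.2
    rw [normSq_eq, h'] at this
    simp at this
  have hE := expDecay_of_nrm hw (measurable_hat ψ) hn
  obtain ⟨h1, h2⟩ := memLp_synth_and_hat hE.integrable hE.memLp
  exact ae_eq_of_hat h1 h.1 h2

/-- The transform of a real valued function is invariant under `f ↦ conj f(-ξ)`. -/
lemma conjHat_hat_toC {w s : ℝ} {φ : ℝ → ℝ} (hw : 0 < w) (h : MemH w s (toC φ)) :
    conjHat (hat (toC φ)) =ᵐ[volume] hat (toC φ) := by
  have hn : nrm w s (fun ξ => ‖hat (toC φ) ξ‖ₑ) ≠ ∞ := fun h' => by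
    have := h.2
    rw [normSq_eq, h'] at this
    simp at this
  have hE := expDecay_of_nrm hw (measurable_hat (toC φ)) hn
  refine ae_eq_of_synth_eq hE.conjHat.integrable hE.conjHat.memLp hE.integrable hE.memLp ?_
  refine (continuous_synth hE.conjHat.integrable).ae_eq_iff_eq volume
    (continuous_synth hE.integrable) |>.1 ?_
  filter_upwards [synth_hat_ae_eq hw h] with x hx
  rw [synth_conjHat, hx]
  exact Complex.conj_ofReal _

lemma exists_forall_ofReal_inv_mul_le {X : ℝ≥0∞} (hX : X ≠ ∞) :
    ∃ M₀ : ℝ, 0 < M₀ ∧ ∀ M, M₀ ≤ M → 8 * (ENNReal.ofReal (1 / M) * X) ≤ 1 := by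
  refine ⟨8 * X.toReal + 1, by positivity, fun M hM => ?_⟩
  have hX0 : 0 ≤ X.toReal := ENNReal.toReal_nonneg
  have hM0 : 0 < M := by linarith
  rw [← ENNReal.ofReal_toReal hX, ← ENNReal.ofReal_mul (by positivity),
    show (8 : ℝ≥0∞) = ENNReal.ofReal 8 by simp, ← ENNReal.ofReal_mul (by norm_num),
    ENNReal.ofReal_le_one, ← mul_assoc, mul_one_div, div_mul_eq_mul_div, div_le_one hM0]
  linarith

end

end

end WKB

theorem theorem1
    -- the nonlinearities `f(s) = μ s^σ`, `g(s) = α s^γ`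
    (α μ : ℝ) (γ σ : ℕ) (hγ : 1 ≤ γ) (hσ : 1 ≤ σ)
    (ℓ : ℝ) (hℓ : 1 < ℓ) (R : ℝ≥0) :
    -- `M₀` depends only on the nonlinearities, on `ℓ` and on the bound `R` of the initial data
    ∃ M₀ : ℝ, 0 < M₀ ∧
      ∀ (w₀ : ℝ), 0 < w₀ → ∀ (φ₀ : ℝ → ℝ → ℝ) (a₀ : ℝ → ℝ → ℂ),
      (∀ ε ∈ Icc (0 : ℝ) 1,
        WKB.MemH w₀ (ℓ + 1) (WKB.toC (φ₀ ε)) ∧ WKB.MemH w₀ ℓ (a₀ ε) ∧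
        WKB.normSq w₀ (ℓ + 1) (WKB.toC (φ₀ ε)) ≤ (R : ℝ≥0∞) ^ 2 ∧
        WKB.normSq w₀ ℓ (a₀ ε) ≤ (R : ℝ≥0∞) ^ 2) →
      ∀ M : ℝ, M₀ ≤ M → ∀ T : ℝ, 0 < T → T < w₀ / M →
      ∀ ε ∈ Icc (0 : ℝ) 1,
        ∃ (φ : ℝ → ℝ → ℝ) (a : ℝ → ℝ → ℂ),
          (WKB.MemX (fun t => w₀ - M * t) T ℓ φ a ∧
            WKB.IsSolution (fun s => μ * s ^ σ) (fun s => α * s ^ γ) ε T (φ₀ ε) (a₀ ε) φ a) ∧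
          (∀ (φ' : ℝ → ℝ → ℝ) (a' : ℝ → ℝ → ℂ),
            WKB.MemX (fun t => w₀ - M * t) T ℓ φ' a' →
            WKB.IsSolution (fun s => μ * s ^ σ) (fun s => α * s ^ γ) ε T (φ₀ ε) (a₀ ε) φ' a' →
            ∀ t ∈ Icc 0 T, φ' t = φ t ∧ a' t = a t) ∧
          WKB.tripleSq (fun t => w₀ - M * t) M (ℓ + 1) T (fun t => WKB.toC (φ t))
            ≤ 4 * WKB.normSq w₀ (ℓ + 1) (WKB.toC (φ₀ ε))
              + WKB.normSq w₀ ℓ (a₀ ε) ^ (2 * σ) ∧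
          WKB.tripleSq (fun t => w₀ - M * t) M ℓ T a ≤ 2 * WKB.normSq w₀ ℓ (a₀ ε) := by
  obtain ⟨n, rfl⟩ : ∃ n, γ = n + 1 := ⟨γ - 1, by omega⟩
  obtain ⟨m, rfl⟩ : ∃ m, σ = m + 1 := ⟨σ - 1, by omega⟩
  -- The solution lives in the ball of radius `R + 1`; uniqueness needs the contraction in the ball of
  -- radius `R + 2`.
  set K : ℝ≥0∞ := R + 1 with hKdef
  have hK : K ≠ ∞ := by finiteness
  have hK1 : 1 ≤ K := le_add_self
  set C : ℝ≥0∞ := ‖(μ : ℂ)‖ₑ * WKB.algConst ℓ ^ (2 * m + 1) * 2 ^ (m + 1) with hC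
  have hCt : C ≠ ∞ := by
    have := WKB.algConst_ne_top (s := ℓ) (by linarith)
    have : ‖(μ : ℂ)‖ₑ ≠ ∞ := enorm_ne_top
    finiteness
  have hL1 := WKB.nonlinLip_ne_top α μ n m hℓ hK
  have hL2 := WKB.nonlinLip_ne_top α μ n m hℓ (ENNReal.add_ne_top.2 ⟨hK, ENNReal.one_ne_top⟩)
  obtain ⟨M₀, hM₀, hsmall⟩ := WKB.exists_forall_ofReal_inv_mul_le
    (ENNReal.add_ne_top.2 ⟨ENNReal.add_ne_top.2 ⟨hL1, hL2⟩, hCt⟩)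
  refine ⟨M₀, hM₀, fun w₀ hw₀ φ₀ a₀ hdata M hMM T hT hTw ε hε => ?_⟩
  obtain ⟨hφ₀, ha₀, nφ₀, na₀⟩ := hdata ε hε
  have hM : 0 < M := hM₀.trans_le hMM
  have hw : 0 < w₀ - M * T := by
    rw [lt_div_iff₀ hM] at hTw
    linarith
  have hw0 : ∀ t ∈ Icc 0 T, 0 ≤ w₀ - M * t := fun t ht => by
    have := mul_le_mul_of_nonneg_left ht.2 hM.le
    linarith
  have hs := hsmall M hMM
  have hs1 : 8 * (ENNReal.ofReal (1 / M) * WKB.nonlinLip α μ n m ℓ K) ≤ 1 :=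
    le_trans (by gcongr; exact le_self_add.trans le_self_add) hs
  have hs2 : 8 * (ENNReal.ofReal (1 / M) * WKB.nonlinLip α μ n m ℓ (K + 1)) ≤ 1 :=
    le_trans (by gcongr; exact le_add_self.trans le_self_add) hs
  have hs3 : 8 * (ENNReal.ofReal (1 / M) * C) ≤ 1 :=
    le_trans (by gcongr; exact le_add_self) hs
  have half : ∀ {x : ℝ≥0∞}, 8 * x ≤ 1 → x ≤ 1 / 2 := fun {x} hx => by
    rw [ENNReal.le_div_iff_mul_le (by norm_num) (by norm_num), mul_comm]
    exact le_trans (by gcongr; norm_num) hx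
  rw [WKB.normSq_eq] at nφ₀ na₀
  have nu₀ := (ENNReal.pow_le_pow_left_iff two_ne_zero).1 nφ₀
  have nv₀ := (ENNReal.pow_le_pow_left_iff two_ne_zero).1 na₀
  have nu₀' := ne_top_of_le_ne_top ENNReal.coe_ne_top nu₀
  have nv₀' := ne_top_of_le_ne_top ENNReal.coe_ne_top nv₀
  have mu₀ := WKB.measurable_hat (WKB.toC (φ₀ ε))
  have mv₀ := WKB.measurable_hat (a₀ ε)
  obtain ⟨u, v, h⟩ := WKB.exists_isMild α μ n m ε mu₀ mv₀ (WKB.conjHat_hat_toC hw₀ hφ₀) hM hT.le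
    hw0 hℓ ENNReal.coe_ne_top nu₀ nv₀ (half hs1)
  have hre : ∀ t ∈ Icc 0 T, WKB.toC (fun x => (WKB.synth (u t) x).re) = WKB.synth (u t) :=
    fun t ht => h.toC_re_synth ht
  have hw1 : ∀ t ∈ Icc 0 T, w₀ - M * T ≤ w₀ - M * t := fun t ht => by
    have := mul_le_mul_of_nonneg_left ht.2 hM.le
    linarith
  have Du := (h.wtFam_phase hM hT.le hw hℓ hK mu₀ nu₀').decayFam hw hw1
  have Dv := (h.wtFam_amp hM hT.le hw hℓ hK mv₀ nv₀').decayFam hw hw1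
  obtain ⟨bu, bv⟩ := h.supN_sq_le hM hw0 hℓ hK hK1 mu₀ mv₀ nu₀' nv₀' hs1 hs3
  refine ⟨fun t x => (WKB.synth (u t) x).re, fun t => WKB.synth (v t),
    h.isSolution hM hT.le hw hℓ hK mu₀ nu₀' mv₀ nv₀' (WKB.synth_hat_ae_eq hw₀ hφ₀)
      (WKB.synth_hat_ae_eq hw₀ ha₀) hre (fun t _ => rfl), fun φ' a' hX hS t ht => ?_, ?_, ?_⟩
  · obtain ⟨h1, h2⟩ := h.unique hM hT.le hw hℓ hK rfl nu₀' rfl nv₀' (half hs2) hX hS ht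
    exact ⟨funext fun x => congrArg Complex.re (congrFun h1 x), h2⟩
  · rw [WKB.normSq_eq, WKB.normSq_eq]
    refine (WKB.tripleSq_le_supN_sq hM fun t ht r => ?_).trans bu
    rw [hre t ht, WKB.normSq_synth _ _ (Du.expDecay ht)]
  · rw [WKB.normSq_eq]
    refine (WKB.tripleSq_le_supN_sq hM fun t ht r => ?_).trans bv
    rw [WKB.normSq_synth _ _ (Dv.expDecay ht)]
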